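/- Let $b\in\mathbb{R}$ and $\mathbb{S}^1=\mathbb{R}/\mathbb{Z}$. Let $\mathrm{C}^\infty(\mathbb{S}^1)$ be the Fréchet space of smooth real functions on $\mathbb{S}^1$ (smooth $1$-periodic functions on $\mathbb{R}$) with the topology of all $C^n$-norms; it is identified with the space $\mathrm{Vect}^\infty(\mathbb{S}^1)$ of smooth vector fields. Let $\mathrm{Diff}^\infty(\mathbb{S}^1)$ be the group of smooth orientation-preserving diffeomorphisms of $\mathbb{S}^1$, with the Fréchet manifold structure modelled on $\mathrm{C}^\infty(\mathbb{S}^1)$ given by the two charts $\varphi\mapsto f-\mathrm{id}$, where $f$ is the lift of $\varphi$ to $\mathbb{R}$ with $-\tfrac12<f(0)<\tfrac12$, respectively $0<f(0)<1$. A map between open subsets of Fréchet spaces is $C^1$ if it is continuous, all its directional derivatives $Df(x)h=\lim_{\varepsilon\to0}\varepsilon^{-1}(f(x+\varepsilon h)-f(x))$ exist and $(x,h)\mapsto Df(x)h$ is continuous; $C^n$ is defined inductively, and smooth means $C^n$ for all $n$. Smoothness of maps from or to $\mathrm{Diff}^\infty(\mathbb{S}^1)$ is smoothness in the charts. Put $A=I-\frac{d^2}{dx^2}$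 (a bijection of $\mathrm{C}^\infty(\mathbb{S}^1)$), $[u,w]=u_xw-uw_x$ and $$B(u,w)=\tfrac12A^{-1}\big[u(Aw)_x+w(Au)_x+b(Au)w_x+b(Aw)u_x\big].$$ The right-invariant symmetric connection of the $b$-equation $m_t=-(m_xu+b\,m\,u_x)$, $m=u-u_{xx}$, is given by the covariant derivative $w_t+\tfrac12[u,w]+B(u,w)$ along a smooth curve $\varphi(t)$ in $\mathrm{Diff}^\infty(\mathbb{S}^1)$ with Eulerian velocity $u=\varphi_t\circ\varphi^{-1}$, where a vector field along $\varphi$ is represented, by right translation, by a curve $w(t)$ in $\mathrm{C}^\infty(\mathbb{S}^1)$. A geodesic is a smooth curve $\varphi$ for which the covariant derivative of $\varphi_t$ (that is, of $w=u$) vanishes. The exponential map $\mathfrak{exp}$ at $\mathrm{id}$ sends $u_0$ to $\varphi(1)$, where $\varphi$ is a geodesic, defined on an open interval containing $[0,1]$, with $\varphi(0)=\mathrm{id}$ and $\varphi_t(0)=u_0$. **Theorem.** There are an open neighbourhood $U$ of $0$ in $\mathrm{Vect}^\infty(\mathbb{S}^1)=\mathrm{C}^\infty(\mathbb{S}^1)$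 and an open neighbourhood $V$ of $\mathrm{id}$ in $\mathrm{Diff}^\infty(\mathbb{S}^1)$ such that $\mathfrak{exp}$ is well defined on $U$ (for every $u_0\in U$ such a geodesic exists and $\varphi(1)$ does not depend on its choice) and $\mathfrak{exp}:U\to V$ is a bijection that is smooth with smooth inverse. -/

import Mathlib

open Set Filter Topology
open scoped ContDiff

noncomputable section

/-! ### Differential calculus in topological vector spaces -/

section Calculus

universe u v

/-- `f'` is the directional (Gâteaux) derivative `D f (x) h = lim_{ε → 0} (f (x + ε h) - f x) / ε`.
For a curve (`X = ℝ`, `h = 1`) this is the derivative at the time `x`. -/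
def HasDirDerivAt {X : Type u} {Y : Type v} [AddCommGroup X] [Module ℝ X]
    [AddCommGroup Y] [Module ℝ Y] [TopologicalSpace Y] (f : X → Y) (f' : Y) (x h : X) : Prop :=
  Tendsto (fun ε : ℝ => ε⁻¹ • (f (x + ε • h) - f x)) (𝓝[≠] 0) (𝓝 f')

/-- `f` is of class `C^n` on the (open) set `U`: it is continuous and, for `n = k + 1`, all directional
derivatives exist on `U` and `(x, h) ↦ D f (x) h` is of class `C^k` on `U × X`. -/
def IsClassC : ℕ → ∀ {X : Type u} {Y : Type v} [AddCommGroup X] [Module ℝ X] [TopologicalSpace X]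
    [AddCommGroup Y] [Module ℝ Y] [TopologicalSpace Y], (X → Y) → Set X → Prop
  | 0, _, _, _, _, _, _, _, _, f, U => ContinuousOn f U
  | k + 1, X, Y, _, _, _, _, _, _, f, U => ContinuousOn f U ∧
      ∃ f' : X × X → Y, (∀ x ∈ U, ∀ h : X, HasDirDerivAt f (f' (x, h)) x h) ∧
        IsClassC k f' (U ×ˢ (Set.univ : Set X))

/-- Smoothness on the (open) set `U` of a map between topological vector spaces. -/
def IsSmoothOn {X : Type u} {Y : Type v} [AddCommGroup X] [Module ℝ X] [TopologicalSpace X]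
    [AddCommGroup Y] [Module ℝ Y] [TopologicalSpace Y] (f : X → Y) (U : Set X) : Prop :=
  ∀ n : ℕ, IsClassC n f U

end Calculus

/-! ### The Fréchet space `C^∞(S¹)`, where `S¹ = ℝ / ℤ` -/

/-- Smooth real functions on the circle, that is smooth `1`-periodic functions on `ℝ`. -/
def circleFunSubalgebra : Subalgebra ℝ (ℝ → ℝ) where
  carrier := {u | ContDiff ℝ ∞ u ∧ Function.Periodic u 1}
  mul_mem' := fun ha hb => ⟨ha.1.mul hb.1, ha.2.mul hb.2⟩
  add_mem' := fun ha hb => ⟨ha.1.add hb.1, ha.2.add hb.2⟩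
  algebraMap_mem' := fun _ => ⟨contDiff_const, fun _ => rfl⟩

/-- The space `C^∞(S¹)` of smooth real functions on the circle, which is also the space `Vect^∞(S¹)` of
smooth vector fields on the circle (the function `u` is the vector field `u(x) ∂ₓ`). -/
def CircleFun : Type := circleFunSubalgebra

namespace CircleFun

instance : CommRing CircleFun := inferInstanceAs (CommRing circleFunSubalgebra)
instance : Algebra ℝ CircleFun := inferInstanceAs (Algebra ℝ circleFunSubalgebra)

/-- The underlying `1`-periodic function on `ℝ`. -/
def toFun (u : CircleFun) : ℝ → ℝ := Subtype.val (p := (· ∈ circleFunSubalgebra)) u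

instance : CoeFun CircleFun (fun _ => ℝ → ℝ) := ⟨toFun⟩

theorem contDiff (u : CircleFun) : ContDiff ℝ ∞ (u : ℝ → ℝ) := u.2.1

theorem periodic (u : CircleFun) : Function.Periodic (u : ℝ → ℝ) 1 := u.2.2

theorem differentiable (u : CircleFun) : Differentiable ℝ (u : ℝ → ℝ) :=
  u.contDiff.differentiable (by simp)

theorem ext' {u v : CircleFun} (h : ∀ x : ℝ, u x = v x) : u = v := Subtype.ext (funext h)

theorem periodic_int (u : CircleFun) (x : ℝ) (n : ℤ) : u (x + n) = u x := by
  simpa using u.periodic.int_mul n x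

/-- The Fréchet topology: uniform convergence of all derivatives, that is the topology given by the
family of all `C^n`-norms. -/
instance : TopologicalSpace CircleFun :=
  TopologicalSpace.induced
    (fun (u : CircleFun) (k : ℕ) => (UniformFun.ofFun (iteratedDeriv k (u : ℝ → ℝ)) : UniformFun ℝ ℝ))
    inferInstance

/-- The derivative `u ↦ u_x`. -/
def dx : CircleFun →ₗ[ℝ] CircleFun where
  toFun u := ⟨deriv u, (contDiff_infty_iff_deriv.1 u.contDiff).2, fun x => by
    rw [← deriv_comp_add_const]
    exact congrArg (fun g => deriv g x) u.periodic.funext⟩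
  map_add' u v := ext' fun x => deriv_add (u.differentiable x) (v.differentiable x)
  map_smul' c u := ext' fun x => deriv_const_smul c (u.differentiable x)

theorem hasDerivAt (u : CircleFun) (x : ℝ) : HasDerivAt (u : ℝ → ℝ) (dx u x) x :=
  (u.differentiable x).hasDerivAt

/-- The operator `A = I - d²/dx²`. -/
def opA : CircleFun →ₗ[ℝ] CircleFun := LinearMap.id - dx ∘ₗ dx

theorem dx_add_smul_bijective {a : ℝ} (ha : a ≠ 0) :
    Function.Bijective (dx + a • LinearMap.id : CircleFun →ₗ[ℝ] CircleFun) := by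
  have hea : Real.exp a - 1 ≠ 0 := by
    rw [sub_ne_zero]
    simpa using ha
  have hexp : ∀ x : ℝ, HasDerivAt (fun y => Real.exp (a * y)) (a * Real.exp (a * x)) x := by
    intro x
    have := ((hasDerivAt_id x).const_mul a).exp
    simpa [mul_comm] using this
  constructor
  · rw [← LinearMap.ker_eq_bot, LinearMap.ker_eq_bot']
    intro u hu
    have hu' : ∀ x, dx u x + a * u x = 0 := fun x => congrArg (fun w : CircleFun => w x) hu
    have hd : ∀ x : ℝ, HasDerivAt (fun y => Real.exp (a * y) * u y) 0 x := by
      intro x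
      have h0 : a * Real.exp (a * x) * u x + Real.exp (a * x) * dx u x = 0 := by
        linear_combination Real.exp (a * x) * hu' x
      have h1 := (hexp x).mul (u.hasDerivAt x)
      rw [h0] at h1
      exact h1
    have hc := is_const_of_deriv_eq_zero (fun x => (hd x).differentiableAt) (fun x => (hd x).deriv)
    refine ext' fun x => ?_
    have h1 := hc (x + 1) x
    have h2 : u (x + 1) = u x := u.periodic x
    rw [h2, mul_add, mul_one, Real.exp_add] at h1
    have h3 : Real.exp (a * x) * u x * (Real.exp a - 1) = 0 := by linear_combination h1
    have h4 := (mul_eq_zero.1 h3).resolve_right hea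
    exact (mul_eq_zero.1 h4).resolve_left (Real.exp_pos _).ne'
  · intro w
    set g : ℝ → ℝ := fun s => Real.exp (a * s) * w s with hg
    have hgs : ContDiff ℝ ∞ g := (Real.contDiff_exp.comp (contDiff_const.mul contDiff_id)).mul w.contDiff
    have hgc : Continuous g := hgs.continuous
    set q : ℝ → ℝ := fun x => ∫ s in (0 : ℝ)..x, g s with hq
    have hqd : ∀ x, HasDerivAt q (g x) x := fun x => hgc.integral_hasStrictDerivAt 0 x |>.hasDerivAt
    have hqs : ContDiff ℝ ∞ q := contDiff_infty_iff_deriv.2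
      ⟨fun x => (hqd x).differentiableAt, by
        rw [show deriv q = g from funext fun x => (hqd x).deriv]; exact hgs⟩
    have hqp : ∀ x, q (x + 1) = q 1 + Real.exp a * q x := by
      intro x
      have h1 : ∫ s in (0 : ℝ)..x, g (s + 1) = ∫ s in (0 + 1 : ℝ)..(x + 1), g s :=
        intervalIntegral.integral_comp_add_right (fun s => g s) 1
      have h2 : ∀ s, g (s + 1) = Real.exp a * g s := by
        intro s
        have : w (s + 1) = w s := w.periodic s
        simp only [hg]
        rw [this, mul_add, mul_one, Real.exp_add]
        ring
      simp only [h2, intervalIntegral.integral_const_mul, zero_add] at h1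
      simp only [hq]
      rw [h1]
      exact (intervalIntegral.integral_add_adjacent_intervals (hgc.intervalIntegrable _ _)
        (hgc.intervalIntegrable _ _)).symm
    set c : ℝ := q 1 / (Real.exp a - 1) with hc
    have hcc : c + q 1 = Real.exp a * c := by
      rw [hc]
      field_simp
      ring
    set f : ℝ → ℝ := fun x => Real.exp (-(a * x)) * (c + q x) with hf
    have hfs : ContDiff ℝ ∞ f :=
      (Real.contDiff_exp.comp (contDiff_const.mul contDiff_id).neg).mul (contDiff_const.add hqs)
    have hfp : Function.Periodic f 1 := by
      intro x
      simp only [hf]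
      rw [hqp, ← add_assoc, hcc, ← mul_add, ← mul_assoc, ← Real.exp_add]
      congr 2
      ring
    refine ⟨⟨f, hfs, hfp⟩, ext' fun x => ?_⟩
    have he : HasDerivAt (fun y => Real.exp (-(a * y))) (-(a * Real.exp (-(a * x)))) x := by
      have := ((hasDerivAt_id x).const_mul a).neg.exp
      simpa [mul_comm] using this
    have hfd : HasDerivAt f (w x - a * f x) x := by
      have hone : Real.exp (-(a * x)) * Real.exp (a * x) = 1 := by
        rw [← Real.exp_add]; simp
      have h0 : -(a * Real.exp (-(a * x))) * (c + q x) + Real.exp (-(a * x)) * g x = w x - a * f x := by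
        simp only [hf, hg]
        linear_combination (w x) * hone
      have h1 := he.mul ((hqd x).const_add c)
      rw [h0] at h1
      exact h1
    change deriv f x + a * f x = w x
    rw [hfd.deriv]
    ring

theorem opA_bijective : Function.Bijective opA := by
  have h1 := dx_add_smul_bijective (a := 1) one_ne_zero
  have h2 := dx_add_smul_bijective (a := -1) (neg_ne_zero.2 one_ne_zero)
  have h : (opA : CircleFun → CircleFun) = (fun u => -u) ∘
      (dx + (-1 : ℝ) • LinearMap.id : CircleFun →ₗ[ℝ] CircleFun) ∘
        (dx + (1 : ℝ) • LinearMap.id : CircleFun →ₗ[ℝ] CircleFun) := by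
    funext u
    simp [opA, sub_eq_add_neg]
  rw [h]
  exact (Equiv.neg CircleFun).bijective.comp (h2.comp h1)

/-- The inverse `A⁻¹` of the operator `A = I - d²/dx²` on `C^∞(S¹)`. -/
def opAInv : CircleFun →ₗ[ℝ] CircleFun := (LinearEquiv.ofBijective opA opA_bijective).symm

/-- The Lie bracket `[u, w] = u_x w - u w_x` of the Lie algebra of the diffeomorphism group. -/
def bracket (u w : CircleFun) : CircleFun := dx u * w - u * dx w

/-- The symmetric bilinear operator of the `b`-equation,
`B(u, w) = ½ A⁻¹ [u (A w)_x + w (A u)_x + b (A u) w_x + b (A w) u_x]`. -/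
def opB (b : ℝ) (u w : CircleFun) : CircleFun :=
  (1 / 2 : ℝ) • opAInv (u * dx (opA w) + w * dx (opA u) + b • (opA u * dx w) + b • (opA w * dx u))

end CircleFun

/-! ### The Fréchet Lie group `Diff^∞(S¹)` -/

/-- `f` is a smooth lift of degree one of the self-map `φ` of the circle. -/
def IsSmoothLift (f : ℝ → ℝ) (φ : UnitAddCircle → UnitAddCircle) : Prop :=
  ContDiff ℝ ∞ f ∧ (∀ x, f (x + 1) = f x + 1) ∧ ∀ x : ℝ, φ (x : UnitAddCircle) = (f x : UnitAddCircle)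

theorem IsSmoothLift.comp {f g : ℝ → ℝ} {φ ψ : UnitAddCircle → UnitAddCircle}
    (hf : IsSmoothLift f φ) (hg : IsSmoothLift g ψ) : IsSmoothLift (f ∘ g) (φ ∘ ψ) :=
  ⟨hf.1.comp hg.1, fun x => by simp [hg.2.1, hf.2.1], fun x => by simp [hg.2.2, hf.2.2]⟩

/-- The group of smooth orientation preserving diffeomorphisms of the circle: bijections of the circle
such that they and their inverses are smooth of degree one. -/
def circleDiffSubgroup : Subgroup (Equiv.Perm UnitAddCircle) where
  carrier := {φ | (∃ f, IsSmoothLift f φ) ∧ ∃ g, IsSmoothLift g φ.symm}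
  mul_mem' := fun ⟨⟨f, hf⟩, ⟨g, hg⟩⟩ ⟨⟨f', hf'⟩, ⟨g', hg'⟩⟩ =>
    ⟨⟨f ∘ f', hf.comp hf'⟩, ⟨g' ∘ g, hg'.comp hg⟩⟩
  one_mem' := ⟨⟨id, contDiff_id, fun _ => rfl, fun _ => rfl⟩, ⟨id, contDiff_id, fun _ => rfl, fun _ => rfl⟩⟩
  inv_mem' := fun ⟨hf, hg⟩ => ⟨hg, hf⟩

/-- The group `Diff^∞(S¹)` of smooth orientation preserving diffeomorphisms of the circle. -/
def CircleDiff : Type := circleDiffSubgroup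

namespace CircleDiff

instance : Group CircleDiff := inferInstanceAs (Group circleDiffSubgroup)

/-- The underlying bijection of the circle. -/
def toPerm (φ : CircleDiff) : Equiv.Perm UnitAddCircle := Subtype.val (p := (· ∈ circleDiffSubgroup)) φ

instance : CoeFun CircleDiff (fun _ => UnitAddCircle → UnitAddCircle) := ⟨fun φ => φ.toPerm⟩

theorem ext' {φ ψ : CircleDiff} (h : ∀ x : UnitAddCircle, φ x = ψ x) : φ = ψ :=
  Subtype.ext (Equiv.ext h)

/-- Some lift of `φ`; any two lifts differ by an integer constant. -/
def lift (φ : CircleDiff) : ℝ → ℝ := φ.2.1.choose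

theorem lift_spec (φ : CircleDiff) : IsSmoothLift φ.lift φ := φ.2.1.choose_spec

theorem isSmoothLift_ofDisplacement (u : CircleFun) (h : ∀ x, -1 < deriv u x) :
    ∃ φ : CircleDiff, IsSmoothLift (fun x => x + u x) φ := by
  set f : ℝ → ℝ := fun x => x + u x with hf
  have hfs : ContDiff ℝ ∞ f := contDiff_id.add u.contDiff
  have hfd : ∀ x, HasDerivAt f (1 + deriv u x) x := fun x =>
    (hasDerivAt_id x).add (u.hasDerivAt x)
  have hpos : ∀ x, 0 < 1 + deriv u x := fun x => by linarith [h x]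
  have hmono : StrictMono f := strictMono_of_deriv_pos fun x => by rw [(hfd x).deriv]; exact hpos x
  have hint : ∀ (x : ℝ) (n : ℤ), f (x + n) = f x + n := fun x n => by
    simp only [hf, u.periodic_int]; ring
  have hsurj : Function.Surjective f := by
    intro y
    refine mem_range_of_exists_le_of_exists_ge hfs.continuous ⟨(⌊y - f 0⌋ : ℝ), ?_⟩ ⟨(⌈y - f 0⌉ : ℝ), ?_⟩
    · have := hint 0 ⌊y - f 0⌋
      rw [zero_add] at this
      rw [this]
      linarith [Int.floor_le (y - f 0)]
    · have := hint 0 ⌈y - f 0⌉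
      rw [zero_add] at this
      rw [this]
      linarith [Int.le_ceil (y - f 0)]
  set F : ℝ ≃o ℝ := StrictMono.orderIsoOfSurjective f hmono hsurj with hF
  have hFf : ∀ x, F x = f x := fun x => rfl
  have hgs : ContDiff ℝ ∞ F.symm :=
    F.toHomeomorph.contDiff_symm_deriv (fun x => (hpos x).ne') hfd hfs
  have hginv : ∀ x, F.symm (x + 1) = F.symm x + 1 := by
    intro x
    rw [F.symm_apply_eq, hFf]
    have := hint (F.symm x) 1
    simp only [Int.cast_one] at this
    rw [this, ← hFf, F.apply_symm_apply]
  have hf1 : ∀ x, f (x + 1) = f x + 1 := fun x => by simpa using hint x 1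
  have hp : Function.Periodic (fun x => (f x : UnitAddCircle)) 1 := fun x => by simp [hf1]
  have hq : Function.Periodic (fun x => (F.symm x : UnitAddCircle)) 1 := fun x => by simp [hginv]
  let e : Equiv.Perm UnitAddCircle :=
    { toFun := hp.lift
      invFun := hq.lift
      left_inv := fun z => by
        obtain ⟨x, rfl⟩ := QuotientAddGroup.mk_surjective z
        rw [Function.Periodic.lift_coe, Function.Periodic.lift_coe, ← hFf, F.symm_apply_apply]
      right_inv := fun z => by
        obtain ⟨x, rfl⟩ := QuotientAddGroup.mk_surjective z
        rw [Function.Periodic.lift_coe, Function.Periodic.lift_coe, ← hFf, F.apply_symm_apply] }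
  have h1 : IsSmoothLift f e := ⟨hfs, hf1, fun x => Function.Periodic.lift_coe hp x⟩
  exact ⟨⟨e, ⟨f, h1⟩, ⟨F.symm, hgs, hginv, fun x => Function.Periodic.lift_coe hq x⟩⟩, h1⟩

open scoped Classical in
/-- For `u' > -1` this is the diffeomorphism with lift `id + u`. -/
def param (u : CircleFun) : CircleDiff :=
  if h : ∀ x, -1 < deriv u x then (isSmoothLift_ofDisplacement u h).choose else 1

/-- The domain `U_j` of the `j`-th chart parametrization: the functions `u` with `u' > -1` and
`-1/2 < u(0) < 1/2` for `j = 0`, respectively `0 < u(0) < 1` for `j = 1`. -/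
def chartDomain (j : Fin 2) : Set CircleFun :=
  {u | ![(-1 / 2 : ℝ), 0] j < u 0 ∧ u 0 < ![(1 / 2 : ℝ), 1] j ∧ ∀ x, -1 < deriv u x}

/-- The image `V_j` of the `j`-th chart parametrization; `V_0` and `V_1` cover the group. -/
def chartImage (j : Fin 2) : Set CircleDiff := param '' chartDomain j

/-- The `j`-th chart `V_j → U_j`, the inverse of `param` restricted to `U_j`: it sends `φ` to `f - id`,
where `f` is the lift of `φ` that satisfies the normalization of `f(0)` in `chartDomain j`. -/
def chart (j : Fin 2) : CircleDiff → CircleFun := Function.invFunOn param (chartDomain j)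

theorem param_spec {u : CircleFun} (h : ∀ x, -1 < deriv u x) :
    IsSmoothLift (fun x => x + u x) (param u) := by
  rw [param, dif_pos h]
  exact (isSmoothLift_ofDisplacement u h).choose_spec

theorem param_injOn (j : Fin 2) : Set.InjOn param (chartDomain j) := by
  intro u hu w hw huw
  have h1 := (param_spec hu.2.2).2.2
  have h2 := (param_spec hw.2.2).2.2
  rw [huw] at h1
  have h3 : ∀ x : ℝ, ∃ n : ℤ, u x - w x = n := by
    intro x
    have h4 : ((x + u x : ℝ) : UnitAddCircle) = ((x + w x : ℝ) : UnitAddCircle) :=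
      (h1 x).symm.trans (h2 x)
    rw [← sub_eq_zero, ← AddCircle.coe_sub, AddCircle.coe_eq_zero_iff] at h4
    obtain ⟨n, hn⟩ := h4
    refine ⟨n, ?_⟩
    simp only [zsmul_eq_mul, mul_one] at hn
    linarith
  choose n hn using h3
  have hcont : Continuous fun x => (n x : ℝ) := by
    have : (fun x => (n x : ℝ)) = fun x => u x - w x := funext fun x => (hn x).symm
    rw [this]
    exact u.contDiff.continuous.sub w.contDiff.continuous
  have hnc : Continuous n := Int.isClosedEmbedding_coe_real.isInducing.continuous_iff.2 hcont
  have hconst : ∀ x, n x = n 0 := fun x =>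
    (PreconnectedSpace.constant inferInstance hnc)
  have h0 : n 0 = 0 := by
    have a := hu.1
    have a' := hu.2.1
    have c := hw.1
    have c' := hw.2.1
    have h00 := hn 0
    have hlt : |(n 0 : ℝ)| < 1 := by
      rw [abs_lt]
      fin_cases j <;> simp at a a' c c' <;> constructor <;> linarith
    exact Int.abs_lt_one_iff.1 (by exact_mod_cast hlt)
  refine CircleFun.ext' fun x => ?_
  have := hn x
  rw [hconst, h0, Int.cast_zero] at this
  linarith

/-- The manifold topology of `Diff^∞(S¹)`: a set is open if and only if its preimages under the two
chart parametrizations `U_j → Diff^∞(S¹)` are open. -/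
instance : TopologicalSpace CircleDiff :=
  ⨆ j : Fin 2, TopologicalSpace.coinduced ((chartDomain j).domRestrict param) inferInstance

/-- The map `R_φ : C^∞(S¹) → C^∞(S¹)`, `u ↦ u ∘ φ`. -/
def rightComp (φ : CircleDiff) (u : CircleFun) : CircleFun :=
  ⟨fun x => u (φ.lift x), u.contDiff.comp φ.lift_spec.1, fun x => by
    change u (φ.lift (x + 1)) = u (φ.lift x)
    rw [φ.lift_spec.2.1]; exact u.periodic _⟩

/-- Smoothness on the open set `S` of a map with values in the Fréchet manifold `Diff^∞(S¹)`. -/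
def SmoothOnInto {X : Type*} [AddCommGroup X] [Module ℝ X] [TopologicalSpace X]
    (F : X → CircleDiff) (S : Set X) : Prop :=
  ContinuousOn F S ∧ ∀ j, IsSmoothOn (fun x => chart j (F x)) (S ∩ F ⁻¹' chartImage j)

/-- Smoothness on the open set `S` of a map defined on the Fréchet manifold `Diff^∞(S¹)`. -/
def SmoothOnFrom {Y : Type*} [AddCommGroup Y] [Module ℝ Y] [TopologicalSpace Y]
    (G : CircleDiff → Y) (S : Set CircleDiff) : Prop :=
  ∀ j, IsSmoothOn (fun u => G (param u)) (chartDomain j ∩ param ⁻¹' S)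

/-- The velocity `φ_t` at time `t` of the curve `φ` is `v`, in the trivialization
`T Diff^∞(S¹) = Diff^∞(S¹) × C^∞(S¹)` given by the charts (the charts differ by constants). -/
def HasVelocityAt (φ : ℝ → CircleDiff) (v : CircleFun) (t : ℝ) : Prop :=
  ∀ j, φ t ∈ chartImage j → HasDirDerivAt (fun s => chart j (φ s)) v t 1

/-- The covariant derivative at time `t` of the vector field `w` along a curve with Eulerian velocity `u`,
for the right invariant symmetric connection of the `b`-equation, is `z`, where
`z = w_t + ½ [u, w] + B(u, w)`. Tangent vectors are identified with elements of the
Lie algebra `C^∞(S¹)` by right translation. -/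
def HasCovDerivAt (b : ℝ) (u w : ℝ → CircleFun) (z : CircleFun) (t : ℝ) : Prop :=
  ∃ w' : CircleFun, HasDirDerivAt w w' t 1 ∧
    z = w' + (1 / 2 : ℝ) • CircleFun.bracket (u t) (w t) + CircleFun.opB b (u t) (w t)

/-- `φ` is a geodesic on the open interval `J` for the connection of the `b`-equation: it is a smooth curve
and the covariant derivative along `φ` of `φ_t`, represented by the Eulerian velocity
`u = φ_t ∘ φ⁻¹`, vanishes. -/
def IsGeodesicOn (b : ℝ) (φ : ℝ → CircleDiff) (J : Set ℝ) : Prop :=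
  SmoothOnInto φ J ∧ ∃ v : ℝ → CircleFun, (∀ t ∈ J, HasVelocityAt φ (v t) t) ∧
    ∀ t ∈ J, HasCovDerivAt b (fun s => rightComp (φ s)⁻¹ (v s)) (fun s => rightComp (φ s)⁻¹ (v s)) 0 t

/-- `ψ` is the time-one value of a geodesic that starts at the identity with velocity `u₀`. -/
def IsTimeOne (b : ℝ) (u₀ : CircleFun) (ψ : CircleDiff) : Prop :=
  ∃ α β : ℝ, α < 0 ∧ 1 < β ∧ ∃ φ : ℝ → CircleDiff, IsGeodesicOn b φ (Ioo α β) ∧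
    φ 0 = 1 ∧ HasVelocityAt φ u₀ 0 ∧ φ 1 = ψ

open scoped Classical in
/-- The exponential map at the identity of the connection of the `b`-equation: it sends `u₀` to the time-one
value of the geodesic that starts at the identity with velocity `u₀` (and to `1` if there is none). -/
def expMap (b : ℝ) (u₀ : CircleFun) : CircleDiff :=
  if h : ∃ ψ, IsTimeOne b u₀ ψ then h.choose else 1

end CircleDiff

end

noncomputable section

set_option linter.unusedSectionVars false

/-! ### Exponential and logarithm in commutative Banach algebras -/

section BanachExp

open NormedSpace

variable {A : Type*} [NormedCommRing A] [NormedAlgebra ℝ A] [CompleteSpace A]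

/-! Write `φ = id + q`. A curve is a geodesic exactly when `m₀ = ((A u) ∘ φ) φₓ^b` is constant in
time (`hasDerivAt_transport`, `hasCovDerivAt_self_iff`). Conversely `φ` and `m₀` determine `u ∘ φ`:
the functions `(u ∓ uₓ) ∘ φ` solve linear first-order equations in `x`, whose periodic solutions are
obtained from the integrating factors `e^(±q)` and the bounded resolvents `(1 ± ∂ₓ)⁻¹`. In the
coordinate `z = q + qₓ` the geodesic equation therefore becomes `z_t = field b z m₀`. This is an
ordinary differential equation in the Banach space of continuous functions, without loss of
derivatives; its right-hand side is analytic on `{φₓ > 0}` and linear in `m₀`.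

Existence and analytic dependence on `m₀` come from the implicit function theorem for the integral
equation in the Banach algebra of paths over `[-1, 1]` (`PathC.exists_solution`); small momenta take
the place of small times. The formulas are written once, in `LagrangeField`, for a commutative
Banach algebra, and used both for functions and for paths.

The map `m₀ ↦ A q(1)` of continuous functions (`endMomentum`) is analytic with derivative the
identity at `0`, hence locally invertible with analytic inverse. No inverse function theorem is
needed in the Fréchet space, because neither this map nor its inverse loses regularity. If `m₀` has
`n` derivatives, then `q`, `φₓ` and the velocities have `n + 1` (`goodN_flow`). Moreover `A q(1) = K
m₀ + (terms one order smoother than m₀)` with `K > 0`, so regularity of `A q(1)` passes back to `m₀`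
by bootstrapping (`goodN_of_endMomentum`). All orders are treated on the same neighbourhood, which
is defined by the uniform norm of the momentum.

Smoothness in the Fréchet sense is reduced to Banach calculus: it suffices that every derivative in
`x` of the map factors through a continuous linear map and a smooth map of normed spaces
(`isClassC_of_jets`, `GoodN.jet`). Finally, solutions of the ordinary differential equation are
identified with geodesics (`exists_geodesic`), and geodesics are unique since they solve a locally
Lipschitz equation in every chart (`geodesic_unique`). -/

theorem banach_contDiff_exp : ContDiff ℝ ω (exp : A → A) :=
  contDiff_iff_contDiffAt.2 fun x => (exp_analytic (𝕂 := ℝ) x).contDiffAt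

theorem banach_exp_add (x y : A) : exp (x + y) = exp x * exp y := by
  let _ : NormedAlgebra ℚ A := NormedAlgebra.restrictScalars ℚ ℝ A
  exact exp_add_of_commute (Commute.all x y)

theorem banach_exp_zero : exp (0 : A) = 1 := exp_zero

theorem banach_exp_mul_exp_neg (x : A) : exp x * exp (-x) = 1 := by
  rw [← banach_exp_add, add_neg_cancel, banach_exp_zero]

/-- The derivative of the exponential, as an invertible operator. -/
def expDerivEquiv (x : A) : A ≃L[ℝ] A :=
  ContinuousLinearEquiv.equivOfInverse (ContinuousLinearMap.mul ℝ A (exp x))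
    (ContinuousLinearMap.mul ℝ A (exp (-x)))
    (fun y => by
      simp only [ContinuousLinearMap.mul_apply']
      rw [← mul_assoc, mul_comm (exp (-x)), banach_exp_mul_exp_neg, one_mul])
    (fun y => by
      simp only [ContinuousLinearMap.mul_apply']
      rw [← mul_assoc, banach_exp_mul_exp_neg, one_mul])

theorem banach_hasStrictFDerivAt_exp (x : A) :
    HasStrictFDerivAt (exp : A → A) (expDerivEquiv x : A →L[ℝ] A) x := by
  have h := hasStrictFDerivAt_exp (𝕂 := ℝ) (x := x)
  convert! h using 1

/-- The derivative of `exp` at `x` is multiplication by the unit `exp x`, so `exp` is a local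
homeomorphism. The range serves as the set of "positive" elements, on which real powers are defined.
-/
theorem isOpen_range_exp : IsOpen (range (exp : A → A)) := by
  rw [isOpen_iff_mem_nhds]
  rintro _ ⟨x, rfl⟩
  rw [← (banach_hasStrictFDerivAt_exp x).map_nhds_eq_of_equiv]
  exact range_mem_map

/-- The logarithm: a right inverse of the exponential on its range. -/
def lg (p : A) : A := Function.invFun (exp : A → A) p

theorem exp_lg {p : A} (hp : p ∈ range (exp : A → A)) : exp (lg p) = p :=
  Function.invFun_eq hp

theorem lg_exp (hA : Function.Injective (exp : A → A)) (x : A) : lg (exp x) = x :=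
  Function.leftInverse_invFun hA x

/-- Global injectivity forces the chosen preimage to agree with the analytic local inverse of `exp`
near every point of the range. -/
theorem contDiffOn_lg (hA : Function.Injective (exp : A → A)) :
    ContDiffOn ℝ ω (lg : A → A) (range exp) := by
  rintro _ ⟨x, rfl⟩
  have hs := banach_contDiff_exp.contDiffAt (x := x)
  have h := hs.to_localInverse (banach_hasStrictFDerivAt_exp x).hasFDerivAt (by simp)
  refine (h.congr_of_eventuallyEq ?_).contDiffWithinAt
  have h2 := (hs.hasStrictFDerivAt' (banach_hasStrictFDerivAt_exp x).hasFDerivAt (by simp)).eventually_right_inverse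
  filter_upwards [h2] with y hy
  rw [← hy, lg_exp hA, hy]
  rfl

end BanachExp

/-! ### Continuous functions on the circle -/

/-- Continuous functions on the circle. -/
def CircleC : Type := C(UnitAddCircle, ℝ)

namespace CircleC

open NormedSpace

instance : NormedCommRing CircleC := inferInstanceAs (NormedCommRing C(UnitAddCircle, ℝ))
instance : NormedAlgebra ℝ CircleC := inferInstanceAs (NormedAlgebra ℝ C(UnitAddCircle, ℝ))
instance : CompleteSpace CircleC := inferInstanceAs (CompleteSpace C(UnitAddCircle, ℝ))

/-- The underlying continuous map. -/
def toMap (f : CircleC) : C(UnitAddCircle, ℝ) := f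

/-- The function given by a continuous map. -/
def ofMap (f : C(UnitAddCircle, ℝ)) : CircleC := f

instance : CoeFun CircleC (fun _ => UnitAddCircle → ℝ) := ⟨fun f => toMap f⟩

theorem continuous (f : CircleC) : Continuous (f : UnitAddCircle → ℝ) := (toMap f).continuous

theorem continuous_comp_coe (f : CircleC) : Continuous (fun x : ℝ => f (x : UnitAddCircle)) :=
  f.continuous.comp (AddCircle.continuous_mk' 1)

theorem ext' {f g : CircleC} (h : ∀ x, f x = g x) : f = g :=
  ContinuousMap.ext (f := toMap f) (g := toMap g) h

theorem ext_coe {f g : CircleC} (h : ∀ x : ℝ, f (x : UnitAddCircle) = g (x : UnitAddCircle)) : f = g :=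
  ext' fun z => by
    obtain ⟨x, rfl⟩ := QuotientAddGroup.mk_surjective z
    exact h x

theorem ofMap_apply (f : C(UnitAddCircle, ℝ)) (x : UnitAddCircle) : ofMap f x = f x := rfl
theorem add_apply (f g : CircleC) (x : UnitAddCircle) : (f + g) x = f x + g x := rfl
theorem sub_apply (f g : CircleC) (x : UnitAddCircle) : (f - g) x = f x - g x := rfl
theorem neg_apply (f : CircleC) (x : UnitAddCircle) : (-f) x = -f x := rfl
theorem mul_apply (f g : CircleC) (x : UnitAddCircle) : (f * g) x = f x * g x := rfl
theorem smul_apply (c : ℝ) (f : CircleC) (x : UnitAddCircle) : (c • f) x = c * f x := rfl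
theorem zero_apply (x : UnitAddCircle) : (0 : CircleC) x = 0 := rfl
theorem one_apply (x : UnitAddCircle) : (1 : CircleC) x = 1 := rfl
theorem algebraMap_apply (c : ℝ) (x : UnitAddCircle) : (algebraMap ℝ CircleC c) x = c := rfl

theorem norm_apply_le (f : CircleC) (x : UnitAddCircle) : |f x| ≤ ‖f‖ := (toMap f).norm_coe_le_norm x

theorem norm_le {f : CircleC} {C : ℝ} (hC : 0 ≤ C) (h : ∀ x, |f x| ≤ C) : ‖f‖ ≤ C :=
  (ContinuousMap.norm_le (toMap f) hC).2 h

theorem tendsto_iff_tendstoUniformly {ι : Type*} {l : Filter ι} {F : ι → CircleC} {f : CircleC} :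
    Tendsto F l (𝓝 f) ↔ TendstoUniformly (fun i x => F i x) (fun x => f x) l :=
  ContinuousMap.tendsto_iff_tendstoUniformly (F := fun i => toMap (F i)) (f := toMap f)

/-- The evaluation at a point. -/
def ev (x : UnitAddCircle) : CircleC →L[ℝ] ℝ :=
  LinearMap.mkContinuous (E := CircleC)
    { toFun := fun f : CircleC => f x, map_add' := fun _ _ => rfl, map_smul' := fun _ _ => rfl } 1
    (fun f => by rw [one_mul]; exact norm_apply_le f x)

@[simp] theorem ev_apply (x : UnitAddCircle) (f : CircleC) : ev x f = f x := rfl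

theorem exp_apply (f : CircleC) (x : UnitAddCircle) : (exp f) x = Real.exp (f x) := by
  let _ : NormedAlgebra ℚ CircleC := NormedAlgebra.restrictScalars ℚ ℝ CircleC
  let F : CircleC →+* ℝ :=
    { toFun := fun f => f x, map_one' := rfl, map_mul' := fun _ _ => rfl, map_zero' := rfl,
      map_add' := fun _ _ => rfl }
  have h := map_exp F (ev x).continuous f
  rw [Real.exp_eq_exp_ℝ]
  exact h

theorem exp_injective : Function.Injective (exp : CircleC → CircleC) := by
  intro f g h
  refine ext' fun x => ?_
  have := congrArg (fun k : CircleC => k x) h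
  simpa [exp_apply] using this

theorem mem_range_exp {p : CircleC} : p ∈ range (exp : CircleC → CircleC) ↔ ∀ x, 0 < p x := by
  constructor
  · rintro ⟨f, rfl⟩ x
    rw [exp_apply]
    exact Real.exp_pos _
  · intro h
    refine ⟨ofMap ⟨fun x => Real.log (p x), p.continuous.log fun x => (h x).ne'⟩, ext' fun x => ?_⟩
    rw [exp_apply]
    exact Real.exp_log (h x)

/-- `g` is the derivative of the function `f` on the circle. -/
def IsD (f g : CircleC) : Prop :=
  ∀ x : ℝ, HasDerivAt (fun y : ℝ => f (y : UnitAddCircle)) (g (x : UnitAddCircle)) x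

theorem IsD.unique {f g h : CircleC} (hg : IsD f g) (hh : IsD f h) : g = h := by
  refine ext_coe fun x => ?_
  exact (hg x).unique (hh x)

theorem isD_const (c : ℝ) : IsD (algebraMap ℝ CircleC c) 0 := fun x => hasDerivAt_const x c

theorem isD_one : IsD 1 0 := fun x => hasDerivAt_const x 1

theorem IsD.add {f f' g g' : CircleC} (hf : IsD f f') (hg : IsD g g') : IsD (f + g) (f' + g') :=
  fun x => (hf x).add (hg x)

theorem IsD.sub {f f' g g' : CircleC} (hf : IsD f f') (hg : IsD g g') : IsD (f - g) (f' - g') :=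
  fun x => (hf x).sub (hg x)

theorem IsD.neg {f f' : CircleC} (hf : IsD f f') : IsD (-f) (-f') := fun x => (hf x).neg

theorem IsD.smul {f f' : CircleC} (c : ℝ) (hf : IsD f f') : IsD (c • f) (c • f') :=
  fun x => (hf x).const_smul c

theorem IsD.mul {f f' g g' : CircleC} (hf : IsD f f') (hg : IsD g g') :
    IsD (f * g) (f' * g + f * g') := fun x => (hf x).mul (hg x)

theorem IsD.exp {f f' : CircleC} (hf : IsD f f') : IsD (exp f) (exp f * f') := by
  intro x
  simpa only [exp_apply, mul_apply] using (hf x).exp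

/-- The function `e^(a x) y` is constant, and periodicity of `y` is incompatible with this unless `y
= 0`, as `e^a ≠ 1`. -/
theorem eq_zero_of_isD_smul {a : ℝ} (ha : a ≠ 0) {y : CircleC} (h : IsD y (-a • y)) : y = 0 := by
  have hexp : ∀ x : ℝ, HasDerivAt (fun y => Real.exp (a * y)) (a * Real.exp (a * x)) x := by
    intro x
    have := ((hasDerivAt_id x).const_mul a).exp
    simpa [mul_comm] using this
  have hd : ∀ x : ℝ, HasDerivAt (fun t : ℝ => Real.exp (a * t) * y (t : UnitAddCircle)) 0 x := by
    intro x
    convert! (hexp x).mul (h x) using 1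
    simp only [smul_apply]
    ring
  have hc := is_const_of_deriv_eq_zero (fun x => (hd x).differentiableAt) (fun x => (hd x).deriv)
  refine ext_coe fun x => ?_
  have h1 := hc (x + 1) x
  have h2 : ((x + 1 : ℝ) : UnitAddCircle) = (x : UnitAddCircle) := by simp
  simp only [h2] at h1
  rw [mul_add, mul_one, Real.exp_add] at h1
  have hea : Real.exp a - 1 ≠ 0 := by
    rw [sub_ne_zero]
    simpa using ha
  have h3 : Real.exp (a * x) * y (x : UnitAddCircle) * (Real.exp a - 1) = 0 := by linear_combination h1
  exact (mul_eq_zero.1 ((mul_eq_zero.1 h3).resolve_right hea)).resolve_left (Real.exp_pos _).ne'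

/-- The resolvent `(∂ₓ + a)⁻¹` on continuous functions of the circle. -/
def res (a : ℝ) : CircleC →L[ℝ] CircleC :=
  LinearMap.mkContinuous (E := CircleC) (F := CircleC)
    { toFun := fun h : CircleC => ofMap ⟨fun x => (Real.exp a - 1)⁻¹ *
        ∫ s in (0 : ℝ)..1, Real.exp (a * s) * h (x + (s : UnitAddCircle)), by
          refine continuous_const.mul
            (intervalIntegral.continuous_parametric_intervalIntegral_of_continuous' ?_ 0 1)
          have : Continuous fun p : UnitAddCircle × ℝ => h (p.1 + (p.2 : UnitAddCircle)) :=
            h.continuous.comp (continuous_fst.add ((AddCircle.continuous_mk' 1).comp continuous_snd))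
          exact (by fun_prop : Continuous fun p : UnitAddCircle × ℝ => Real.exp (a * p.2)).mul this⟩
      map_add' := fun h k => by
        refine ext' fun x => ?_
        have hc : ∀ h : CircleC, IntervalIntegrable
            (fun s : ℝ => Real.exp (a * s) * h (x + (s : UnitAddCircle))) MeasureTheory.volume 0 1 := by
          intro h
          refine Continuous.intervalIntegrable ?_ _ _
          exact (by fun_prop : Continuous fun s : ℝ => Real.exp (a * s)).mul
            (h.continuous.comp (continuous_const.add (AddCircle.continuous_mk' 1)))
        simp only [ofMap_apply, ContinuousMap.coe_mk, add_apply]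
        rw [← mul_add, ← intervalIntegral.integral_add (hc h) (hc k)]
        simp only [mul_add]
      map_smul' := fun c h => by
        refine ext' fun x => ?_
        simp only [ofMap_apply, ContinuousMap.coe_mk, smul_apply, RingHom.id_apply]
        rw [mul_left_comm, ← intervalIntegral.integral_const_mul c]
        congr 2
        funext s
        ring }
    (|(Real.exp a - 1)⁻¹| * Real.exp |a|) (by
      intro h
      refine norm_le (by positivity) fun x => ?_
      simp only [LinearMap.coe_mk, AddHom.coe_mk, ofMap_apply, ContinuousMap.coe_mk, abs_mul]
      rw [mul_assoc]
      refine mul_le_mul_of_nonneg_left ?_ (abs_nonneg _)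
      have := intervalIntegral.norm_integral_le_of_norm_le_const (a := (0 : ℝ)) (b := 1)
        (f := fun s : ℝ => Real.exp (a * s) * h (x + (s : UnitAddCircle)))
        (C := Real.exp |a| * ‖h‖) (by
          intro s hs
          rw [uIoc_of_le zero_le_one] at hs
          rw [norm_mul]
          refine mul_le_mul ?_ (h.norm_apply_le _) (norm_nonneg _) (Real.exp_pos _).le
          rw [Real.norm_eq_abs, abs_of_pos (Real.exp_pos _)]
          refine Real.exp_le_exp.2 ((le_abs_self _).trans ?_)
          rw [abs_mul, abs_of_pos hs.1]
          exact mul_le_of_le_one_right (abs_nonneg _) hs.2)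
      simpa using this)

theorem res_apply (a : ℝ) (h : CircleC) (x : UnitAddCircle) : res a h x = (Real.exp a - 1)⁻¹ *
    ∫ s in (0 : ℝ)..1, Real.exp (a * s) * h (x + (s : UnitAddCircle)) := rfl

/-- After the shift `s ↦ x + s` the resolvent is `(e^a - 1)⁻¹ e^(-a x) ∫_x^(x+1) e^(a s) h(s) ds`.
The end points of the integral contribute `(e^a - 1) e^(a x) h(x)`, which the prefactor normalizes
to `h(x)`. -/
theorem isD_res {a : ℝ} (ha : a ≠ 0) (h : CircleC) : IsD (res a h) (h - a • res a h) := by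
  have hea : Real.exp a - 1 ≠ 0 := by
    rw [sub_ne_zero]
    simpa using ha
  set g : ℝ → ℝ := fun s => Real.exp (a * s) * h (s : UnitAddCircle) with hg
  have hgc : Continuous g := (by fun_prop : Continuous fun s : ℝ => Real.exp (a * s)).mul
    h.continuous_comp_coe
  have key : ∀ x : ℝ, res a h (x : UnitAddCircle) =
      (Real.exp a - 1)⁻¹ * (Real.exp (-(a * x)) * ((∫ s in (0 : ℝ)..(x + 1), g s) - ∫ s in (0 : ℝ)..x, g s)) := by
    intro x
    rw [res_apply, intervalIntegral.integral_interval_sub_left (hgc.intervalIntegrable _ _)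
      (hgc.intervalIntegrable _ _)]
    congr 1
    rw [← intervalIntegral.integral_const_mul]
    have := intervalIntegral.integral_comp_add_left (a := 0) (b := 1)
      (fun s => Real.exp (-(a * x)) * g s) x
    rw [add_zero] at this
    rw [← this]
    congr 1
    ext s
    simp only [hg]
    rw [← mul_assoc, ← Real.exp_add, AddCircle.coe_add]
    congr 2
    ring
  intro x
  have he : HasDerivAt (fun y => Real.exp (-(a * y))) (-(a * Real.exp (-(a * x)))) x := by
    have := ((hasDerivAt_id x).const_mul a).neg.exp
    simpa [mul_comm] using this
  have h1 : HasDerivAt (fun x => ∫ s in (0 : ℝ)..(x + 1), g s) (g (x + 1)) x :=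
    HasDerivAt.comp_add_const x 1 (hgc.integral_hasStrictDerivAt 0 (x + 1)).hasDerivAt
  have h2 : HasDerivAt (fun x => ∫ s in (0 : ℝ)..x, g s) (g x) x :=
    (hgc.integral_hasStrictDerivAt 0 x).hasDerivAt
  have h3 := (he.mul (h1.sub h2)).const_mul (Real.exp a - 1)⁻¹
  have h4 : (fun y : ℝ => res a h (y : UnitAddCircle)) = _ := funext key
  rw [h4]
  convert! h3 using 1
  simp only [sub_apply, smul_apply, Pi.sub_apply]
  rw [key x]
  have h5 : g (x + 1) = Real.exp a * Real.exp (a * x) * h (x : UnitAddCircle) := by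
    simp only [hg]
    rw [mul_add, mul_one, Real.exp_add, AddCircle.coe_add, AddCircle.coe_period, add_zero]
    ring
  have h6 : Real.exp (-(a * x)) * Real.exp (a * x) = 1 := by
    rw [← Real.exp_add]; simp
  rw [h5]
  simp only [hg]
  field_simp
  linear_combination (-(h (x : UnitAddCircle)) * (Real.exp a - 1)) * h6

/-- With `isD_res` this makes `res a` a two-sided inverse of `∂ₓ + a`. Differentiability can thus be
expressed by an equation between bounded operators, which commutes with limits and integrals. -/
theorem res_of_isD {a : ℝ} (ha : a ≠ 0) {z z' : CircleC} (h : IsD z z') :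
    res a (z' + a • z) = z := by
  have h1 := (isD_res ha (z' + a • z)).sub h
  rw [← sub_eq_zero]
  refine eq_zero_of_isD_smul ha ?_
  convert h1 using 1
  module

end CircleC

/-! ### Smooth functions of the circle as continuous functions -/

namespace CircleFun

/-- A smooth function on the circle, as a continuous function. -/
def toC : CircleFun →ₐ[ℝ] CircleC where
  toFun u := CircleC.ofMap ⟨u.periodic.lift, by
    refine (QuotientAddGroup.isQuotientMap_mk _).continuous_iff.2 ?_
    exact u.contDiff.continuous⟩
  map_one' := by
    exact CircleC.ext_coe fun x => rfl
  map_mul' u v := by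
    exact CircleC.ext_coe fun x => rfl
  map_zero' := by
    exact CircleC.ext_coe fun x => rfl
  map_add' u v := by
    exact CircleC.ext_coe fun x => rfl
  commutes' c := by
    exact CircleC.ext_coe fun x => rfl

@[simp] theorem toC_coe (u : CircleFun) (x : ℝ) : toC u (x : UnitAddCircle) = u x := rfl

theorem toC_injective : Function.Injective toC := fun u v h => ext' fun x => by
  rw [← toC_coe, h, toC_coe]

theorem isD_toC (u : CircleFun) : CircleC.IsD (toC u) (toC (dx u)) := fun x => u.hasDerivAt x

/-- `f` is `n` times differentiable. -/
def HasD : ℕ → CircleC → Prop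
  | 0, _ => True
  | n + 1, f => ∃ g, CircleC.IsD f g ∧ HasD n g

theorem HasD.contDiff {n : ℕ} {f : CircleC} (h : HasD (n + 1) f) :
    ContDiff ℝ n (fun x : ℝ => f (x : UnitAddCircle)) := by
  induction n generalizing f with
  | zero => exact contDiff_zero.2 f.continuous_comp_coe
  | succ n ih =>
    obtain ⟨g, hg, hn⟩ := h
    rw [Nat.cast_add, Nat.cast_one, contDiff_succ_iff_deriv]
    refine ⟨fun x => (hg x).differentiableAt, by simp, ?_⟩
    rw [show deriv (fun x : ℝ => f (x : UnitAddCircle)) = fun x : ℝ => g x from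
      funext fun x => (hg x).deriv]
    exact ih hn

theorem exists_toC_eq {f : CircleC} (h : ∀ n, HasD n f) : ∃ u : CircleFun, toC u = f := by
  refine ⟨⟨fun x : ℝ => f (x : UnitAddCircle), contDiff_infty.2 fun n => (h (n + 1)).contDiff, ?_⟩, ?_⟩
  · intro x
    simp
  · exact CircleC.ext_coe fun x => rfl

/-- The sequence of all derivatives. -/
def jet (k : ℕ) : CircleFun →ₗ[ℝ] CircleC := toC.toLinearMap ∘ₗ dx ^ k

theorem jet_zero (u : CircleFun) : jet 0 u = toC u := rfl

theorem jet_succ (k : ℕ) (u : CircleFun) : jet (k + 1) u = jet k (dx u) := by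
  simp [jet, pow_succ]

theorem isD_jet (k : ℕ) (u : CircleFun) : CircleC.IsD (jet k u) (jet (k + 1) u) := by
  have : jet (k + 1) u = toC (dx ((dx ^ k) u)) := by simp [jet, pow_succ']
  rw [this]
  exact isD_toC _

theorem jet_coe (k : ℕ) (u : CircleFun) (x : ℝ) :
    jet k u (x : UnitAddCircle) = iteratedDeriv k (u : ℝ → ℝ) x := by
  induction k generalizing x with
  | zero => simp [jet_zero]
  | succ k ih =>
    rw [iteratedDeriv_succ, ← funext ih, (isD_jet k u x).deriv]

theorem isInducing_uniformFun : IsInducing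
    (fun f : CircleC => (UniformFun.ofFun (fun x : ℝ => f (x : UnitAddCircle)) : UniformFun ℝ ℝ)) := by
  have key : ∀ (l : Filter CircleC) (h : CircleC), Tendsto id l (𝓝 h) ↔
      Tendsto (fun f : CircleC => (UniformFun.ofFun (fun x : ℝ => f (x : UnitAddCircle)) : UniformFun ℝ ℝ))
        l (𝓝 (UniformFun.ofFun (fun x : ℝ => h (x : UnitAddCircle)))) := by
    intro l h
    rw [CircleC.tendsto_iff_tendstoUniformly, UniformFun.tendsto_iff_tendstoUniformly]
    constructor
    · intro H
      exact H.comp (fun x : ℝ => (x : UnitAddCircle))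
    · intro H u hu
      filter_upwards [H u hu] with f hf z
      obtain ⟨x, rfl⟩ := QuotientAddGroup.mk_surjective z
      exact hf x
  refine isInducing_iff_nhds.2 fun h => le_antisymm ?_ ?_
  · rw [← tendsto_iff_comap]
    exact (key _ h).1 tendsto_id
  · exact (key _ h).2 tendsto_comap

/-- Uniform convergence on `ℝ` and on the circle coincide for periodic functions, so the Fréchet
topology is the initial topology for the maps `jet k` to a Banach space. Limits, continuity and
directional derivatives can then be tested one `k` at a time. -/
theorem isInducing_jet : IsInducing (fun (u : CircleFun) (k : ℕ) => jet k u) := by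
  have h1 : IsInducing (fun (u : CircleFun) (k : ℕ) =>
      (UniformFun.ofFun (iteratedDeriv k (u : ℝ → ℝ)) : UniformFun ℝ ℝ)) := ⟨rfl⟩
  have h2 : IsInducing (Pi.map (fun _ : ℕ => fun f : CircleC =>
      (UniformFun.ofFun (fun x : ℝ => f (x : UnitAddCircle)) : UniformFun ℝ ℝ))) :=
    IsInducing.piMap fun _ => isInducing_uniformFun
  refine (h2.of_comp_iff).1 ?_
  convert h1 using 1
  funext u k
  simp only [Function.comp_apply, Pi.map_apply]
  congr 1
  funext x
  exact jet_coe k u x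

theorem tendsto_iff {ι : Type*} {l : Filter ι} {f : ι → CircleFun} {u : CircleFun} :
    Tendsto f l (𝓝 u) ↔ ∀ k, Tendsto (fun i => jet k (f i)) l (𝓝 (jet k u)) := by
  rw [isInducing_jet.tendsto_nhds_iff, tendsto_pi_nhds]
  rfl

theorem continuous_iff {X : Type*} [TopologicalSpace X] {f : X → CircleFun} :
    Continuous f ↔ ∀ k, Continuous fun x => jet k (f x) := by
  rw [isInducing_jet.continuous_iff, continuous_pi_iff]
  rfl

theorem continuousOn_iff {X : Type*} [TopologicalSpace X] {f : X → CircleFun} {s : Set X} :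
    ContinuousOn f s ↔ ∀ k, ContinuousOn (fun x => jet k (f x)) s := by
  rw [isInducing_jet.continuousOn_iff, continuousOn_pi]
  rfl

theorem continuous_jet (k : ℕ) : Continuous (jet k : CircleFun → CircleC) :=
  continuous_iff.1 continuous_id k

instance : IsTopologicalAddGroup CircleFun where
  continuous_add := continuous_iff.2 fun k => by
    simp only [map_add]
    exact ((continuous_jet k).comp continuous_fst).add ((continuous_jet k).comp continuous_snd)
  continuous_neg := continuous_iff.2 fun k => by
    simp only [map_neg]
    exact (continuous_jet k).neg

instance : ContinuousSMul ℝ CircleFun where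
  continuous_smul := continuous_iff.2 fun k => by
    simp only [map_smul]
    exact continuous_fst.smul ((continuous_jet k).comp continuous_snd)

theorem continuous_toC : Continuous (toC : CircleFun → CircleC) := continuous_jet 0

instance : T2Space CircleFun := T2Space.of_injective_continuous toC_injective continuous_toC

theorem continuous_dx : Continuous (dx : CircleFun → CircleFun) :=
  continuous_iff.2 fun k => by
    simp only [← jet_succ]
    exact continuous_jet (k + 1)

theorem continuous_opA : Continuous (opA : CircleFun → CircleFun) :=
  continuous_id.sub (continuous_dx.comp continuous_dx)

theorem hasDirDerivAt_iff {X : Type*} [AddCommGroup X] [Module ℝ X] {f : X → CircleFun}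
    {f' : CircleFun} {x h : X} :
    HasDirDerivAt f f' x h ↔ ∀ k, HasDirDerivAt (fun y => jet k (f y)) (jet k f') x h := by
  simp only [HasDirDerivAt, tendsto_iff, map_smul, map_sub]

/-- This is the completeness needed later: if all derivatives converge uniformly, the limits are the
successive derivatives of one smooth function. It produces directional derivatives in `CircleFun`
from those of the jets. -/
theorem exists_of_tendsto {ι : Type*} {l : Filter ι} [l.NeBot] {f : ι → CircleFun} {y : ℕ → CircleC}
    (h : ∀ k, Tendsto (fun i => jet k (f i)) l (𝓝 (y k))) :
    ∃ u : CircleFun, ∀ k, jet k u = y k := by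
  have hD : ∀ k, CircleC.IsD (y k) (y (k + 1)) := by
    intro k x
    have hu : ∀ k, TendstoUniformly (fun i (x : ℝ) => jet k (f i) (x : UnitAddCircle))
        (fun x : ℝ => y k (x : UnitAddCircle)) l := fun k =>
      (CircleC.tendsto_iff_tendstoUniformly.1 (h k)).comp (fun x : ℝ => (x : UnitAddCircle))
    exact hasDerivAt_of_tendstoUniformly (hu (k + 1))
      (Eventually.of_forall fun i x => isD_jet k (f i) x)
      (fun x => (hu k).tendsto_at x) x
  have hn : ∀ n k, HasD n (y k) := by
    intro n
    induction n with
    | zero => exact fun _ => trivial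
    | succ n ih => exact fun k => ⟨y (k + 1), hD k, ih (k + 1)⟩
  obtain ⟨u, hu⟩ := exists_toC_eq fun n => hn n 0
  refine ⟨u, fun k => ?_⟩
  induction k with
  | zero => exact hu
  | succ k ih =>
    have := isD_jet k u
    rw [ih] at this
    exact this.unique (hD k)

end CircleFun

/-! ### Maps that factor through smooth maps of normed spaces -/

section Calculus

/-- `g` is on `U` the composition of a continuous linear map to a normed space and a smooth map. -/
def BSmoothOn {X Y : Type} [AddCommGroup X] [Module ℝ X] [TopologicalSpace X]
    [NormedAddCommGroup Y] [NormedSpace ℝ Y] (g : X → Y) (U : Set X) : Prop :=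
  ∃ (Z : Type) (_ : NormedAddCommGroup Z) (_ : NormedSpace ℝ Z) (L : X →L[ℝ] Z) (W : Set Z)
    (F : Z → Y), IsOpen W ∧ ContDiffOn ℝ ∞ F W ∧ ∀ x ∈ U, L x ∈ W ∧ g x = F (L x)

variable {X Y Y' : Type} [AddCommGroup X] [Module ℝ X] [TopologicalSpace X]
    [NormedAddCommGroup Y] [NormedSpace ℝ Y] [NormedAddCommGroup Y'] [NormedSpace ℝ Y']

namespace BSmoothOn

theorem clm (L : X →L[ℝ] Y) (U : Set X) : BSmoothOn L U :=
  ⟨Y, _, _, L, univ, id, isOpen_univ, contDiffOn_id, fun _ _ => ⟨mem_univ _, rfl⟩⟩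

theorem const (c : Y) (U : Set X) : BSmoothOn (fun _ : X => c) U :=
  ⟨Y, _, _, 0, univ, fun _ => c, isOpen_univ, contDiffOn_const, fun _ _ => ⟨mem_univ _, rfl⟩⟩

theorem congr {g g' : X → Y} {U : Set X} (h : BSmoothOn g U) (hg : ∀ x ∈ U, g' x = g x) :
    BSmoothOn g' U := by
  obtain ⟨Z, _, _, L, W, F, hW, hF, h⟩ := h
  exact ⟨Z, _, _, L, W, F, hW, hF, fun x hx => ⟨(h x hx).1, (hg x hx).trans (h x hx).2⟩⟩

theorem comp {g : X → Y} {U : Set X} (hg : BSmoothOn g U) {G : Y → Y'} {V : Set Y} (hV : IsOpen V)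
    (hG : ContDiffOn ℝ ∞ G V) (hm : ∀ x ∈ U, g x ∈ V) : BSmoothOn (fun x => G (g x)) U := by
  obtain ⟨Z, _, _, L, W, F, hW, hF, h⟩ := hg
  refine ⟨Z, _, _, L, W ∩ F ⁻¹' V, G ∘ F, hF.continuousOn.isOpen_inter_preimage hW hV,
    hG.comp (hF.mono inter_subset_left) fun x hx => hx.2, fun x hx => ?_⟩
  obtain ⟨h1, h2⟩ := h x hx
  refine ⟨⟨h1, ?_⟩, by simp [h2]⟩
  rw [mem_preimage, ← h2]
  exact hm x hx

theorem comp_contDiff {g : X → Y} {U : Set X} (hg : BSmoothOn g U) {G : Y → Y'}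
    (hG : ContDiff ℝ ∞ G) : BSmoothOn (fun x => G (g x)) U :=
  hg.comp isOpen_univ hG.contDiffOn fun _ _ => mem_univ _

theorem prodMk {g : X → Y} {g' : X → Y'} {U : Set X} (hg : BSmoothOn g U) (hg' : BSmoothOn g' U) :
    BSmoothOn (fun x => (g x, g' x)) U := by
  obtain ⟨Z, _, _, L, W, F, hW, hF, h⟩ := hg
  obtain ⟨Z', _, _, L', W', F', hW', hF', h'⟩ := hg'
  refine ⟨Z × Z', _, _, L.prod L', W ×ˢ W', fun z => (F z.1, F' z.2), hW.prod hW',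
    (hF.comp contDiffOn_fst fun z hz => hz.1).prodMk (hF'.comp contDiffOn_snd fun z hz => hz.2),
    fun x hx => ⟨⟨(h x hx).1, (h' x hx).1⟩, ?_⟩⟩
  simp [(h x hx).2, (h' x hx).2]

theorem precomp {X' : Type} [AddCommGroup X'] [Module ℝ X'] [TopologicalSpace X'] {g : X → Y}
    {U : Set X} (hg : BSmoothOn g U) (M : X' →L[ℝ] X) {V : Set X'} (hV : ∀ x ∈ V, M x ∈ U) :
    BSmoothOn (fun x => g (M x)) V := by
  obtain ⟨Z, _, _, L, W, F, hW, hF, h⟩ := hg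
  exact ⟨Z, _, _, L.comp M, W, F, hW, hF, fun x hx => h (M x) (hV x hx)⟩

theorem continuousOn {g : X → Y} {U : Set X} (hg : BSmoothOn g U) : ContinuousOn g U := by
  obtain ⟨Z, _, _, L, W, F, hW, hF, h⟩ := hg
  exact (hF.continuousOn.comp L.continuous.continuousOn fun x hx => (h x hx).1).congr
    fun x hx => (h x hx).2

theorem add {g g' : X → Y} {U : Set X} (hg : BSmoothOn g U) (hg' : BSmoothOn g' U) :
    BSmoothOn (fun x => g x + g' x) U := (hg.prodMk hg').comp_contDiff contDiff_add

variable [ContinuousAdd X] [ContinuousSMul ℝ X]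

/-- By the chain rule the directional derivative of `F ∘ L` is `fderiv ℝ F (L x) (L h)`, which
factors through `Z × Z`. Hence the class is stable under differentiation and the criterion below can
be proved by induction. -/
theorem exists_hasDirDerivAt {g : X → Y} {U : Set X} (hU : IsOpen U) (hg : BSmoothOn g U) :
    ∃ g' : X × X → Y, BSmoothOn g' (U ×ˢ univ) ∧
      ∀ x ∈ U, ∀ h, HasDirDerivAt g (g' (x, h)) x h := by
  obtain ⟨Z, _, _, L, W, F, hW, hF, H⟩ := hg
  refine ⟨fun p => fderiv ℝ F (L p.1) (L p.2), ⟨Z × Z, _, _,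
    (L.comp (ContinuousLinearMap.fst ℝ X X)).prod (L.comp (ContinuousLinearMap.snd ℝ X X)),
    W ×ˢ univ, fun z => fderiv ℝ F z.1 z.2, hW.prod isOpen_univ, ?_, fun x hx => ?_⟩, ?_⟩
  · have h1 : ContDiffOn ℝ ∞ (fderiv ℝ F) W := hF.fderiv_of_isOpen hW (by simp)
    exact (h1.comp contDiffOn_fst fun z hz => hz.1).clm_apply contDiffOn_snd
  · exact ⟨⟨(H x.1 hx.1).1, mem_univ _⟩, rfl⟩
  · intro x hx h
    have hd : HasFDerivAt F (fderiv ℝ F (L x)) (L x) :=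
      ((hF.contDiffAt (hW.mem_nhds (H x hx).1)).differentiableAt (by simp)).hasFDerivAt
    have hl : HasLineDerivAt ℝ F (fderiv ℝ F (L x) (L h)) (L x) (L h) := hd.hasLineDerivAt _
    have ht := hasDerivAt_iff_tendsto_slope_zero.1 hl
    refine Tendsto.congr' ?_ ht
    have hc : Tendsto (fun e : ℝ => x + e • h) (𝓝[≠] 0) (𝓝 x) := by
      have : Continuous fun e : ℝ => x + e • h := by fun_prop
      have := this.tendsto 0
      simp only [zero_smul, add_zero] at this
      exact this.mono_left nhdsWithin_le_nhds
    filter_upwards [hc (hU.mem_nhds hx)] with e he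
    simp only [zero_add, zero_smul, add_zero]
    rw [(H x hx).2, (H _ he).2, map_add, map_smul]

end BSmoothOn

/-- The difference quotients converge in every jet, so by completeness they converge to a smooth
function. The jets of this derivative are again of the same type, on `U × X`. -/
theorem isClassC_of_jets [ContinuousAdd X] [ContinuousSMul ℝ X] {f : X → CircleFun} {U : Set X}
    (hU : IsOpen U) (h : ∀ k, BSmoothOn (fun x => CircleFun.jet k (f x)) U) (n : ℕ) :
    IsClassC n f U := by
  induction n generalizing X with
  | zero => exact CircleFun.continuousOn_iff.2 fun k => (h k).continuousOn
  | succ n ih =>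
    refine ⟨CircleFun.continuousOn_iff.2 fun k => (h k).continuousOn, ?_⟩
    choose g hg hd using fun k => (h k).exists_hasDirDerivAt hU
    have hex : ∀ p : X × X, p.1 ∈ U → ∃ u : CircleFun, ∀ k, CircleFun.jet k u = g k p := by
      intro p hp
      refine CircleFun.exists_of_tendsto (l := 𝓝[≠] (0 : ℝ))
        (f := fun e => e⁻¹ • (f (p.1 + e • p.2) - f p.1)) fun k => ?_
      have := hd k p.1 hp p.2
      simpa only [HasDirDerivAt, map_smul, map_sub] using this
    classical
    -- The value `0` outside `U` plays no role: only base points in `U` are tested.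
    refine ⟨fun p => if hp : p.1 ∈ U then (hex p hp).choose else 0, fun x hx v => ?_, ?_⟩
    · rw [CircleFun.hasDirDerivAt_iff]
      intro k
      simp only [hx, dif_pos]
      rw [(hex (x, v) hx).choose_spec k]
      exact hd k x hx v
    · refine ih (hU.prod isOpen_univ) fun k => (hg k).congr fun p hp => ?_
      simp only [hp.1, dif_pos]
      exact (hex p hp.1).choose_spec k

end Calculus

/-! ### Maps to algebras with a derivation that are differentiable to all orders -/

section GoodN

/-- A relation that behaves like the graph of a derivation. -/
structure DerivRel {A : Type} [NormedCommRing A] [NormedAlgebra ℝ A] (D : A → A → Prop) : Prop where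
  zero : ∀ c : ℝ, D (algebraMap ℝ A c) 0
  add : ∀ {f f' g g'}, D f f' → D g g' → D (f + g) (f' + g')
  mul : ∀ {f f' g g'}, D f f' → D g g' → D (f * g) (f' * g + f * g')

variable {X A A' : Type} [AddCommGroup X] [Module ℝ X] [TopologicalSpace X]
  [NormedCommRing A] [NormedAlgebra ℝ A] [NormedCommRing A'] [NormedAlgebra ℝ A']

/-- The map `g` and its derivatives `D^k g` for `k ≤ n` factor through smooth maps of normed spaces. -/
def GoodN (D : A → A → Prop) : ℕ → (X → A) → Set X → Prop
  | 0, g, U => BSmoothOn g U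
  | n + 1, g, U => BSmoothOn g U ∧ ∃ g', GoodN D n g' U ∧ ∀ x ∈ U, D (g x) (g' x)

namespace GoodN

variable {D : A → A → Prop} {D' : A' → A' → Prop} {U : Set X} {n : ℕ} {f g : X → A}

theorem bsmoothOn (h : GoodN D n g U) : BSmoothOn g U := by
  cases n with
  | zero => exact h
  | succ n => exact h.1

theorem pred (h : GoodN D (n + 1) g U) : GoodN D n g U := by
  induction n generalizing g with
  | zero => exact h.1
  | succ n ih =>
    obtain ⟨h1, g', h2, h3⟩ := h
    exact ⟨h1, g', ih h2, h3⟩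

theorem congr (h : GoodN D n g U) (hfg : ∀ x ∈ U, f x = g x) : GoodN D n f U := by
  induction n generalizing f g with
  | zero => exact BSmoothOn.congr h hfg
  | succ n ih =>
    obtain ⟨h1, g', h2, h3⟩ := h
    exact ⟨h1.congr hfg, g', h2, fun x hx => by rw [hfg x hx]; exact h3 x hx⟩

theorem const (hD : DerivRel D) (c : ℝ) : GoodN D n (fun _ : X => algebraMap ℝ A c) U := by
  induction n generalizing c with
  | zero => exact BSmoothOn.const _ _
  | succ n ih =>
    refine ⟨BSmoothOn.const _ _, fun _ => algebraMap ℝ A 0, ih 0, fun x _ => ?_⟩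
    rw [map_zero]
    exact hD.zero c

theorem one (hD : DerivRel D) : GoodN D n (fun _ : X => (1 : A)) U := by
  simpa using const (n := n) (U := U) hD 1

theorem add (hD : DerivRel D) (hf : GoodN D n f U) (hg : GoodN D n g U) :
    GoodN D n (fun x => f x + g x) U := by
  induction n generalizing f g with
  | zero => exact BSmoothOn.add hf hg
  | succ n ih =>
    obtain ⟨h1, f', h2, h3⟩ := hf
    obtain ⟨k1, g', k2, k3⟩ := hg
    exact ⟨h1.add k1, _, ih h2 k2, fun x hx => hD.add (h3 x hx) (k3 x hx)⟩

theorem mul (hD : DerivRel D) (hf : GoodN D n f U) (hg : GoodN D n g U) :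
    GoodN D n (fun x => f x * g x) U := by
  induction n generalizing f g with
  | zero => exact (BSmoothOn.prodMk hf hg).comp_contDiff contDiff_mul
  | succ n ih =>
    obtain ⟨h1, f', h2, h3⟩ := id hf
    obtain ⟨k1, g', k2, k3⟩ := id hg
    exact ⟨(h1.prodMk k1).comp_contDiff contDiff_mul, _, add hD (ih h2 hg.pred) (ih hf.pred k2),
      fun x hx => hD.mul (h3 x hx) (k3 x hx)⟩

theorem smul (hD : DerivRel D) (c : ℝ) (hf : GoodN D n f U) : GoodN D n (fun x => c • f x) U := by
  simp only [Algebra.smul_def]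
  exact mul hD (const hD c) hf

theorem sub (hD : DerivRel D) (hf : GoodN D n f U) (hg : GoodN D n g U) :
    GoodN D n (fun x => f x - g x) U :=
  (add hD hf (smul hD (-1) hg)).congr fun x _ => by module

theorem map (hf : GoodN D n f U) (L : A →L[ℝ] A') (hL : ∀ a a', D a a' → D' (L a) (L a')) :
    GoodN D' n (fun x => L (f x)) U := by
  induction n generalizing f with
  | zero => exact BSmoothOn.comp_contDiff hf L.contDiff
  | succ n ih =>
    obtain ⟨h1, f', h2, h3⟩ := hf
    exact ⟨h1.comp_contDiff L.contDiff, _, ih h2, fun x hx => hL _ _ (h3 x hx)⟩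

theorem precomp {X' : Type} [AddCommGroup X'] [Module ℝ X'] [TopologicalSpace X']
    (hg : GoodN D n g U) (M : X' →L[ℝ] X) {V : Set X'} (hV : ∀ x ∈ V, M x ∈ U) :
    GoodN D n (fun x => g (M x)) V := by
  induction n generalizing g with
  | zero => exact BSmoothOn.precomp hg M hV
  | succ n ih =>
    obtain ⟨h1, f', h2, h3⟩ := hg
    exact ⟨h1.precomp M hV, _, ih h2, fun x hx => h3 _ (hV x hx)⟩

end GoodN

end GoodN

theorem CircleC.derivRel : DerivRel CircleC.IsD :=
  ⟨CircleC.isD_const, CircleC.IsD.add, CircleC.IsD.mul⟩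

theorem GoodN.hasD {X : Type} [AddCommGroup X] [Module ℝ X] [TopologicalSpace X] {g : X → CircleC}
    {U : Set X} {n : ℕ} (h : GoodN CircleC.IsD n g U) {x : X} (hx : x ∈ U) :
    CircleFun.HasD n (g x) := by
  induction n generalizing g with
  | zero => trivial
  | succ n ih =>
    obtain ⟨-, g', h2, h3⟩ := h
    exact ⟨g' x, h3 x hx, ih h2⟩

/-- Derivatives in `x` are unique, so the successive derivatives supplied by `GoodN` are the jets.
It remains only to control `toC ∘ f` to all orders. -/
theorem GoodN.jet {X : Type} [AddCommGroup X] [Module ℝ X] [TopologicalSpace X] {f : X → CircleFun}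
    {U : Set X} (h : ∀ n, GoodN CircleC.IsD n (fun x => CircleFun.toC (f x)) U) (k : ℕ) :
    BSmoothOn (fun x => CircleFun.jet k (f x)) U := by
  have key : ∀ n, GoodN CircleC.IsD n (fun x => CircleFun.jet k (f x)) U := by
    induction k with
    | zero => exact h
    | succ k ih =>
      intro n
      obtain ⟨-, g', h2, h3⟩ := ih (n + 1)
      exact h2.congr fun x hx => (CircleFun.isD_jet k (f x)).unique (h3 x hx)
  exact key 0

theorem goodN_jet {X : Type} [AddCommGroup X] [Module ℝ X] [TopologicalSpace X] {U : Set X}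
    (L : X → CircleFun) (M : ∀ k, ∃ M : X →L[ℝ] CircleC, ∀ x ∈ U, CircleFun.jet k (L x) = M x) (n k : ℕ) :
    GoodN CircleC.IsD n (fun x => CircleFun.jet k (L x)) U := by
  have hb : ∀ k, BSmoothOn (fun x => CircleFun.jet k (L x)) U := fun k => by
    obtain ⟨M, hM⟩ := M k
    exact (BSmoothOn.clm M U).congr hM
  induction n generalizing k with
  | zero => exact hb k
  | succ n ih => exact ⟨hb k, _, ih (k + 1), fun x _ => CircleFun.isD_jet k (L x)⟩

/-! ### Paths of continuous functions of the circle -/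

/-- Continuous paths, parametrized by `[-1, 1]`, of continuous functions of the circle. -/
def PathC : Type := C(Icc (-1 : ℝ) 1, CircleC)

namespace PathC

open NormedSpace

instance : NormedCommRing PathC := inferInstanceAs (NormedCommRing C(Icc (-1 : ℝ) 1, CircleC))
instance : NormedAlgebra ℝ PathC := inferInstanceAs (NormedAlgebra ℝ C(Icc (-1 : ℝ) 1, CircleC))
instance : CompleteSpace PathC := inferInstanceAs (CompleteSpace C(Icc (-1 : ℝ) 1, CircleC))

/-- The path as a continuous map. -/
def toMap (f : PathC) : C(Icc (-1 : ℝ) 1, CircleC) := f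

/-- The path with the given values. -/
def ofMap (f : C(Icc (-1 : ℝ) 1, CircleC)) : PathC := f

instance : CoeFun PathC (fun _ => Icc (-1 : ℝ) 1 → CircleC) := ⟨fun f => toMap f⟩

theorem continuous (f : PathC) : Continuous (f : Icc (-1 : ℝ) 1 → CircleC) := (toMap f).continuous

theorem ext' {f g : PathC} (h : ∀ t, f t = g t) : f = g :=
  ContinuousMap.ext (f := toMap f) (g := toMap g) h

theorem add_apply (f g : PathC) (t : Icc (-1 : ℝ) 1) : (f + g) t = f t + g t := rfl
theorem sub_apply (f g : PathC) (t : Icc (-1 : ℝ) 1) : (f - g) t = f t - g t := rfl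
theorem neg_apply (f : PathC) (t : Icc (-1 : ℝ) 1) : (-f) t = -f t := rfl
theorem mul_apply (f g : PathC) (t : Icc (-1 : ℝ) 1) : (f * g) t = f t * g t := rfl
theorem smul_apply (c : ℝ) (f : PathC) (t : Icc (-1 : ℝ) 1) : (c • f) t = c • f t := rfl
theorem one_apply (t : Icc (-1 : ℝ) 1) : (1 : PathC) t = 1 := rfl

theorem norm_apply_le (f : PathC) (t : Icc (-1 : ℝ) 1) : ‖f t‖ ≤ ‖f‖ := (toMap f).norm_coe_le_norm t

theorem norm_le {f : PathC} {C : ℝ} (hC : 0 ≤ C) (h : ∀ t, ‖f t‖ ≤ C) : ‖f‖ ≤ C :=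
  (ContinuousMap.norm_le (toMap f) hC).2 h

/-- A linear map to paths that is pointwise bounded. -/
def mkCLM {E : Type*} [NormedAddCommGroup E] [NormedSpace ℝ E] (L : E →ₗ[ℝ] PathC) (C : ℝ) (hC : 0 ≤ C)
    (h : ∀ x t, ‖L x t‖ ≤ C * ‖x‖) : E →L[ℝ] PathC :=
  L.mkContinuous C fun x => norm_le (by positivity) (h x)

/-- The evaluation at the time `t`. -/
def ev (t : Icc (-1 : ℝ) 1) : PathC →L[ℝ] CircleC :=
  LinearMap.mkContinuous (E := PathC) (F := CircleC)
    { toFun := fun f : PathC => f t, map_add' := fun _ _ => rfl, map_smul' := fun _ _ => rfl } 1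
    (fun f => by rw [one_mul]; exact norm_apply_le f t)

@[simp] theorem ev_apply (t : Icc (-1 : ℝ) 1) (f : PathC) : ev t f = f t := rfl

/-- Constant paths. -/
def cst : CircleC →L[ℝ] PathC :=
  mkCLM { toFun := fun f => ofMap (ContinuousMap.const _ f), map_add' := fun _ _ => rfl,
          map_smul' := fun _ _ => rfl } 1 zero_le_one fun f t => by rw [one_mul]; exact le_rfl

@[simp] theorem cst_apply (f : CircleC) (t : Icc (-1 : ℝ) 1) : cst f t = f := rfl

theorem exp_apply (f : PathC) (t : Icc (-1 : ℝ) 1) : (exp f) t = exp (f t) := by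
  let _ : NormedAlgebra ℚ PathC := NormedAlgebra.restrictScalars ℚ ℝ PathC
  let _ : NormedAlgebra ℚ CircleC := NormedAlgebra.restrictScalars ℚ ℝ CircleC
  let F : PathC →+* CircleC :=
    { toFun := fun f => f t, map_one' := rfl, map_mul' := fun _ _ => rfl, map_zero' := rfl,
      map_add' := fun _ _ => rfl }
  exact map_exp F (ev t).continuous f

theorem exp_injective : Function.Injective (exp : PathC → PathC) := by
  intro f g h
  refine ext' fun t => ?_
  refine CircleC.exp_injective ?_
  rw [← exp_apply, ← exp_apply, h]

theorem apply_mem_range_exp {p : PathC} (hp : p ∈ range (exp : PathC → PathC)) (t : Icc (-1 : ℝ) 1) :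
    p t ∈ range (exp : CircleC → CircleC) := by
  obtain ⟨f, rfl⟩ := hp
  rw [exp_apply]
  exact mem_range_self _

theorem lg_apply {p : PathC} (hp : p ∈ range (exp : PathC → PathC)) (t : Icc (-1 : ℝ) 1) :
    (lg p) t = lg (p t) := by
  obtain ⟨f, rfl⟩ := hp
  rw [lg_exp exp_injective, exp_apply, lg_exp CircleC.exp_injective]

/-- `g` is the derivative of `f` in the variable of the circle. -/
def IsD (f g : PathC) : Prop := ∀ t, CircleC.IsD (f t) (g t)

theorem derivRel : DerivRel IsD :=
  ⟨fun c _ => CircleC.isD_const c, fun h k t => (h t).add (k t), fun h k t => (h t).mul (k t)⟩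

theorem isD_cst {f g : CircleC} (h : CircleC.IsD f g) : IsD (cst f) (cst g) := fun _ => h

/-- The resolvent `(∂ₓ + a)⁻¹`. -/
def res (a : ℝ) : PathC →L[ℝ] PathC :=
  mkCLM { toFun := fun f => ofMap ⟨fun t => CircleC.res a (f t), (CircleC.res a).continuous.comp f.continuous⟩
          map_add' := fun f g => ext' fun t => map_add (CircleC.res a) (f t) (g t)
          map_smul' := fun c f => ext' fun t => map_smul (CircleC.res a) c (f t) }
    ‖CircleC.res a‖ (norm_nonneg _) fun f t => ((CircleC.res a).le_opNorm _).trans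
      (mul_le_mul_of_nonneg_left (norm_apply_le f t) (norm_nonneg _))

@[simp] theorem res_apply (a : ℝ) (f : PathC) (t : Icc (-1 : ℝ) 1) :
    res a f t = CircleC.res a (f t) := rfl

/-- The extension of a path to the real line. -/
def ext (f : PathC) (s : ℝ) : CircleC := f (projIcc (-1) 1 (by norm_num) s)

theorem continuous_ext (f : PathC) : Continuous f.ext := f.continuous.comp continuous_projIcc

theorem ext_coe (f : PathC) (t : Icc (-1 : ℝ) 1) : f.ext t = f t := by
  rw [ext, projIcc_val]

theorem ext_of_mem (f : PathC) {t : ℝ} (ht : t ∈ Icc (-1 : ℝ) 1) : f.ext t = f ⟨t, ht⟩ :=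
  f.ext_coe ⟨t, ht⟩

/-- The primitive in time that vanishes at the time `0`. -/
def prim : PathC →L[ℝ] PathC :=
  mkCLM
    { toFun := fun f => ofMap ⟨fun t => ∫ s in (0 : ℝ)..t, f.ext s,
        (intervalIntegral.continuous_primitive (fun _ _ => f.continuous_ext.intervalIntegrable _ _) 0).comp
          continuous_subtype_val⟩
      map_add' := fun f g => ext' fun t => intervalIntegral.integral_add
        (f.continuous_ext.intervalIntegrable _ _) (g.continuous_ext.intervalIntegrable _ _)
      map_smul' := fun c f => ext' fun t => intervalIntegral.integral_smul c f.ext } 1 zero_le_one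
    fun f t => by
      rw [one_mul]
      have h := intervalIntegral.norm_integral_le_of_norm_le_const (a := (0 : ℝ)) (b := t) (f := f.ext)
        (C := ‖f‖) fun s _ => f.norm_apply_le _
      refine h.trans (mul_le_of_le_one_right (norm_nonneg _) ?_)
      rw [sub_zero]
      exact abs_le.2 t.2

theorem prim_apply (f : PathC) (t : Icc (-1 : ℝ) 1) : prim f t = ∫ s in (0 : ℝ)..t, f.ext s := rfl

theorem prim_zero_time (f : PathC) : prim f ⟨0, by norm_num, by norm_num⟩ = 0 := by
  rw [prim_apply]
  simp

theorem hasDerivAt_ext_prim (f : PathC) {t : ℝ} (ht : t ∈ Ioo (-1 : ℝ) 1) :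
    HasDerivAt (prim f).ext (f.ext t) t := by
  have h := (f.continuous_ext.integral_hasStrictDerivAt 0 t).hasDerivAt
  refine h.congr_of_eventuallyEq ?_
  filter_upwards [isOpen_Ioo.mem_nhds ht] with s hs
  rw [ext_of_mem _ (Ioo_subset_Icc_self hs), prim_apply]

theorem res_prim (a : ℝ) (f : PathC) : res a (prim f) = prim (res a f) := by
  refine ext' fun t => ?_
  rw [res_apply, prim_apply, prim_apply]
  exact ((CircleC.res a).intervalIntegral_comp_comm (f.continuous_ext.intervalIntegrable _ _)).symm

theorem isD_res {a : ℝ} (ha : a ≠ 0) (h : PathC) : IsD (res a h) (h - a • res a h) :=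
  fun t => CircleC.isD_res ha (h t)

theorem res_of_isD {a : ℝ} (ha : a ≠ 0) {z z' : PathC} (h : IsD z z') : res a (z' + a • z) = z := by
  refine ext' fun t => ?_
  exact CircleC.res_of_isD ha (h t)

/-- Differentiation under the time integral, without estimates: `IsD f f'` is equivalent to `res 1
(f' + f) = f`, and the bounded operator `res 1` commutes with the integral. -/
theorem IsD.prim {f f' : PathC} (h : IsD f f') : IsD (prim f) (PathC.prim f') := by
  have h1 := isD_res one_ne_zero (PathC.prim (f' + (1 : ℝ) • f))
  rw [res_prim, res_of_isD one_ne_zero h] at h1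
  convert h1 using 1
  rw [← map_smul, ← map_sub]
  congr 1
  module

theorem IsD.exp {f f' : PathC} (h : IsD f f') : IsD (exp f) (exp f * f') := by
  intro t
  have := (h t).exp
  rw [← exp_apply] at this
  exact this

end PathC

/-! ### The geodesic equation in Lagrangian coordinates -/

namespace LagrangeField

open NormedSpace

variable {A : Type} [NormedCommRing A] [NormedAlgebra ℝ A] [CompleteSpace A]
  (R R' : A →L[ℝ] A) (b : ℝ)

/-- The derivative `φₓ = 1 + qₓ` of `φ = id + q`, where `q = R z` and `R = (1 + ∂ₓ)⁻¹`. -/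
def stretch (z : A) : A := 1 + z - R z

/-- Powers with real exponents. -/
def powr (s : ℝ) (p : A) : A := exp (s • lg p)

/-- The density `φₓ (m ∘ φ)`, if the momentum `m` satisfies `m ∘ φ = φₓ^(-b) m₀`. -/
def density (z m : A) : A := stretch R z * (powr (-b) (stretch R z) * m)

/-- `(u - uₓ) ∘ φ`, where `u` is the velocity with momentum `m`. -/
def velA (z m : A) : A := exp (-R z) * R (exp (R z) * density R b z m)

/-- `(u + uₓ) ∘ φ`, where `u` is the velocity with momentum `m`. -/
def velB (z m : A) : A := exp (R z) * R' (exp (-R z) * density R b z m)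

/-- The velocity `u ∘ φ`. -/
def vel (z m : A) : A := (1 / 2 : ℝ) • (velA R b z m + velB R R' b z m)

/-- The derivative of the velocity, `uₓ ∘ φ`. -/
def slope (z m : A) : A := (1 / 2 : ℝ) • (velB R R' b z m - velA R b z m)

/-- The vector field of the geodesic equation, in the coordinate `z = q + qₓ`. -/
def field (z m : A) : A := vel R R' b z m + stretch R z * slope R R' b z m

/-- The domain of the vector field. -/
def fieldDom : Set A := stretch R ⁻¹' range exp

theorem contDiff_stretch : ContDiff ℝ ω (stretch R) :=
  (contDiff_const.add contDiff_id).sub R.contDiff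

theorem isOpen_fieldDom : IsOpen (fieldDom R) :=
  isOpen_range_exp.preimage (contDiff_stretch R).continuous

theorem stretch_zero : stretch R 0 = 1 := by simp [stretch]

theorem zero_mem_fieldDom : (0 : A) ∈ fieldDom R := by
  rw [fieldDom, mem_preimage, stretch_zero]
  exact ⟨0, banach_exp_zero⟩

theorem powr_one (hA : Function.Injective (exp : A → A)) (s : ℝ) : powr s (1 : A) = 1 := by
  have : lg (1 : A) = 0 := by
    conv_lhs => rw [← banach_exp_zero (A := A)]
    exact lg_exp hA 0
  rw [powr, this, smul_zero, banach_exp_zero]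

theorem density_smul (c : ℝ) (z m : A) : density R b z (c • m) = c • density R b z m := by
  simp [density]

theorem velA_smul (c : ℝ) (z m : A) : velA R b z (c • m) = c • velA R b z m := by
  simp [velA, density_smul]

theorem velB_smul (c : ℝ) (z m : A) : velB R R' b z (c • m) = c • velB R R' b z m := by
  simp [velB, density_smul]

theorem vel_smul (c : ℝ) (z m : A) : vel R R' b z (c • m) = c • vel R R' b z m := by
  simp only [vel, velA_smul, velB_smul]
  module

/-- Linearity in the momentum is the homogeneity of geodesics: multiplying the initial velocity by
`t` amounts to running time at speed `t`. -/
theorem field_smul (c : ℝ) (z m : A) : field R R' b z (c • m) = c • field R R' b z m := by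
  simp only [field, vel, slope, velA_smul, velB_smul, mul_smul_comm, ← smul_sub]
  module

theorem vel_zero_right (z : A) : vel R R' b z 0 = 0 := by
  simpa using vel_smul R R' b 0 z 0

theorem field_zero_right (z : A) : field R R' b z 0 = 0 := by
  simpa using field_smul R R' b 0 z 0

variable (hA : Function.Injective (exp : A → A))
include hA

theorem velA_zero (m : A) : velA R b 0 m = R m := by
  simp [velA, density, stretch_zero, powr_one hA]

theorem velB_zero (m : A) : velB R R' b 0 m = R' m := by
  simp [velB, density, stretch_zero, powr_one hA]

theorem vel_zero (m : A) : vel R R' b 0 m = (1 / 2 : ℝ) • (R + R') m := by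
  rw [vel, velA_zero R b hA, velB_zero R R' b hA, add_apply]

/-- At the identity the velocity is `A⁻¹ m`, and `(1 + ∂ₓ) A⁻¹ = (1 - ∂ₓ)⁻¹`. -/
theorem field_zero (m : A) : field R R' b 0 m = R' m := by
  rw [field, vel, slope, velA_zero R b hA, velB_zero R R' b hA, stretch_zero, one_mul]
  module

theorem contDiffOn_powr (s : ℝ) : ContDiffOn ℝ ω (powr s : A → A) (range exp) :=
  banach_contDiff_exp.comp_contDiffOn ((contDiffOn_lg hA).const_smul s)

theorem contDiffOn_powr_stretch (s : ℝ) :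
    ContDiffOn ℝ ω (fun z => powr s (stretch R z)) (fieldDom R) :=
  (contDiffOn_powr hA s).comp (contDiff_stretch R).contDiffOn fun _ h => h

theorem contDiffOn_density :
    ContDiffOn ℝ ω (fun w : A × A => density R b w.1 w.2) (fieldDom R ×ˢ univ) :=
  ((contDiff_stretch R).comp contDiff_fst).contDiffOn.mul
    (((contDiffOn_powr_stretch R hA (-b)).comp contDiffOn_fst fun _ h => h.1).mul contDiffOn_snd)

theorem contDiffOn_velA :
    ContDiffOn ℝ ω (fun w : A × A => velA R b w.1 w.2) (fieldDom R ×ˢ univ) :=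
  (banach_contDiff_exp.comp (R.contDiff.comp contDiff_fst).neg).contDiffOn.mul
    (R.contDiff.comp_contDiffOn ((banach_contDiff_exp.comp (R.contDiff.comp contDiff_fst)).contDiffOn.mul
      (contDiffOn_density R b hA)))

theorem contDiffOn_velB :
    ContDiffOn ℝ ω (fun w : A × A => velB R R' b w.1 w.2) (fieldDom R ×ˢ univ) :=
  (banach_contDiff_exp.comp (R.contDiff.comp contDiff_fst)).contDiffOn.mul
    (R'.contDiff.comp_contDiffOn
      ((banach_contDiff_exp.comp (R.contDiff.comp contDiff_fst).neg).contDiffOn.mul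
        (contDiffOn_density R b hA)))

theorem contDiffOn_vel :
    ContDiffOn ℝ ω (fun w : A × A => vel R R' b w.1 w.2) (fieldDom R ×ˢ univ) :=
  ((contDiffOn_velA R b hA).add (contDiffOn_velB R R' b hA)).const_smul _

theorem contDiffOn_field :
    ContDiffOn ℝ ω (fun w : A × A => field R R' b w.1 w.2) (fieldDom R ×ˢ univ) :=
  (contDiffOn_vel R R' b hA).add (((contDiff_stretch R).comp contDiff_fst).contDiffOn.mul
    (((contDiffOn_velB R R' b hA).sub (contDiffOn_velA R b hA)).const_smul _))

theorem contDiffAt_field :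
    ContDiffAt ℝ ω (fun w : A × A => field R R' b w.1 w.2) 0 :=
  (contDiffOn_field R R' b hA).contDiffAt
    (((isOpen_fieldDom R).prod isOpen_univ).mem_nhds ⟨zero_mem_fieldDom R, mem_univ _⟩)

end LagrangeField

/-- The total derivative is the sum of the two partial derivatives, which are read off from the
restrictions to the axes. This gives linearizations at the origin without differentiating the
explicit formula of the field. -/
theorem hasFDerivAt_of_partial {E F G : Type*} [NormedAddCommGroup E] [NormedSpace ℝ E]
    [NormedAddCommGroup F] [NormedSpace ℝ F] [NormedAddCommGroup G] [NormedSpace ℝ G]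
    {f : E × F → G} (hf : DifferentiableAt ℝ f 0) (h1 : ∀ x, f (x, 0) = 0) {L : F →L[ℝ] G}
    (h2 : ∀ y, f (0, y) = L y) : HasFDerivAt f (L.comp (ContinuousLinearMap.snd ℝ E F)) 0 := by
  have hd := hf.hasFDerivAt
  have e1 : HasFDerivAt (fun x : E => f (x, 0)) ((fderiv ℝ f 0).comp (ContinuousLinearMap.inl ℝ E F)) 0 :=
    HasFDerivAt.comp (f := fun x : E => (x, (0 : F))) 0 (by simpa using! hd)
      (ContinuousLinearMap.inl ℝ E F).hasFDerivAt
  have e2 : HasFDerivAt (fun y : F => f (0, y)) ((fderiv ℝ f 0).comp (ContinuousLinearMap.inr ℝ E F)) 0 :=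
    HasFDerivAt.comp (f := fun y : F => ((0 : E), y)) 0 (by simpa using! hd)
      (ContinuousLinearMap.inr ℝ E F).hasFDerivAt
  simp only [h1] at e1
  simp only [h2] at e2
  have e1' := e1.unique (hasFDerivAt_const _ _)
  have e2' := e2.unique L.hasFDerivAt
  convert! hd using 1
  ext x
  · simpa using (DFunLike.congr_fun e1' x).symm
  · simpa using (DFunLike.congr_fun e2' x).symm

/-! ### The resolvents and the geodesic field on continuous functions. -/

namespace CircleC

/-- `(1 + ∂ₓ)⁻¹` -/
abbrev resP : CircleC →L[ℝ] CircleC := res 1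

/-- `(1 - ∂ₓ)⁻¹` -/
abbrev resM : CircleC →L[ℝ] CircleC := -res (-1)

theorem isD_resP (h : CircleC) : IsD (resP h) (h - resP h) := by
  simpa using isD_res one_ne_zero h

theorem isD_resM (h : CircleC) : IsD (resM h) (resM h - h) := by
  have := (isD_res (a := -1) (by norm_num) h).neg
  have e : resM h - h = -(h - (-1 : ℝ) • res (-1) h) := by
    rw [show resM h = -res (-1) h from rfl, neg_one_smul]
    abel
  rwa [e]

theorem resP_of_isD {z z' : CircleC} (h : IsD z z') : resP (z + z') = z := by
  have := res_of_isD one_ne_zero h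
  rwa [one_smul, add_comm] at this

theorem resM_of_isD {z z' : CircleC} (h : IsD z z') : resM (z - z') = z := by
  have := res_of_isD (a := -1) (by norm_num) h
  rw [show resM (z - z') = -res (-1) (z - z') from rfl, ← map_neg]
  convert this using 2
  module

open NormedSpace

/-- The derivative of `id + (1 + ∂ₓ)⁻¹ z`. -/
def stretch (z : CircleC) : CircleC := LagrangeField.stretch (A := CircleC) resP z

/-- Powers with real exponents. -/
def powr (s : ℝ) (p : CircleC) : CircleC := LagrangeField.powr (A := CircleC) s p

/-- `φₓ^(1-b) m`. -/
def density (b : ℝ) (z m : CircleC) : CircleC := LagrangeField.density (A := CircleC) resP b z m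

/-- `(u - uₓ) ∘ φ` -/
def velA (b : ℝ) (z m : CircleC) : CircleC := LagrangeField.velA (A := CircleC) resP b z m

/-- `(u + uₓ) ∘ φ` -/
def velB (b : ℝ) (z m : CircleC) : CircleC := LagrangeField.velB (A := CircleC) resP resM b z m

/-- `u ∘ φ` -/
def vel (b : ℝ) (z m : CircleC) : CircleC := LagrangeField.vel (A := CircleC) resP resM b z m

/-- `uₓ ∘ φ` -/
def slope (b : ℝ) (z m : CircleC) : CircleC := LagrangeField.slope (A := CircleC) resP resM b z m

/-- The vector field of the geodesic equation. -/
def field (b : ℝ) (z m : CircleC) : CircleC := LagrangeField.field (A := CircleC) resP resM b z m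

/-- The domain of the vector field. -/
def dom : Set CircleC := LagrangeField.fieldDom (A := CircleC) resP

theorem stretch_eq (z : CircleC) : stretch z = 1 + z - resP z := rfl

theorem density_eq (b : ℝ) (z m : CircleC) :
    density b z m = stretch z * (powr (-b) (stretch z) * m) := rfl

theorem velA_eq (b : ℝ) (z m : CircleC) :
    velA b z m = exp (-resP z) * resP (exp (resP z) * density b z m) := rfl

theorem velB_eq (b : ℝ) (z m : CircleC) :
    velB b z m = exp (resP z) * resM (exp (-resP z) * density b z m) := rfl

theorem vel_eq (b : ℝ) (z m : CircleC) : vel b z m = (1 / 2 : ℝ) • (velA b z m + velB b z m) := rfl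

theorem slope_eq (b : ℝ) (z m : CircleC) :
    slope b z m = (1 / 2 : ℝ) • (velB b z m - velA b z m) := rfl

theorem field_eq (b : ℝ) (z m : CircleC) : field b z m = vel b z m + stretch z * slope b z m := rfl

theorem isOpen_dom : IsOpen dom := LagrangeField.isOpen_fieldDom (A := CircleC) resP

theorem mem_dom {z : CircleC} : z ∈ dom ↔ ∀ x, 0 < stretch z x := mem_range_exp

theorem powr_apply {p : CircleC} (hp : ∀ x, 0 < p x) (s : ℝ) (x : UnitAddCircle) :
    powr s p x = (p x) ^ s := by
  have h1 : exp (lg p) = p := exp_lg (mem_range_exp.2 hp)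
  have h2 : p x = Real.exp (lg p x) := by
    conv_lhs => rw [← h1, exp_apply]
  have h3 : powr s p x = Real.exp ((s • lg p) x) := exp_apply _ _
  rw [h3, h2, ← Real.exp_mul, smul_apply, mul_comm]

theorem field_smul (b c : ℝ) (z m : CircleC) : field b z (c • m) = c • field b z m :=
  LagrangeField.field_smul (A := CircleC) resP resM b c z m

theorem contDiffOn_field (b : ℝ) :
    ContDiffOn ℝ ω (fun w : CircleC × CircleC => field b w.1 w.2) (dom ×ˢ univ) := by
  have := LagrangeField.contDiffOn_field (A := CircleC) resP resM b exp_injective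
  exact this

end CircleC

/-! ### The same field on paths, evaluated pointwise in time. -/

namespace PathC

open NormedSpace

/-- `(1 + ∂ₓ)⁻¹` -/
abbrev resP : PathC →L[ℝ] PathC := res 1

/-- `(1 - ∂ₓ)⁻¹` -/
abbrev resM : PathC →L[ℝ] PathC := -res (-1)

theorem resP_apply (f : PathC) (t : Icc (-1 : ℝ) 1) : resP f t = CircleC.resP (f t) := rfl

theorem resM_apply (f : PathC) (t : Icc (-1 : ℝ) 1) : resM f t = CircleC.resM (f t) := rfl

/-- The derivative of `id + (1 + ∂ₓ)⁻¹ z`. -/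
def stretch (z : PathC) : PathC := LagrangeField.stretch (A := PathC) resP z

/-- Powers with real exponents. -/
def powr (s : ℝ) (p : PathC) : PathC := LagrangeField.powr (A := PathC) s p

/-- `φₓ^(1-b) m`. -/
def density (b : ℝ) (z m : PathC) : PathC := LagrangeField.density (A := PathC) resP b z m

/-- `(u - uₓ) ∘ φ` -/
def velA (b : ℝ) (z m : PathC) : PathC := LagrangeField.velA (A := PathC) resP b z m

/-- `(u + uₓ) ∘ φ` -/
def velB (b : ℝ) (z m : PathC) : PathC := LagrangeField.velB (A := PathC) resP resM b z m

/-- `u ∘ φ` -/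
def vel (b : ℝ) (z m : PathC) : PathC := LagrangeField.vel (A := PathC) resP resM b z m

/-- `uₓ ∘ φ` -/
def slope (b : ℝ) (z m : PathC) : PathC := LagrangeField.slope (A := PathC) resP resM b z m

/-- The vector field of the geodesic equation. -/
def field (b : ℝ) (z m : PathC) : PathC := LagrangeField.field (A := PathC) resP resM b z m

/-- The domain of the vector field. -/
def dom : Set PathC := LagrangeField.fieldDom (A := PathC) resP

theorem stretch_eq (z : PathC) : stretch z = 1 + z - resP z := rfl

theorem density_eq (b : ℝ) (z m : PathC) :
    density b z m = stretch z * (powr (-b) (stretch z) * m) := rfl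

theorem velA_eq (b : ℝ) (z m : PathC) :
    velA b z m = exp (-resP z) * resP (exp (resP z) * density b z m) := rfl

theorem velB_eq (b : ℝ) (z m : PathC) :
    velB b z m = exp (resP z) * resM (exp (-resP z) * density b z m) := rfl

theorem vel_eq (b : ℝ) (z m : PathC) : vel b z m = (1 / 2 : ℝ) • (velA b z m + velB b z m) := rfl

theorem slope_eq (b : ℝ) (z m : PathC) :
    slope b z m = (1 / 2 : ℝ) • (velB b z m - velA b z m) := rfl

theorem field_eq (b : ℝ) (z m : PathC) : field b z m = vel b z m + stretch z * slope b z m := rfl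

theorem isOpen_dom : IsOpen dom := LagrangeField.isOpen_fieldDom (A := PathC) resP

theorem zero_mem_dom : (0 : PathC) ∈ dom := LagrangeField.zero_mem_fieldDom (A := PathC) resP

theorem field_zero_right (b : ℝ) (z : PathC) : field b z 0 = 0 :=
  LagrangeField.field_zero_right (A := PathC) resP resM b z

theorem field_zero (b : ℝ) (m : PathC) : field b 0 m = resM m :=
  LagrangeField.field_zero (A := PathC) resP resM b exp_injective m

theorem vel_zero_right (b : ℝ) (z : PathC) : vel b z 0 = 0 :=
  LagrangeField.vel_zero_right (A := PathC) resP resM b z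

theorem vel_zero (b : ℝ) (m : PathC) : vel b 0 m = (1 / 2 : ℝ) • (resP + resM) m :=
  LagrangeField.vel_zero (A := PathC) resP resM b exp_injective m

theorem contDiffAt_field (b : ℝ) :
    ContDiffAt ℝ ω (fun w : PathC × PathC => field b w.1 w.2) 0 := by
  have := LagrangeField.contDiffAt_field (A := PathC) resP resM b exp_injective
  exact this

theorem contDiff_stretch : ContDiff ℝ ω stretch := LagrangeField.contDiff_stretch (A := PathC) resP

theorem contDiffOn_powr_stretch (s : ℝ) : ContDiffOn ℝ ω (fun z => powr s (stretch z)) dom := by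
  have := LagrangeField.contDiffOn_powr_stretch (A := PathC) resP exp_injective s
  exact this

theorem contDiffOn_velA (b : ℝ) :
    ContDiffOn ℝ ω (fun w : PathC × PathC => velA b w.1 w.2) (dom ×ˢ univ) := by
  have := LagrangeField.contDiffOn_velA (A := PathC) resP b exp_injective
  exact this

theorem contDiffOn_velB (b : ℝ) :
    ContDiffOn ℝ ω (fun w : PathC × PathC => velB b w.1 w.2) (dom ×ˢ univ) := by
  have := LagrangeField.contDiffOn_velB (A := PathC) resP resM b exp_injective
  exact this

theorem contDiffOn_vel (b : ℝ) :
    ContDiffOn ℝ ω (fun w : PathC × PathC => vel b w.1 w.2) (dom ×ˢ univ) := by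
  have := LagrangeField.contDiffOn_vel (A := PathC) resP resM b exp_injective
  exact this

theorem stretch_apply (z : PathC) (t : Icc (-1 : ℝ) 1) : stretch z t = CircleC.stretch (z t) := rfl

variable {z : PathC} (hz : z ∈ dom) (b : ℝ) (m : PathC) (t : Icc (-1 : ℝ) 1)
include hz

theorem apply_mem_dom : z t ∈ CircleC.dom := apply_mem_range_exp hz t

/-- The logarithm is a choice of preimage under `exp` and commutes with evaluation only on the range
of `exp`. This is where `z ∈ dom` enters, and hence in the evaluation lemmas that follow. -/
theorem powr_apply (s : ℝ) : powr s (stretch z) t = CircleC.powr s (CircleC.stretch (z t)) := by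
  have h1 : powr s (stretch z) = exp (s • lg (stretch z)) := rfl
  have h2 : lg (stretch z) t = lg (stretch z t) := lg_apply hz t
  rw [h1, exp_apply, smul_apply, h2]
  rfl

theorem density_apply : density b z m t = CircleC.density b (z t) (m t) := by
  simp only [density_eq, CircleC.density_eq, mul_apply, powr_apply hz, stretch_apply]

theorem velA_apply : velA b z m t = CircleC.velA b (z t) (m t) := by
  simp only [velA_eq, CircleC.velA_eq, mul_apply, exp_apply, resP_apply,
    neg_apply, density_apply hz b]

theorem velB_apply : velB b z m t = CircleC.velB b (z t) (m t) := by
  simp only [velB_eq, CircleC.velB_eq, mul_apply, exp_apply, resP_apply, resM_apply,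
    neg_apply, density_apply hz b]

theorem vel_apply : vel b z m t = CircleC.vel b (z t) (m t) := by
  simp only [vel_eq, CircleC.vel_eq, smul_apply, add_apply,
    velA_apply hz b, velB_apply hz b]

theorem slope_apply : slope b z m t = CircleC.slope b (z t) (m t) := by
  simp only [slope_eq, CircleC.slope_eq, smul_apply, sub_apply,
    velA_apply hz b, velB_apply hz b]

theorem field_apply : field b z m t = CircleC.field b (z t) (m t) := by
  simp only [field_eq, CircleC.field_eq, mul_apply, add_apply,
    vel_apply hz b, slope_apply hz b, stretch_apply]

end PathC

/-! ### Existence of solutions and smooth dependence on the initial velocity -/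

section ImplicitFunction

variable {E F : Type*} [NormedAddCommGroup E] [NormedSpace ℝ E] [CompleteSpace E]
  [NormedAddCommGroup F] [NormedSpace ℝ F] [CompleteSpace F]

/-- The shear `(x, y) ↦ (x, y - L x)`. -/
def shearEquiv (L : E →L[ℝ] F) : (E × F) ≃L[ℝ] (E × F) := ContinuousLinearEquiv.equivOfInverse
  ((ContinuousLinearMap.fst ℝ E F).prod
    (ContinuousLinearMap.snd ℝ E F - L.comp (ContinuousLinearMap.fst ℝ E F)))
  ((ContinuousLinearMap.fst ℝ E F).prod
    (ContinuousLinearMap.snd ℝ E F + L.comp (ContinuousLinearMap.fst ℝ E F)))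
  (fun w => by simp) (fun w => by simp)

/-- Fixed points depending analytically on a parameter, if the dependence on the point is of second
order. -/
theorem exists_fixedPoint {G : E × F → F} {L : E →L[ℝ] F} (hG : ContDiffAt ℝ ω G 0) (hG0 : G 0 = 0)
    (hGd : HasFDerivAt G (L.comp (ContinuousLinearMap.fst ℝ E F)) 0) {O : Set F} (hO : O ∈ 𝓝 0) :
    ∃ (ρ ε : ℝ) (Z : E → F), 0 < ρ ∧ 0 < ε ∧ ContDiffOn ℝ ω Z (Metric.ball 0 ρ) ∧
      HasFDerivAt Z L 0 ∧ Z 0 = 0 ∧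
      (∀ m ∈ Metric.ball 0 ρ, Z m ∈ O ∧ ‖Z m‖ < ε ∧ Z m = G (m, Z m)) ∧
      ∀ m ∈ Metric.ball 0 ρ, ∀ z, ‖z‖ < ε → z = G (m, z) → z = Z m := by
  -- Fixed points of `G (m, ·)` are the solutions of `S (m, z) = (m, 0)`. The derivative of `S` at
  -- `0` is a shear, hence invertible, so `Z m` is the second component of the local inverse at `(m,
  -- 0)`.
  let S : E × F → E × F := fun w => (w.1, w.2 - G w)
  have hs : ContDiffAt ℝ ω S 0 := contDiffAt_fst.prodMk (contDiffAt_snd.sub hG)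
  have hd : HasFDerivAt S (shearEquiv L : E × F →L[ℝ] E × F) 0 :=
    hasFDerivAt_fst.prodMk (hasFDerivAt_snd.sub hGd)
  have hs0 : S 0 = 0 := by simp [S, hG0]
  let e := hs.toOpenPartialHomeomorph S hd (by simp)
  have he0 : (0 : E × F) ∈ e.source := hs.mem_toOpenPartialHomeomorph_source hd (by simp)
  have hecoe : ∀ w, e w = S w := fun w => rfl
  have hes : ContDiffAt ℝ ω e.symm 0 := by
    have := hs.to_localInverse hd (by simp)
    rw [hs0] at this
    exact this
  have hes0 : e.symm 0 = 0 := by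
    have := e.left_inv he0
    rwa [hecoe, hs0] at this
  have het0 : (0 : E × F) ∈ e.target := by
    have := e.map_source he0
    rwa [hecoe, hs0] at this
  let I : E →L[ℝ] E × F := ContinuousLinearMap.inl ℝ E F
  have hI0 : I 0 = 0 := map_zero _
  let Z : E → F := fun m => (e.symm (I m)).2
  have hZat : ContDiffAt ℝ ω Z 0 :=
    contDiffAt_snd.comp 0 (ContDiffAt.comp (f := I) 0 (by rw [hI0]; exact hes) I.contDiff.contDiffAt)
  have hZ0 : Z 0 = 0 := by
    change (e.symm (I 0)).2 = 0
    rw [hI0, hes0]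
    rfl
  have hZd : HasFDerivAt Z L 0 := by
    have h1 : HasFDerivAt e.symm ((shearEquiv L).symm : E × F →L[ℝ] E × F) 0 :=
      e.hasFDerivAt_symm het0 (by rw [hes0]; exact hd)
    have h2 : HasFDerivAt (fun m => e.symm (I m)) _ 0 :=
      HasFDerivAt.comp (f := I) 0 (by rw [hI0]; exact h1) I.hasFDerivAt
    have h3 : HasFDerivAt Z _ 0 := h2.snd
    convert! h3 using 1
    ext1 m
    exact (zero_add (L m)).symm
  obtain ⟨ε, hε, hball⟩ := Metric.mem_nhds_iff.1 (e.open_source.mem_nhds he0)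
  have hZc : ContinuousAt Z 0 := hZat.continuousAt
  -- The last condition `‖m‖ < ε` puts `(m, z)` in the source of `e` for every `‖z‖ < ε`; uniqueness
  -- then follows from injectivity of `e` there.
  have hev : ∀ᶠ m in 𝓝 (0 : E), ContDiffAt ℝ ω Z m ∧ I m ∈ e.target ∧ Z m ∈ O ∧
      ‖Z m‖ < ε ∧ ‖m‖ < ε := by
    refine (hZat.eventually (by simp)).and (.and ?_ (.and ?_ (.and ?_ ?_)))
    · exact I.continuous.continuousAt.eventually (by rw [hI0]; exact e.open_target.mem_nhds het0)
    · exact hZc.eventually (by rw [hZ0]; exact hO)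
    · exact hZc.norm.eventually_lt continuousAt_const (by simpa [hZ0] using hε)
    · exact continuousAt_id.norm.eventually_lt continuousAt_const (by simpa using hε)
  obtain ⟨ρ, hρ, hρb⟩ := Metric.eventually_nhds_iff_ball.1 hev
  refine ⟨ρ, ε, Z, hρ, hε, fun m hm => (hρb m hm).1.contDiffWithinAt, hZd, hZ0, fun m hm => ?_,
    fun m hm z hz hsol => ?_⟩
  · obtain ⟨-, h2, h3, h4, -⟩ := hρb m hm
    have h6 := e.right_inv h2
    rw [hecoe] at h6
    have h7 : (e.symm (I m)).1 = m := congrArg Prod.fst h6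
    have h8 : (e.symm (I m)).2 - G (e.symm (I m)) = 0 := congrArg Prod.snd h6
    rw [sub_eq_zero] at h8
    have h9 : (m, Z m) = e.symm (I m) := Prod.ext h7.symm rfl
    exact ⟨h3, h4, by rw [h9]; exact h8⟩
  · have h1 : (m, z) ∈ e.source := by
      refine hball ?_
      rw [mem_ball_zero_iff, Prod.norm_def]
      exact max_lt (hρb m hm).2.2.2.2 hz
    have h2 : e (m, z) = I m := by
      rw [hecoe]
      refine Prod.ext rfl ?_
      change z - G (m, z) = 0
      rw [← hsol, sub_self]
    have h3 := e.left_inv h1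
    rw [h2] at h3
    change z = (e.symm (I m)).2
    rw [h3]

/-- Since `H` vanishes for zero momentum, the right-hand side has no first-order dependence on `z`
at the origin. The linearization of the fixed point is then simply `T N c`. -/
theorem exists_fixedPoint_of_partial {H : F × F → F} {N T : F →L[ℝ] F} {c : E →L[ℝ] F}
    (hH : ContDiffAt ℝ ω H 0) (h1 : ∀ z, H (z, 0) = 0) (h2 : ∀ y, H (0, y) = N y)
    {O : Set F} (hO : O ∈ 𝓝 0) :
    ∃ (ρ ε : ℝ) (Z : E → F), 0 < ρ ∧ 0 < ε ∧ ContDiffOn ℝ ω Z (Metric.ball 0 ρ) ∧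
      HasFDerivAt Z (T ∘L N ∘L c) 0 ∧ Z 0 = 0 ∧
      (∀ m ∈ Metric.ball 0 ρ, Z m ∈ O ∧ ‖Z m‖ < ε ∧ Z m = T (H (Z m, c m))) ∧
      ∀ m ∈ Metric.ball 0 ρ, ∀ z, ‖z‖ < ε → z = T (H (z, c m)) → z = Z m := by
  have hd := hasFDerivAt_of_partial (hH.differentiableAt (by simp)) h1 h2
  let J : E × F →L[ℝ] F × F :=
    (ContinuousLinearMap.snd ℝ E F).prod (c.comp (ContinuousLinearMap.fst ℝ E F))
  have hJ0 : J 0 = 0 := map_zero _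
  have hGd : HasFDerivAt (fun w : E × F => T (H (J w))) _ 0 :=
    T.hasFDerivAt.comp 0 (HasFDerivAt.comp (f := J) 0 (by rw [hJ0]; exact hd) J.hasFDerivAt)
  have hG : ContDiffAt ℝ ω (fun w : E × F => T (H (J w))) 0 :=
    T.contDiff.contDiffAt.comp 0
      (ContDiffAt.comp (f := J) 0 (by rw [hJ0]; exact hH) J.contDiff.contDiffAt)
  have hz : T (H (J 0)) = 0 := by
    have : H 0 = 0 := h1 0
    rw [hJ0, this, map_zero]
  exact exists_fixedPoint hG hz (L := T ∘L N ∘L c) hGd hO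

end ImplicitFunction

namespace PathC

/-- The initial value problem is solved as an integral equation in the space of paths over the fixed
interval `[-1, 1]`, so analytic dependence on the momentum is part of the implicit function theorem.
The bound `1/2` on `q = resP (Z m)` keeps the geodesic inside the chart around the identity. -/
theorem exists_solution (b : ℝ) : ∃ (ρ ε : ℝ) (Z : CircleC → PathC), 0 < ρ ∧ 0 < ε ∧
    ContDiffOn ℝ ω Z (Metric.ball 0 ρ) ∧ HasFDerivAt Z (prim ∘L resM ∘L cst) 0 ∧
    Z 0 = 0 ∧
    (∀ m ∈ Metric.ball 0 ρ, (Z m ∈ dom ∧ ‖resP (Z m)‖ < 1 / 2) ∧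
      ‖Z m‖ < ε ∧ Z m = prim (field b (Z m) (cst m))) ∧
    ∀ m ∈ Metric.ball 0 ρ, ∀ z, ‖z‖ < ε → z = prim (field b z (cst m)) → z = Z m := by
  have hO : {z : PathC | z ∈ dom ∧ ‖resP z‖ < 1 / 2} ∈ 𝓝 (0 : PathC) := by
    refine inter_mem (isOpen_dom.mem_nhds zero_mem_dom) ?_
    refine (isOpen_lt resP.continuous.norm continuous_const).mem_nhds ?_
    simp
  exact exists_fixedPoint_of_partial (T := prim) (c := cst) (contDiffAt_field b)
    (field_zero_right b) (field_zero b) hO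

end PathC

/-! ### Regularity of solutions in the space variable -/

namespace CircleC

open NormedSpace

theorem isD_resP_stretch (z : CircleC) : IsD (resP z) (stretch z - 1) := by
  have h := isD_resP z
  rwa [show z - resP z = stretch z - 1 by rw [stretch_eq]; ring] at h

/-- In Eulerian form this is `(u - uₓ)ₓ = A u - (u - uₓ)`, composed with `φ`. The explicit formula
of `velA` is its solution with the integrating factor `e^q`. -/
theorem isD_velA (b : ℝ) (z m : CircleC) :
    IsD (velA b z m) (stretch z * (powr (-b) (stretch z) * m - velA b z m)) := by
  have h := (isD_resP_stretch z).neg.exp.mul (isD_resP (exp (resP z) * density b z m))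
  rw [← velA_eq] at h
  convert h using 1
  linear_combination (-stretch z) * velA_eq b z m - density b z m * banach_exp_mul_exp_neg (resP z) -
    density_eq b z m

theorem isD_velB (b : ℝ) (z m : CircleC) :
    IsD (velB b z m) (stretch z * (velB b z m - powr (-b) (stretch z) * m)) := by
  have h := (isD_resP_stretch z).exp.mul (isD_resM (exp (-resP z) * density b z m))
  rw [← velB_eq] at h
  convert h using 1
  linear_combination stretch z * velB_eq b z m + density b z m * banach_exp_mul_exp_neg (resP z) +
    density_eq b z m

theorem isD_vel (b : ℝ) (z m : CircleC) : IsD (vel b z m) (stretch z * slope b z m) := by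
  have h := ((isD_velA b z m).add (isD_velB b z m)).smul (1 / 2)
  rw [← vel_eq] at h
  convert h using 1
  rw [slope_eq, mul_smul_comm]
  congr 1
  ring

theorem isD_slope (b : ℝ) (z m : CircleC) :
    IsD (slope b z m) (stretch z * (vel b z m - powr (-b) (stretch z) * m)) := by
  have h := ((isD_velB b z m).sub (isD_velA b z m)).smul (1 / 2)
  rw [← slope_eq] at h
  convert h using 1
  refine ext' fun x => ?_
  simp only [vel_eq, mul_apply, sub_apply, add_apply, smul_apply]
  ring

end CircleC

namespace PathC

open NormedSpace

/-- The path `z` solves the geodesic equation with initial momentum `m`. -/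
def IsSol (b : ℝ) (z : PathC) (m : CircleC) : Prop := z ∈ dom ∧ z = prim (field b z (cst m))

theorem prim_mul_cst (f : PathC) (m : CircleC) : prim (f * cst m) = prim f * cst m := by
  refine ext' fun t => ?_
  rw [mul_apply, prim_apply, prim_apply, cst_apply]
  have := (ContinuousLinearMap.mul ℝ CircleC m).intervalIntegral_comp_comm
    (f.continuous_ext.intervalIntegrable (μ := MeasureTheory.volume) 0 t)
  simp only [ContinuousLinearMap.mul_apply'] at this
  rw [mul_comm _ m, ← this]
  congr 1
  funext s
  exact mul_comm _ _

/-- The equation says `p_t = p s` with `p(0) = 1`, so `p e^(-∫ s)` is constant in time at every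
point of the circle. -/
theorem eq_exp_prim {p s : PathC} (h : p = 1 + prim (p * s)) : p = exp (prim s) := by
  suffices H : p * exp (-prim s) = 1 by
    have := congrArg (· * exp (prim s)) H
    simpa [mul_assoc, mul_comm (exp (-prim s)), banach_exp_mul_exp_neg] using this
  refine ext' fun t => CircleC.ext' fun x => ?_
  set g : ℝ → ℝ := fun t => p.ext t x * Real.exp (-(prim s).ext t x) with hg
  have hgc : Continuous g := by
    have h1 := (CircleC.ev x).continuous.comp p.continuous_ext
    have h2 := (CircleC.ev x).continuous.comp (prim s).continuous_ext
    exact h1.mul (Real.continuous_exp.comp h2.neg)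
  have hgd : ∀ t ∈ Ioo (-1 : ℝ) 1, HasDerivAt g 0 t := by
    intro t ht
    have h1 : HasDerivAt p.ext ((p * s).ext t) t := by
      have := (hasDerivAt_ext_prim (p * s) ht).const_add 1
      refine this.congr_of_eventuallyEq (Eventually.of_forall fun r => ?_)
      conv_lhs => rw [h]
      rfl
    have h2 := hasDerivAt_ext_prim s ht
    have h1' := (CircleC.ev x).hasFDerivAt.comp_hasDerivAt t h1
    have h2' := (CircleC.ev x).hasFDerivAt.comp_hasDerivAt t h2
    have h3 := h1'.mul h2'.neg.exp
    convert! h3 using 1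
    change _ = (p.ext t x * s.ext t x) * Real.exp (-(prim s).ext t x) +
      p.ext t x * (Real.exp (-(prim s).ext t x) * (-s.ext t x))
    ring
  have h0 : g 0 = 1 := by
    have hz : (0 : ℝ) ∈ Icc (-1 : ℝ) 1 := by constructor <;> norm_num
    have e1 : (prim s).ext 0 = 0 := by rw [ext_of_mem _ hz, prim_zero_time]
    have e2 : p.ext 0 = 1 := by
      rw [h, ext_of_mem _ hz, add_apply, prim_zero_time, add_zero, one_apply]
    simp only [hg, e1, e2]
    simp [CircleC.one_apply, CircleC.zero_apply]
  have hconst : EqOn g (fun _ => 1) (Ioo (-1 : ℝ) 1) := by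
    intro t ht
    have := isOpen_Ioo.is_const_of_deriv_eq_zero isPreconnected_Ioo
      (fun r hr => (hgd r hr).differentiableAt.differentiableWithinAt) (fun r hr => (hgd r hr).deriv)
      ht (y := 0) (by constructor <;> norm_num)
    rw [this, h0]
  -- The extended paths are constant beyond `±1`, so the derivative is computed only in the open
  -- interval; the end points follow by continuity.
  have hcl := hconst.closure hgc continuous_const
  rw [closure_Ioo (by norm_num)] at hcl
  have := hcl t.2
  simp only [hg, ext_coe] at this
  rw [mul_apply, CircleC.mul_apply, exp_apply, neg_apply, CircleC.exp_apply]
  exact this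

section Facts

variable {b : ℝ} {z : PathC} (hz : z ∈ dom) (m : PathC)

theorem isD_resP_stretch (z : PathC) : IsD (resP z) (stretch z - 1) :=
  fun t => CircleC.isD_resP_stretch (z t)

include hz

theorem isD_velA : IsD (velA b z m) (stretch z * (powr (-b) (stretch z) * m - velA b z m)) := by
  intro t
  simp only [mul_apply, sub_apply, velA_apply hz, powr_apply hz, stretch_apply]
  exact CircleC.isD_velA b (z t) (m t)

theorem isD_velB : IsD (velB b z m) (stretch z * (velB b z m - powr (-b) (stretch z) * m)) := by
  intro t
  simp only [mul_apply, sub_apply, velB_apply hz, powr_apply hz, stretch_apply]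
  exact CircleC.isD_velB b (z t) (m t)

theorem isD_vel : IsD (vel b z m) (stretch z * slope b z m) := by
  intro t
  simp only [mul_apply, vel_apply hz, slope_apply hz, stretch_apply]
  exact CircleC.isD_vel b (z t) (m t)

theorem isD_slope : IsD (slope b z m) (stretch z * (vel b z m - powr (-b) (stretch z) * m)) := by
  intro t
  simp only [mul_apply, sub_apply, vel_apply hz, slope_apply hz, powr_apply hz, stretch_apply]
  exact CircleC.isD_slope b (z t) (m t)

end Facts

/-- The logarithmic derivative of `φₓ`. -/
def logStretch (b : ℝ) (z m : PathC) : PathC :=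
  prim (stretch z * (vel b z m - powr (-b) (stretch z) * m))

namespace IsSol

variable {b : ℝ} {z : PathC} {m : CircleC} (h : IsSol b z m)
include h

theorem resP_eq : resP z = prim (vel b z (cst m)) := by
  have h1 : resP (field b z (cst m)) = vel b z (cst m) := by
    refine ext' fun t => ?_
    rw [resP_apply, field_eq]
    exact CircleC.resP_of_isD (isD_vel h.1 (cst m) t)
  conv_lhs => rw [h.2]
  rw [res_prim, h1]

/-- Integrated form of `(φₓ)_t = φₓ (uₓ ∘ φ)`: it is the difference of the equations `z_t = field`
and `q_t = u ∘ φ`. -/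
theorem stretch_eq_add : stretch z = 1 + prim (stretch z * slope b z (cst m)) := by
  have h1 : stretch z * slope b z (cst m) = field b z (cst m) - vel b z (cst m) := by
    rw [field_eq]
    ring
  rw [h1, map_sub, ← h.2, ← h.resP_eq, stretch_eq]
  ring

theorem stretch_eq_exp : stretch z = exp (prim (slope b z (cst m))) := eq_exp_prim h.stretch_eq_add

theorem powr_stretch (s : ℝ) : powr s (stretch z) = exp (s • prim (slope b z (cst m))) := by
  have h1 : powr s (stretch z) = exp (s • lg (stretch z)) := rfl
  rw [h1, h.stretch_eq_exp, lg_exp exp_injective]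

theorem isD_prim_slope : IsD (prim (slope b z (cst m))) (logStretch b z (cst m)) :=
  (isD_slope h.1 (cst m)).prim

/-- This is the source of the spatial regularity. A priori `φₓ` is only continuous, but `log φₓ` is
the time integral of `uₓ ∘ φ`, whose derivative in `x` involves `m` without derivatives of `m`. -/
theorem isD_stretch : IsD (stretch z) (stretch z * logStretch b z (cst m)) := by
  have := h.isD_prim_slope.exp
  rwa [← h.stretch_eq_exp] at this

theorem isD_powr (s : ℝ) : IsD (powr s (stretch z)) (powr s (stretch z) * (s • logStretch b z (cst m))) := by
  have h1 : IsD (s • prim (slope b z (cst m))) (s • logStretch b z (cst m)) :=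
    fun t => (h.isD_prim_slope t).smul s
  have := h1.exp
  rwa [← h.powr_stretch] at this

/-- The initial momentum does not depend on time and comes out of the integral. This isolates the
only term of `φₓₓ / φₓ` that is no smoother than `m`. -/
theorem logStretch_eq : logStretch b z (cst m) = prim (stretch z * vel b z (cst m)) -
    prim (stretch z * powr (-b) (stretch z)) * cst m := by
  rw [← prim_mul_cst, ← map_sub, logStretch]
  congr 1
  ring

theorem hasDerivAt {t : ℝ} (ht : t ∈ Ioo (-1 : ℝ) 1) :
    HasDerivAt z.ext (CircleC.field b (z.ext t) m) t := by
  have h1 := hasDerivAt_ext_prim (field b z (cst m)) ht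
  rw [← h.2] at h1
  have h2 : (field b z (cst m)).ext t = CircleC.field b (z.ext t) m := field_apply h.1 b (cst m) _
  rwa [h2] at h1

end IsSol

end PathC

/-- The time at which the geodesics are evaluated. -/
def PathC.endTime : Icc (-1 : ℝ) 1 := ⟨1, by norm_num, le_rfl⟩

/-- `q - qₓₓ` for `q = (1 + ∂ₓ)⁻¹ z`, at the time `1`. -/
def endMomentum (b : ℝ) (z : PathC) (m : CircleC) : CircleC :=
  PathC.ev PathC.endTime
    (PathC.resP z - PathC.stretch z * PathC.logStretch b z (PathC.cst m))

namespace PathC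

section Good

variable {X : Type} [AddCommGroup X] [Module ℝ X] [TopologicalSpace X] {U : Set X} {b : ℝ}
  {zf : X → PathC} {mf : X → CircleC}

/-- The five quantities form a closed system: their derivatives in `x` are built from the same
quantities and `m` by algebra and time integrals, without derivatives of `m`. So `n` derivatives of
everything yield `n + 1` derivatives of the five, and the induction starts from analyticity of the
formulas on `dom`. -/
theorem goodN_flow (hz : BSmoothOn zf U) (hs : ∀ x ∈ U, IsSol b (zf x) (mf x)) {n : ℕ}
    (hm : GoodN CircleC.IsD n mf U) :
    GoodN IsD (n + 1) (fun x => resP (zf x)) U ∧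
    GoodN IsD (n + 1) (fun x => stretch (zf x)) U ∧
    GoodN IsD (n + 1) (fun x => powr (-b) (stretch (zf x))) U ∧
    GoodN IsD (n + 1) (fun x => velA b (zf x) (cst (mf x))) U ∧
    GoodN IsD (n + 1) (fun x => velB b (zf x) (cst (mf x))) U := by
  have hD := derivRel
  have step : ∀ n, GoodN CircleC.IsD n mf U → (GoodN IsD n (fun x => resP (zf x)) U ∧
    GoodN IsD n (fun x => stretch (zf x)) U ∧
    GoodN IsD n (fun x => powr (-b) (stretch (zf x))) U ∧
    GoodN IsD n (fun x => velA b (zf x) (cst (mf x))) U ∧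
    GoodN IsD n (fun x => velB b (zf x) (cst (mf x))) U) →
    GoodN IsD (n + 1) (fun x => resP (zf x)) U ∧
    GoodN IsD (n + 1) (fun x => stretch (zf x)) U ∧
    GoodN IsD (n + 1) (fun x => powr (-b) (stretch (zf x))) U ∧
    GoodN IsD (n + 1) (fun x => velA b (zf x) (cst (mf x))) U ∧
    GoodN IsD (n + 1) (fun x => velB b (zf x) (cst (mf x))) U := by
    rintro n hm ⟨h1, h2, h3, h4, h5⟩
    have hm' : GoodN IsD n (fun x => cst (mf x)) U := hm.map cst fun _ _ h => isD_cst h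
    have hv : GoodN IsD n (fun x => vel b (zf x) (cst (mf x))) U := (GoodN.add hD h4 h5).smul hD _
    have hk := GoodN.mul hD h3 hm'
    have hl : GoodN IsD n (fun x => logStretch b (zf x) (cst (mf x))) U :=
      (GoodN.mul hD h2 (GoodN.sub hD hv hk)).map prim fun _ _ h => h.prim
    exact ⟨⟨h1.bsmoothOn, _, GoodN.sub hD h2 (GoodN.one hD), fun x _ => isD_resP_stretch (zf x)⟩,
      ⟨h2.bsmoothOn, _, GoodN.mul hD h2 hl, fun x hx => (hs x hx).isD_stretch⟩,
      ⟨h3.bsmoothOn, _, GoodN.mul hD h3 (GoodN.smul hD (-b) hl), fun x hx => (hs x hx).isD_powr (-b)⟩,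
      ⟨h4.bsmoothOn, _, GoodN.mul hD h2 (GoodN.sub hD hk h4), fun x hx => isD_velA (hs x hx).1 _⟩,
      ⟨h5.bsmoothOn, _, GoodN.mul hD h2 (GoodN.sub hD h5 hk), fun x hx => isD_velB (hs x hx).1 _⟩⟩
  have hd : ∀ x ∈ U, zf x ∈ dom := fun x hx => (hs x hx).1
  have hω : (∞ : WithTop ℕ∞) ≤ ω := by simp
  have base (hm : BSmoothOn mf U) : GoodN IsD 0 (fun x => resP (zf x)) U ∧
    GoodN IsD 0 (fun x => stretch (zf x)) U ∧
    GoodN IsD 0 (fun x => powr (-b) (stretch (zf x))) U ∧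
    GoodN IsD 0 (fun x => velA b (zf x) (cst (mf x))) U ∧
    GoodN IsD 0 (fun x => velB b (zf x) (cst (mf x))) U := by
    have hzm := hz.prodMk (hm.comp_contDiff cst.contDiff)
    refine ⟨hz.comp_contDiff resP.contDiff, hz.comp_contDiff (contDiff_stretch.of_le hω),
      hz.comp isOpen_dom ((contDiffOn_powr_stretch (-b)).of_le hω) hd,
      hzm.comp (isOpen_dom.prod isOpen_univ) ((contDiffOn_velA b).of_le hω)
        fun x hx => ⟨hd x hx, mem_univ _⟩,
      hzm.comp (isOpen_dom.prod isOpen_univ) ((contDiffOn_velB b).of_le hω)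
        fun x hx => ⟨hd x hx, mem_univ _⟩⟩
  induction n with
  | zero => exact step 0 hm (base hm.bsmoothOn)
  | succ n ih => exact step (n + 1) hm (ih hm.pred)

end Good

end PathC

/-! ### The map from the initial momentum to the momentum of the displacement -/

theorem exists_localInverse {E : Type*} [NormedAddCommGroup E] [NormedSpace ℝ E] [CompleteSpace E]
    {f : E → E} (hf : ContDiffAt ℝ ω f 0) (hf0 : f 0 = 0)
    (hd : HasFDerivAt f (ContinuousLinearMap.id ℝ E) 0) {O : Set E} (hO : IsOpen O) (h0 : (0 : E) ∈ O) :
    ∃ e : OpenPartialHomeomorph E E, (0 : E) ∈ e.source ∧ e.source ⊆ O ∧ (∀ x, e x = f x) ∧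
      ContDiffOn ℝ ω e.symm e.target := by
  have hd' : HasFDerivAt f (ContinuousLinearEquiv.refl ℝ E : E →L[ℝ] E) 0 := hd
  let e := hf.toOpenPartialHomeomorph f hd' (by simp)
  have he0 : (0 : E) ∈ e.source := hf.mem_toOpenPartialHomeomorph_source hd' (by simp)
  have hef : ∀ x, e x = f x := fun x => rfl
  have hs : ContDiffAt ℝ ω e.symm 0 := by
    have := hf.to_localInverse hd' (by simp)
    rw [hf0] at this
    exact this
  obtain ⟨V, hV, hVo, hV0⟩ := mem_nhds_iff.1 (hs.eventually (by simp))
  -- The source is cut down by the preimage of `V`, so that the inverse is analytic on the whole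
  -- target and not only at `0`.
  have hWo : IsOpen (O ∩ (e.source ∩ e ⁻¹' V)) := hO.inter (e.isOpen_inter_preimage hVo)
  refine ⟨e.restrOpen _ hWo, ⟨he0, h0, he0, ?_⟩, fun x hx => hx.2.1, hef, ?_⟩
  · change f 0 ∈ V
    rwa [hf0]
  · intro y hy
    have h1 := (e.restrOpen _ hWo).map_target hy
    rw [OpenPartialHomeomorph.restrOpen_source] at h1
    have hy' : y ∈ e.target := hy.1
    have h2 : e (e.symm y) ∈ V := h1.2.2.2
    rw [e.right_inv hy'] at h2
    have h3 : ContDiffAt ℝ ω e.symm y := hV h2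
    exact h3.contDiffWithinAt

theorem contDiffOn_comp_pair {E F G' : Type} [NormedAddCommGroup E] [NormedSpace ℝ E]
    [NormedAddCommGroup F] [NormedSpace ℝ F] [NormedAddCommGroup G'] [NormedSpace ℝ G'] {G : F × F → G'}
    {Z : E → F} {O : Set F} {U : Set E} (hG : ContDiffOn ℝ ω G (O ×ˢ univ)) (c : E →L[ℝ] F)
    (hZ : ContDiffOn ℝ ω Z U) (hd : ∀ m ∈ U, Z m ∈ O) : ContDiffOn ℝ ω (fun m => G (Z m, c m)) U :=
  hG.comp (hZ.prodMk c.contDiff.contDiffOn) fun m hm => ⟨hd m hm, mem_univ _⟩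

theorem contDiffOn_sub_mul {E A : Type} [NormedAddCommGroup E] [NormedSpace ℝ E] [NormedCommRing A]
    [NormedAlgebra ℝ A] {f g h : E → A} {U : Set E} (hf : ContDiffOn ℝ ω f U) (hg : ContDiffOn ℝ ω g U)
    (hh : ContDiffOn ℝ ω h U) : ContDiffOn ℝ ω (fun x => f x - g x * h x) U :=
  hf.sub (hg.mul hh)

namespace CircleC

/-- Partial fractions for `(1 - ∂ₓ²)⁻¹`. -/
theorem resP_resM (y : CircleC) : resP (resM y) = (1 / 2 : ℝ) • (resP + resM) y := by
  have h := resP_of_isD (((isD_resP y).add (isD_resM y)).smul (1 / 2))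
  have e : (1 / 2 : ℝ) • (resP y + resM y) + (1 / 2 : ℝ) • (y - resP y + (resM y - y)) = resM y := by
    module
  rw [e] at h
  exact h

end CircleC

theorem contDiffOn_mul_sub_mul {E A : Type} [NormedAddCommGroup E] [NormedSpace ℝ E] [NormedCommRing A]
    [NormedAlgebra ℝ A] {e f g h : E → A} {U : Set E} (he : ContDiffOn ℝ ω e U) (hf : ContDiffOn ℝ ω f U)
    (hg : ContDiffOn ℝ ω g U) (hh : ContDiffOn ℝ ω h U) :
    ContDiffOn ℝ ω (fun x => e x * (f x - g x * h x)) U :=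
  he.mul (hf.sub (hg.mul hh))

namespace PathC

open NormedSpace

theorem resP_resM (y : PathC) : resP (resM y) = (1 / 2 : ℝ) • (resP + resM) y :=
  ext' fun t => CircleC.resP_resM (y t)

theorem prim_cst_endTime (m : CircleC) : prim (cst m) endTime = m := by
  rw [prim_apply]
  have h : ∀ s, (cst m).ext s = m := fun s => rfl
  simp only [h, intervalIntegral.integral_const, endTime]
  simp

theorem stretch_zero : stretch 0 = 1 := LagrangeField.stretch_zero (A := PathC) resP

theorem powr_one (s : ℝ) : powr s 1 = 1 := LagrangeField.powr_one (A := PathC) exp_injective s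

theorem logStretch_zero_right (b : ℝ) (z : PathC) : logStretch b z 0 = 0 := by
  simp [logStretch, vel_zero_right]

theorem logStretch_zero (b : ℝ) (m : PathC) : logStretch b 0 m = prim (resP (resM m)) - prim m := by
  rw [logStretch, stretch_zero, powr_one, one_mul, one_mul, vel_zero, map_sub, resP_resM]

theorem contDiffOn_logStretch (b : ℝ) :
    ContDiffOn ℝ ω (fun w : PathC × PathC => logStretch b w.1 w.2) (dom ×ˢ univ) := by
  have h1 := contDiffOn_mul_sub_mul (A := PathC) (contDiff_stretch.comp contDiff_fst).contDiffOn
    (contDiffOn_vel b) (ContDiffOn.comp (g := fun z => powr (-b) (stretch z)) (contDiffOn_powr_stretch (-b)) contDiffOn_fst fun _ h => h.1)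
    contDiffOn_snd
  exact prim.contDiff.comp_contDiffOn h1

end PathC

theorem endMomentum_zero (b : ℝ) : endMomentum b 0 0 = 0 := by
  have : PathC.logStretch b 0 (PathC.cst 0) = 0 := by rw [map_zero, PathC.logStretch_zero_right]
  rw [endMomentum, this, mul_zero, map_zero, sub_zero, map_zero]

theorem contDiffOn_endMomentum {b : ℝ} {Z : CircleC → PathC} {U : Set CircleC} (hZ : ContDiffOn ℝ ω Z U)
    (hd : ∀ m ∈ U, Z m ∈ PathC.dom) : ContDiffOn ℝ ω (fun m => endMomentum b (Z m) m) U := by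
  have h1 : ContDiffOn ℝ ω (fun m => PathC.resP (Z m)) U := PathC.resP.contDiff.comp_contDiffOn hZ
  have h2 : ContDiffOn ℝ ω (fun m => PathC.stretch (Z m)) U := PathC.contDiff_stretch.comp_contDiffOn hZ
  have h4 : ContDiffOn ℝ ω (fun m => PathC.logStretch b (Z m) (PathC.cst m)) U :=
    contDiffOn_comp_pair (F := PathC) (G := fun w => PathC.logStretch b w.1 w.2)
      (PathC.contDiffOn_logStretch b) PathC.cst hZ hd
  exact (PathC.ev PathC.endTime).contDiff.comp_contDiffOn (contDiffOn_sub_mul (A := PathC) h1 h2 h4)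

/-- To first order the geodesic is `q(t) = t A⁻¹ m`, so `A q(1) = m`. In the computation the two
terms containing `A⁻¹ m` cancel and the time integral of the constant path `m` over `[0, 1]`
remains. -/
theorem hasFDerivAt_endMomentum {b : ℝ} {Z : CircleC → PathC} (hZ0 : Z 0 = 0)
    (hZ : HasFDerivAt Z (PathC.prim ∘L PathC.resM ∘L PathC.cst) 0) :
    HasFDerivAt (fun m => endMomentum b (Z m) m) (ContinuousLinearMap.id ℝ CircleC) 0 := by
  let N : PathC →L[ℝ] PathC := PathC.prim ∘L PathC.resP ∘L PathC.resM - PathC.prim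
  let H : PathC × PathC → PathC := fun w => PathC.stretch w.1 * PathC.logStretch b w.1 w.2
  have hH : DifferentiableAt ℝ H 0 := by
    have h1 : ContDiffOn ℝ ω H (PathC.dom ×ˢ univ) :=
      (PathC.contDiff_stretch.comp contDiff_fst).contDiffOn.mul (PathC.contDiffOn_logStretch b)
    exact (h1.contDiffAt ((PathC.isOpen_dom.prod isOpen_univ).mem_nhds
      ⟨PathC.zero_mem_dom, mem_univ _⟩)).differentiableAt (by simp)
  have h1 : HasFDerivAt H (N.comp (ContinuousLinearMap.snd ℝ PathC PathC)) 0 := by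
    refine hasFDerivAt_of_partial hH (fun z => ?_) fun y => ?_
    · simp only [H, PathC.logStretch_zero_right, mul_zero]
    · simp only [H, PathC.stretch_zero, one_mul, PathC.logStretch_zero]
      rfl
  have h2 : HasFDerivAt (fun m => (Z m, PathC.cst m))
      ((PathC.prim ∘L PathC.resM ∘L PathC.cst).prod PathC.cst) 0 := hZ.prodMk PathC.cst.hasFDerivAt
  have h3 : HasFDerivAt (fun m => H (Z m, PathC.cst m)) _ 0 :=
    HasFDerivAt.comp (g := H) (0 : CircleC) (by rw [hZ0, map_zero]; exact h1) h2
  have h4 := (PathC.ev PathC.endTime).hasFDerivAt.comp (0 : CircleC)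
    ((PathC.resP.hasFDerivAt.comp (0 : CircleC) hZ).sub h3)
  convert! h4 using 1
  ext1 m
  have e : PathC.resP (PathC.prim (PathC.resM (PathC.cst m))) =
      PathC.prim (PathC.resP (PathC.resM (PathC.cst m))) := PathC.res_prim 1 _
  change m = PathC.ev PathC.endTime (PathC.resP (PathC.prim (PathC.resM (PathC.cst m))) -
    (PathC.prim (PathC.resP (PathC.resM (PathC.cst m))) - PathC.prim (PathC.cst m)))
  rw [e, sub_sub_cancel, PathC.ev_apply, PathC.prim_cst_endTime]

/-! ### Rescaling of time, and the displacement recovered from its momentum. -/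

namespace PathC

/-- The path with the time multiplied by `t`. -/
def rescale (t : ℝ) (z : PathC) : PathC :=
  ofMap ⟨fun τ => z.ext (t * τ), z.continuous_ext.comp (continuous_const.mul continuous_subtype_val)⟩

theorem rescale_apply (t : ℝ) (z : PathC) (τ : Icc (-1 : ℝ) 1) : rescale t z τ = z.ext (t * τ) := rfl

theorem rescale_mem_dom (t : ℝ) {z : PathC} (h : z ∈ dom) : rescale t z ∈ dom := by
  obtain ⟨w, hw⟩ := h
  refine ⟨rescale t w, ext' fun τ => ?_⟩
  have h1 : CircleC.stretch (z.ext (t * τ)) = NormedSpace.exp (w.ext (t * τ)) := by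
    have h2 := congrArg (fun f : PathC => f.ext (t * τ)) hw
    exact (h2.symm.trans (exp_apply w _))
  rw [exp_apply]
  exact h1.symm

theorem norm_rescale_le (t : ℝ) (z : PathC) : ‖rescale t z‖ ≤ ‖z‖ :=
  norm_le (norm_nonneg _) fun _ => norm_apply_le z _

theorem IsSol.rescale {b : ℝ} {z : PathC} {m : CircleC} (h : IsSol b z m) {t : ℝ}
    (ht : t ∈ Icc (-1 : ℝ) 1) : IsSol b (rescale t z) (t • m) := by
  have hd := rescale_mem_dom t h.1
  refine ⟨hd, ext' fun τ => ?_⟩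
  have hmem : ∀ s ∈ Icc (-1 : ℝ) 1, t * s ∈ Icc (-1 : ℝ) 1 := fun s hs => by
    have h1 := abs_le.2 hs
    have h2 := abs_le.2 ht
    refine abs_le.1 ?_
    rw [abs_mul]
    exact mul_le_one₀ h2 (abs_nonneg _) h1
  have h1 : z.ext (t * τ) = ∫ s in (0 : ℝ)..(t * τ), (field b z (cst m)).ext s := by
    conv_lhs => rw [h.2]
    rw [ext_of_mem _ (hmem _ τ.2), prim_apply]
  have h2 := intervalIntegral.smul_integral_comp_mul_left (a := 0) (b := τ) (field b z (cst m)).ext t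
  rw [mul_zero] at h2
  rw [prim_apply, rescale_apply, h1, ← h2, ← intervalIntegral.integral_smul]
  refine intervalIntegral.integral_congr fun s hs => ?_
  have hs' : s ∈ Icc (-1 : ℝ) 1 := by
    refine (uIcc_subset_Icc ?_ τ.2) hs
    constructor <;> norm_num
  rw [ext_of_mem _ hs', ext_of_mem _ (hmem s hs'), field_apply h.1, field_apply hd, rescale_apply,
    ext_of_mem _ (hmem s hs'), cst_apply, cst_apply, CircleC.field_smul]

theorem IsSol.isD_apply {b : ℝ} {z : PathC} {m : CircleC} (h : IsSol b z m) (t : Icc (-1 : ℝ) 1) :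
    CircleC.IsD (stretch z t) (stretch z t * logStretch b z (cst m) t) := h.isD_stretch t

/-- Here `m` is merely continuous: `q(1)` is twice differentiable by `isD_stretch`, and the two
resolvents invert `A` at this regularity. -/
theorem IsSol.resP_resM_endMomentum {b : ℝ} {z : PathC} {m : CircleC} (h : IsSol b z m) :
    CircleC.resP (CircleC.resM (endMomentum b z m)) = resP z endTime := by
  have h1 : CircleC.IsD (resP z endTime) (stretch z endTime - 1) := isD_resP_stretch z endTime
  have h2 := (h.isD_apply endTime).sub CircleC.isD_one
  have h3 := CircleC.resM_of_isD (h1.add h2)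
  have e : resP z endTime + (stretch z endTime - 1) - (stretch z endTime - 1 +
      (stretch z endTime * logStretch b z (cst m) endTime - 0)) = endMomentum b z m := by
    change _ = resP z endTime - stretch z endTime * logStretch b z (cst m) endTime
    ring
  rw [e] at h3
  rw [h3, CircleC.resP_of_isD h1]

theorem IsSol.toC_opA {b : ℝ} {z : PathC} {m : CircleC} (h : IsSol b z m) {ψ : CircleFun}
    (hψ : CircleFun.toC ψ = resP z endTime) : CircleFun.toC (CircleFun.opA ψ) = endMomentum b z m := by
  have h1 : CircleC.IsD (resP z endTime) (stretch z endTime - 1) := isD_resP_stretch z endTime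
  have h2 := (h.isD_apply endTime).sub CircleC.isD_one
  rw [← hψ] at h1
  have e1 := (CircleFun.isD_toC ψ).unique h1
  rw [← e1] at h2
  have e2 := (CircleFun.isD_toC _).unique h2
  change CircleFun.toC (ψ - CircleFun.dx (CircleFun.dx ψ)) = resP z endTime - stretch z endTime *
    logStretch b z (cst m) endTime
  rw [map_sub, e2, hψ, sub_zero]

end PathC

theorem CircleFun.resP_resM_toC_opA (ψ : CircleFun) :
    CircleC.resP (CircleC.resM (toC (opA ψ))) = toC ψ := by
  have h1 := isD_toC ψ
  have h2 := isD_toC (dx ψ)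
  have h3 := CircleC.resM_of_isD (h1.add h2)
  have e : toC ψ + toC (dx ψ) - (toC (dx ψ) + toC (dx (dx ψ))) = toC (opA ψ) := by
    change _ = toC (ψ - dx (dx ψ))
    rw [map_sub]
    ring
  rw [e] at h3
  rw [h3, CircleC.resP_of_isD h1]

/-! ### Solution maps and displacements -/

/-- `Z` sends small momenta `m` to the solutions of the geodesic equation on `[-1, 1]`. -/
structure IsSolutionMap (b ρ ε : ℝ) (Z : CircleC → PathC) : Prop where
  pos : 0 < ρ
  contDiffOn : ContDiffOn ℝ ω Z (Metric.ball 0 ρ)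
  hasFDerivAt : HasFDerivAt Z (PathC.prim ∘L PathC.resM ∘L PathC.cst) 0
  zero : Z 0 = 0
  isSol : ∀ m ∈ Metric.ball 0 ρ, PathC.IsSol b (Z m) m
  norm_resP_lt : ∀ m ∈ Metric.ball 0 ρ, ‖PathC.resP (Z m)‖ < 1 / 2
  norm_lt : ∀ m ∈ Metric.ball 0 ρ, ‖Z m‖ < ε
  unique : ∀ m ∈ Metric.ball 0 ρ, ∀ z, ‖z‖ < ε → PathC.IsSol b z m → z = Z m

theorem exists_isSolutionMap (b : ℝ) : ∃ ρ ε Z, IsSolutionMap b ρ ε Z := by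
  obtain ⟨ρ, ε, Z, h1, -, h2, h3, h4, h5, h6⟩ := PathC.exists_solution b
  exact ⟨ρ, ε, Z, h1, h2, h3, h4, fun m hm => ⟨(h5 m hm).1.1, (h5 m hm).2.2⟩, fun m hm => (h5 m hm).1.2,
    fun m hm => (h5 m hm).2.1, fun m hm z hz h => h6 m hm z hz h.2⟩

theorem smul_mem_ball {E : Type*} [NormedAddCommGroup E] [NormedSpace ℝ E] {ρ t : ℝ} {m : E}
    (hm : m ∈ Metric.ball (0 : E) ρ) (ht : t ∈ Icc (-1 : ℝ) 1) : t • m ∈ Metric.ball (0 : E) ρ := by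
  rw [mem_ball_zero_iff] at hm ⊢
  rw [norm_smul]
  exact (mul_le_of_le_one_left (norm_nonneg _) (abs_le.2 ht)).trans_lt hm

namespace IsSolutionMap

variable {b ρ ε : ℝ} {Z : CircleC → PathC} (hZ : IsSolutionMap b ρ ε Z)
include hZ

theorem rescale_eq {m : CircleC} (hm : m ∈ Metric.ball 0 ρ) {t : ℝ} (ht : t ∈ Icc (-1 : ℝ) 1) :
    PathC.rescale t (Z m) = Z (t • m) :=
  hZ.unique _ (smul_mem_ball hm ht) _ ((PathC.norm_rescale_le t _).trans_lt (hZ.norm_lt m hm))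
    ((hZ.isSol m hm).rescale ht)

/-- The rescaled solution is small and solves the equation with momentum `t m`, so it is `Z (t • m)`
by uniqueness. The whole trajectory is thus read off from the values at time `1`. -/
theorem ext_eq {m : CircleC} (hm : m ∈ Metric.ball 0 ρ) {t : ℝ} (ht : t ∈ Icc (-1 : ℝ) 1) :
    (Z m).ext t = Z (t • m) PathC.endTime := by
  rw [← hZ.rescale_eq hm ht, PathC.rescale_apply]
  simp [PathC.endTime]

/-- The radius `ρ / 2` leaves room for doubling the momentum: geodesics then exist for times in
`(-2, 2)`, an open interval containing `[0, 1]`. -/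
theorem exists_localInverse : ∃ e : OpenPartialHomeomorph CircleC CircleC, (0 : CircleC) ∈ e.source ∧
    e.source ⊆ Metric.ball 0 (ρ / 2) ∧ (∀ m, e m = endMomentum b (Z m) m) ∧
    ContDiffOn ℝ ω e.symm e.target := by
  have h1 : ContDiffOn ℝ ω (fun m => endMomentum b (Z m) m) (Metric.ball 0 ρ) :=
    contDiffOn_endMomentum hZ.contDiffOn fun m hm => (hZ.isSol m hm).1
  have h2 : endMomentum b (Z 0) 0 = 0 := by rw [hZ.zero, endMomentum_zero]
  exact _root_.exists_localInverse (h1.contDiffAt (Metric.ball_mem_nhds _ hZ.pos)) h2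
    (hasFDerivAt_endMomentum hZ.zero hZ.hasFDerivAt) Metric.isOpen_ball
    (Metric.mem_ball_self (half_pos hZ.pos))

end IsSolutionMap

namespace CircleFun

/-- The element of `CircleFun` with the given underlying continuous function, if there is one. -/
def ofC : CircleC → CircleFun := Function.invFun toC

theorem toC_ofC {f : CircleC} (h : ∀ n, HasD n f) : toC (ofC f) = f :=
  Function.invFun_eq (exists_toC_eq h)

theorem ofC_toC (u : CircleFun) : ofC (toC u) = u := Function.leftInverse_invFun toC_injective u

/-- The continuous function underlying the momentum `A u`. -/
def momentum : CircleFun →L[ℝ] CircleC :=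
  ⟨toC.toLinearMap ∘ₗ opA, continuous_toC.comp continuous_opA⟩

theorem momentum_apply (u : CircleFun) : momentum u = toC (opA u) := rfl

theorem opAInv_opA (u : CircleFun) : opAInv (opA u) = u :=
  (LinearEquiv.ofBijective opA opA_bijective).symm_apply_apply u

theorem opA_opAInv (u : CircleFun) : opA (opAInv u) = u :=
  (LinearEquiv.ofBijective opA opA_bijective).apply_symm_apply u

theorem goodN_momentum (n : ℕ) (U : Set CircleFun) : GoodN CircleC.IsD n momentum U :=
  goodN_jet opA (fun k => ⟨⟨jet k ∘ₗ opA, (continuous_jet k).comp continuous_opA⟩, fun _ _ => rfl⟩) n 0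

end CircleFun

theorem CircleC.IsD.resP {f g : CircleC} (h : IsD f g) : IsD (resP f) (CircleC.resP g) := by
  have h1 := isD_resP f
  have h2 := resP_of_isD h
  rw [map_add] at h2
  rwa [show f - CircleC.resP f = CircleC.resP g by linear_combination -h2] at h1

theorem CircleC.IsD.resM {f g : CircleC} (h : IsD f g) : IsD (resM f) (CircleC.resM g) := by
  have h1 := isD_resM f
  have h2 := resM_of_isD h
  rw [map_sub] at h2
  rwa [show CircleC.resM f - f = CircleC.resM g by linear_combination h2] at h1

/-- The displacement at the time `1` of the geodesic with initial velocity `u`. -/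
def displacement (Z : CircleC → PathC) (u : CircleFun) : CircleFun :=
  CircleFun.ofC (PathC.resP (Z (CircleFun.momentum u)) PathC.endTime)

namespace IsSolutionMap

variable {b ρ ε : ℝ} {Z : CircleC → PathC} (hZ : IsSolutionMap b ρ ε Z)
include hZ

open CircleFun

theorem goodN_resP {X : Type} [AddCommGroup X] [Module ℝ X] [TopologicalSpace X] {U : Set X}
    {mf : X → CircleC} (hU : ∀ x ∈ U, mf x ∈ Metric.ball 0 ρ) {n : ℕ} (hm : GoodN CircleC.IsD n mf U) :
    GoodN PathC.IsD (n + 1) (fun x => PathC.resP (Z (mf x))) U :=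
  (PathC.goodN_flow (hm.bsmoothOn.comp Metric.isOpen_ball (hZ.contDiffOn.of_le (by simp)) hU)
    (fun x hx => hZ.isSol _ (hU x hx)) hm).1

theorem goodN_endTime (n : ℕ) : GoodN CircleC.IsD n
    (fun u => PathC.resP (Z (momentum u)) PathC.endTime) (momentum ⁻¹' Metric.ball 0 ρ) :=
  ((hZ.goodN_resP (mf := momentum) (fun _ h => h) (goodN_momentum n _)).map (PathC.ev PathC.endTime)
    fun _ _ h => h _).pred

/-- For smooth `u` the function `q(1)` has derivatives of all orders by `goodN_flow`, so `ofC`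
returns it and not a default value. -/
theorem toC_displacement {u : CircleFun} (hu : momentum u ∈ Metric.ball 0 ρ) :
    toC (displacement Z u) = PathC.resP (Z (momentum u)) PathC.endTime :=
  toC_ofC fun n => (hZ.goodN_endTime n).hasD hu

theorem goodN_displacement (n : ℕ) :
    GoodN CircleC.IsD n (fun u => toC (displacement Z u)) (momentum ⁻¹' Metric.ball 0 ρ) :=
  (hZ.goodN_endTime n).congr fun _ hu => hZ.toC_displacement hu

theorem momentum_displacement {u : CircleFun} (hu : momentum u ∈ Metric.ball 0 ρ) :
    momentum (displacement Z u) = endMomentum b (Z (momentum u)) (momentum u) :=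
  (hZ.isSol _ hu).toC_opA (hZ.toC_displacement hu)

theorem displacement_mem_chartDomain {u : CircleFun} (hu : momentum u ∈ Metric.ball 0 ρ) :
    displacement Z u ∈ CircleDiff.chartDomain 0 := by
  have h1 := hZ.toC_displacement hu
  have h2 : |displacement Z u 0| < 1 / 2 := by
    have h3 : toC (displacement Z u) ((0 : ℝ) : UnitAddCircle) = displacement Z u 0 := toC_coe _ _
    rw [← h3, h1]
    exact ((CircleC.norm_apply_le _ _).trans (PathC.norm_apply_le _ _)).trans_lt (hZ.norm_resP_lt _ hu)
  rw [abs_lt] at h2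
  refine ⟨by simp; linarith, by simpa using h2.2, fun x => ?_⟩
  have h4 := PathC.isD_resP_stretch (Z (momentum u)) PathC.endTime
  rw [← h1] at h4
  have h5 := CircleC.mem_dom.1 (PathC.apply_mem_dom (hZ.isSol _ hu).1 PathC.endTime) (x : UnitAddCircle)
  have h6 : toC (dx (displacement Z u)) (x : UnitAddCircle) = dx (displacement Z u) x := toC_coe _ _
  change -1 < dx (displacement Z u) x
  rw [← h6, (isD_toC _).unique h4]
  change -1 < CircleC.stretch (Z (momentum u) PathC.endTime) (x : UnitAddCircle) - 1
  linarith

end IsSolutionMap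

/-! ### The inverse of the displacement map -/

theorem GoodN.inv {X : Type} [AddCommGroup X] [Module ℝ X] [TopologicalSpace X] {U : Set X}
    {K : X → CircleC} {n : ℕ} (hK : GoodN CircleC.IsD n K U) (hpos : ∀ x ∈ U, ∀ θ, 0 < K x θ) :
    GoodN CircleC.IsD n (fun x => CircleC.powr (-1) (K x)) U := by
  have hb : BSmoothOn (fun x => CircleC.powr (-1) (K x)) U := by
    have h1 : ContDiffOn ℝ ω (CircleC.powr (-1)) (range NormedSpace.exp) := by
      have := LagrangeField.contDiffOn_powr (A := CircleC) CircleC.exp_injective (-1)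
      exact this
    have h2 : IsOpen (range (NormedSpace.exp : CircleC → CircleC)) := isOpen_range_exp
    exact hK.bsmoothOn.comp h2 (h1.of_le (by simp)) fun x hx => CircleC.mem_range_exp.2 (hpos x hx)
  induction n with
  | zero => exact hb
  | succ n ih =>
    obtain ⟨-, K', h2, h3⟩ := id hK
    have hi := ih hK.pred
    refine ⟨hb, _, GoodN.mul CircleC.derivRel (GoodN.mul CircleC.derivRel hi hi)
      (GoodN.smul CircleC.derivRel (-1) h2), fun x hx θ => ?_⟩
    have h4 := (h3 x hx θ).inv (hpos x hx _).ne'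
    have h5 : ∀ θ, CircleC.powr (-1) (K x) θ = (K x θ)⁻¹ := fun θ => by
      rw [CircleC.powr_apply (hpos x hx), Real.rpow_neg_one]
    simp only [h5, CircleC.mul_apply, CircleC.smul_apply]
    convert! h4 using 1
    field_simp

/-! ### Solving for the initial momentum in terms of the final one. -/

namespace PathC

theorem prim_endTime_pos {f : PathC} (hf : ∀ t θ, 0 < f t θ) (θ : UnitAddCircle) :
    0 < prim f endTime θ := by
  have h := (CircleC.ev θ).intervalIntegral_comp_comm
    (f.continuous_ext.intervalIntegrable (μ := MeasureTheory.volume) 0 1)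
  change 0 < CircleC.ev θ (∫ s in (0 : ℝ)..1, f.ext s)
  rw [← h]
  refine intervalIntegral.intervalIntegral_pos_of_pos
    (((CircleC.ev θ).continuous.comp f.continuous_ext).intervalIntegrable _ _) (fun s => hf _ _) zero_lt_one

/-- The factor of the initial momentum in the momentum at the time `1`. -/
def endFactor (b : ℝ) (z : PathC) : CircleC :=
  ev endTime (stretch z * prim (stretch z * powr (-b) (stretch z)))

theorem endFactor_pos (b : ℝ) {z : PathC} (hz : z ∈ dom) (θ : UnitAddCircle) : 0 < endFactor b z θ := by
  have h1 : ∀ t θ, 0 < stretch z t θ := fun t => CircleC.mem_dom.1 (apply_mem_dom hz t)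
  refine mul_pos (h1 _ _) (prim_endTime_pos (fun t θ => mul_pos (h1 t θ) ?_) θ)
  have h2 := powr_apply hz t (-b)
  have h3 : powr (-b) (stretch z) t θ = (stretch z t θ) ^ (-b) := by
    rw [h2]
    exact CircleC.powr_apply (h1 t) _ _
  refine lt_of_lt_of_eq ?_ h3.symm
  exact Real.rpow_pos_of_pos (h1 t θ) _

theorem IsSol.endMomentum_eq {b : ℝ} {z : PathC} {m : CircleC} (h : IsSol b z m) :
    endMomentum b z m = ev endTime (resP z) - ev endTime (stretch z * prim (stretch z * vel b z (cst m))) +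
      endFactor b z * m := by
  rw [endMomentum, h.logStretch_eq, endFactor]
  simp only [ev_apply, mul_apply, sub_apply, cst_apply]
  ring

/-- The positive factor of `m` in `endMomentum` is inverted. On the right `m` enters only through
the flow quantities, which are one order smoother than `m`, so the regularity of `endMomentum` can
be transferred to `m`. -/
theorem IsSol.eq_of_endMomentum {b : ℝ} {z : PathC} {m : CircleC} (h : IsSol b z m) :
    m = (endMomentum b z m - ev endTime (resP z) +
      ev endTime (stretch z * prim (stretch z * vel b z (cst m)))) * CircleC.powr (-1) (endFactor b z) := by
  have h1 : endFactor b z * CircleC.powr (-1) (endFactor b z) = 1 := by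
    refine CircleC.ext' fun θ => ?_
    rw [CircleC.mul_apply, CircleC.powr_apply (endFactor_pos b h.1), Real.rpow_neg_one,
      mul_inv_cancel₀ (endFactor_pos b h.1 θ).ne', CircleC.one_apply]
  linear_combination (-m) * h1 - CircleC.powr (-1) (endFactor b z) * h.endMomentum_eq

end PathC

namespace IsSolutionMap

variable {b ρ ε : ℝ} {Z : CircleC → PathC} (hZ : IsSolutionMap b ρ ε Z)
  {X : Type} [AddCommGroup X] [Module ℝ X] [TopologicalSpace X] {U : Set X} {mf : X → CircleC}

open CircleFun

include hZ in
-- Bootstrapping: if `m` has `n` derivatives, the flow quantities have `n + 1`, and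
-- `eq_of_endMomentum` then expresses `m` by functions with `n + 1` derivatives. This replaces an
-- inverse function theorem at each order of differentiability.
theorem goodN_of_endMomentum (hU : ∀ x ∈ U, mf x ∈ Metric.ball 0 ρ) (hm : BSmoothOn mf U)
    (hE : ∀ n, GoodN CircleC.IsD n (fun x => endMomentum b (Z (mf x)) (mf x)) U) (n : ℕ) :
    GoodN CircleC.IsD n mf U := by
  have hD := PathC.derivRel
  have hD' := CircleC.derivRel
  induction n with
  | zero => exact hm
  | succ n ih =>
    obtain ⟨h1, h2, h3, h4, h5⟩ := PathC.goodN_flow (hm.comp Metric.isOpen_ball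
      (hZ.contDiffOn.of_le (by simp)) hU) (fun x hx => hZ.isSol _ (hU x hx)) ih
    have hv : GoodN PathC.IsD (n + 1) (fun x => PathC.vel b (Z (mf x)) (PathC.cst (mf x))) U :=
      (GoodN.add hD h4 h5).smul hD _
    have hev : ∀ {g : X → PathC}, GoodN PathC.IsD (n + 1) g U →
        GoodN CircleC.IsD (n + 1) (fun x => PathC.ev PathC.endTime (g x)) U :=
      fun hg => hg.map (PathC.ev PathC.endTime) fun _ _ h => h _
    have hprim : ∀ {g : X → PathC}, GoodN PathC.IsD (n + 1) g U →
        GoodN PathC.IsD (n + 1) (fun x => PathC.prim (g x)) U :=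
      fun hg => hg.map PathC.prim fun _ _ h => h.prim
    have hK := hev (GoodN.mul hD h2 (hprim (GoodN.mul hD h2 h3)))
    have hJ := hK.inv fun x hx => PathC.endFactor_pos b (hZ.isSol _ (hU x hx)).1
    have hN := GoodN.add hD' (GoodN.sub hD' (hE (n + 1)) (hev h1))
      (hev (GoodN.mul hD h2 (hprim (GoodN.mul hD h2 hv))))
    exact (GoodN.mul hD' hN hJ).congr fun x hx => (hZ.isSol _ (hU x hx)).eq_of_endMomentum

variable {e : OpenPartialHomeomorph CircleC CircleC} (hs : e.source ⊆ Metric.ball 0 (ρ / 2))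
  (he : ∀ m, e m = endMomentum b (Z m) m) (hc : ContDiffOn ℝ ω e.symm e.target)

/-- The inverse of the displacement map. -/
def _root_.invDisplacement (e : OpenPartialHomeomorph CircleC CircleC) (ψ : CircleFun) : CircleFun :=
  opAInv (ofC (e.symm (momentum ψ)))

include hZ in
theorem ball_half_subset : Metric.ball (0 : CircleC) (ρ / 2) ⊆ Metric.ball 0 ρ :=
  Metric.ball_subset_ball (half_le_self hZ.pos.le)

include hZ hs he hc

theorem goodN_symm {Ef : X → CircleC} (hU : ∀ x ∈ U, Ef x ∈ e.target)
    (hE : ∀ n, GoodN CircleC.IsD n Ef U) (n : ℕ) :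
    GoodN CircleC.IsD n (fun x => e.symm (Ef x)) U := by
  refine hZ.goodN_of_endMomentum (mf := fun x => e.symm (Ef x))
    (fun x hx => hZ.ball_half_subset (hs (e.map_target (hU x hx))))
    ((hE 0).bsmoothOn.comp e.open_target (hc.of_le (by simp)) hU) (fun n => ?_) n
  refine (hE n).congr fun x hx => ?_
  rw [← he, e.right_inv (hU x hx)]

theorem momentum_invDisplacement {ψ : CircleFun} (hψ : momentum ψ ∈ e.target) :
    momentum (invDisplacement e ψ) = e.symm (momentum ψ) := by
  rw [momentum_apply, invDisplacement, opA_opAInv]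
  exact toC_ofC fun n => (hZ.goodN_symm hs he hc (U := momentum ⁻¹' e.target) (fun _ h => h)
    (fun n => goodN_momentum n _) n).hasD hψ

theorem goodN_invDisplacement {P : X → CircleFun} (hU : ∀ x ∈ U, momentum (P x) ∈ e.target)
    (hP : ∀ n, GoodN CircleC.IsD n (fun x => momentum (P x)) U) (n : ℕ) :
    GoodN CircleC.IsD n (fun x => toC (invDisplacement e (P x))) U := by
  refine (((hZ.goodN_symm hs he hc hU hP n).map CircleC.resM fun _ _ h => h.resM).map CircleC.resP
    fun _ _ h => h.resP).congr fun x hx => ?_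
  rw [← hZ.momentum_invDisplacement hs he hc (hU x hx), momentum_apply, resP_resM_toC_opA]

theorem displacement_invDisplacement {ψ : CircleFun} (hψ : momentum ψ ∈ e.target) :
    displacement Z (invDisplacement e ψ) = ψ := by
  have h1 := hZ.momentum_invDisplacement hs he hc hψ
  have h2 : momentum (invDisplacement e ψ) ∈ Metric.ball 0 ρ := by
    rw [h1]
    exact hZ.ball_half_subset (hs (e.map_target hψ))
  refine toC_injective ?_
  rw [hZ.toC_displacement h2, ← (hZ.isSol _ h2).resP_resM_endMomentum, ← he, h1, e.right_inv hψ,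
    momentum_apply, resP_resM_toC_opA]

omit hc in
theorem momentum_displacement_eq {u : CircleFun} (hu : momentum u ∈ e.source) :
    momentum (displacement Z u) = e (momentum u) := by
  rw [hZ.momentum_displacement (hZ.ball_half_subset (hs hu)), he]

omit hc in
theorem invDisplacement_displacement {u : CircleFun} (hu : momentum u ∈ e.source) :
    invDisplacement e (displacement Z u) = u := by
  rw [invDisplacement, hZ.momentum_displacement_eq hs he hu, e.left_inv hu, momentum_apply, ofC_toC,
    opAInv_opA]

end IsSolutionMap

/-! ### Curves of functions as functions of two variables -/

theorem hasDirDerivAt_one_iff {Y : Type*} [NormedAddCommGroup Y] [NormedSpace ℝ Y] {f : ℝ → Y} {f' : Y}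
    {t : ℝ} : HasDirDerivAt f f' t 1 ↔ HasDerivAt f f' t := by
  rw [hasDerivAt_iff_tendsto_slope_zero, HasDirDerivAt]
  simp only [smul_eq_mul, mul_one]

namespace CircleC

theorem isD_iff {f g : CircleC} : IsD f g ↔ resP (f + g) = f := by
  refine ⟨resP_of_isD, fun h => ?_⟩
  have h1 := isD_resP (f + g)
  rw [h] at h1
  rwa [add_sub_cancel_left] at h1

/-- Derivatives in `t` and `x` commute because `∂ₓ f = g` is the bounded linear equation `resP (f +
g) = f`, which may be differentiated in `t`. -/
theorem IsD.deriv {f g : ℝ → CircleC} {f' g' : CircleC} {t : ℝ} (hf : HasDerivAt f f' t)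
    (hg : HasDerivAt g g' t) (h : ∀ᶠ s in 𝓝 t, IsD (f s) (g s)) : IsD f' g' := by
  rw [isD_iff]
  have h1 : HasDerivAt (fun s => CircleC.resP (f s + g s)) (CircleC.resP (f' + g')) t :=
    (CircleC.resP.hasFDerivAt (x := f t + g t)).comp_hasDerivAt t (hf.add hg)
  refine (h1.congr_of_eventuallyEq ?_).unique hf
  filter_upwards [h] with s hs
  exact (isD_iff.1 hs).symm

/-- Split `f s y` into `f t y`, which depends on `y` alone, and `(f s - f t) y`. For the latter the
expansion in `s` is uniform in `y`, and continuity of `f'` allows `y` to be replaced by `x`. -/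
theorem hasFDerivAt_uncurry {f : ℝ → CircleC} {f' g : CircleC} {t x : ℝ} (hf : HasDerivAt f f' t)
    (hg : IsD (f t) g) : HasFDerivAt (fun p : ℝ × ℝ => f p.1 (p.2 : UnitAddCircle))
      (f' (x : UnitAddCircle) • ContinuousLinearMap.fst ℝ ℝ ℝ +
        g (x : UnitAddCircle) • ContinuousLinearMap.snd ℝ ℝ ℝ) (t, x) := by
  have h1 : HasFDerivAt (fun p : ℝ × ℝ => f t (p.2 : UnitAddCircle))
      (g (x : UnitAddCircle) • ContinuousLinearMap.snd ℝ ℝ ℝ) (t, x) :=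
    HasDerivAt.comp_hasFDerivAt (h₂ := fun y : ℝ => f t (y : UnitAddCircle)) (t, x) (hg x) hasFDerivAt_snd
  have h2 : HasFDerivAt (fun p : ℝ × ℝ => (f p.1 - f t) (p.2 : UnitAddCircle))
      (f' (x : UnitAddCircle) • ContinuousLinearMap.fst ℝ ℝ ℝ) (t, x) := by
    rw [hasFDerivAt_iff_isLittleO]
    have e1 : (fun p : ℝ × ℝ => (f p.1 - f t - (p.1 - t) • f') (p.2 : UnitAddCircle)) =o[𝓝 (t, x)]
        fun p : ℝ × ℝ => p - (t, x) := by
      have h3 := (hasDerivAt_iff_isLittleO.1 hf).comp_tendsto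
        (continuous_fst.tendsto (X := ℝ × ℝ) (t, x))
      have h4 : (fun p : ℝ × ℝ => (f p.1 - f t - (p.1 - t) • f') (p.2 : UnitAddCircle)) =O[𝓝 (t, x)]
          fun p : ℝ × ℝ => f p.1 - f t - (p.1 - t) • f' :=
        Asymptotics.IsBigO.of_bound 1 (Eventually.of_forall fun p => by
          rw [one_mul]; exact norm_apply_le _ _)
      have h5 : (fun p : ℝ × ℝ => p.1 - t) =O[𝓝 (t, x)] fun p : ℝ × ℝ => p - (t, x) :=
        Asymptotics.IsBigO.of_bound 1 (Eventually.of_forall fun p => by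
          rw [one_mul]; exact norm_fst_le (p - (t, x)))
      exact (h4.trans_isLittleO h3).trans_isBigO h5
    have e2 : (fun p : ℝ × ℝ => (p.1 - t) * (f' (p.2 : UnitAddCircle) - f' (x : UnitAddCircle)))
        =o[𝓝 (t, x)] fun p : ℝ × ℝ => p - (t, x) := by
      have h5 : (fun p : ℝ × ℝ => p.1 - t) =O[𝓝 (t, x)] fun p : ℝ × ℝ => p - (t, x) :=
        Asymptotics.IsBigO.of_bound 1 (Eventually.of_forall fun p => by
          rw [one_mul]; exact norm_fst_le (p - (t, x)))
      have h6 : (fun p : ℝ × ℝ => f' (p.2 : UnitAddCircle) - f' (x : UnitAddCircle)) =o[𝓝 (t, x)]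
          fun _ => (1 : ℝ) := by
        rw [Asymptotics.isLittleO_one_iff]
        have h7 : Continuous fun p : ℝ × ℝ => f' (p.2 : UnitAddCircle) - f' (x : UnitAddCircle) :=
          (f'.continuous_comp_coe.comp continuous_snd).sub continuous_const
        have := h7.tendsto (t, x)
        simpa using this
      simpa using! h5.norm_right.mul_isLittleO h6
    refine (e1.add e2).congr_left fun p => ?_
    simp only [sub_apply, smul_apply, sub_self, zero_apply, _root_.smul_apply,
      ContinuousLinearMap.coe_fst', smul_eq_mul, Prod.fst_sub]
    ring
  have h3 := h2.add h1
  convert! h3 using 1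
  funext p
  simp only [Pi.add_apply, sub_apply]
  ring

/-- The entry `f i k` stands for `∂_t^i ∂ₓ^k` of one function. Both partial derivatives stay within
the family, so one order of differentiability can be gained for all entries at once. -/
theorem contDiffOn_uncurry {f : ℕ → ℕ → ℝ → CircleC} {S : Set ℝ} (hS : IsOpen S)
    (ht : ∀ i k, ∀ t ∈ S, HasDerivAt (f i k) (f (i + 1) k t) t)
    (hx : ∀ i k, ∀ t ∈ S, IsD (f i k t) (f i (k + 1) t)) (n i k : ℕ) :
    ContDiffOn ℝ n (fun p : ℝ × ℝ => f i k p.1 (p.2 : UnitAddCircle)) (S ×ˢ univ) := by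
  have hO : IsOpen (S ×ˢ (univ : Set ℝ)) := hS.prod isOpen_univ
  have hd : ∀ i k, ∀ p ∈ S ×ˢ (univ : Set ℝ), HasFDerivAt (fun p : ℝ × ℝ => f i k p.1 (p.2 : UnitAddCircle))
      (f (i + 1) k p.1 (p.2 : UnitAddCircle) • ContinuousLinearMap.fst ℝ ℝ ℝ +
        f i (k + 1) p.1 (p.2 : UnitAddCircle) • ContinuousLinearMap.snd ℝ ℝ ℝ) p :=
    fun i k p hp => hasFDerivAt_uncurry (ht i k p.1 hp.1) (hx i k p.1 hp.1)
  induction n generalizing i k with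
  | zero => exact contDiffOn_zero.2 fun p hp => (hd i k p hp).continuousAt.continuousWithinAt
  | succ n ih =>
    rw [Nat.cast_succ, contDiffOn_succ_iff_fderiv_of_isOpen hO]
    refine ⟨fun p hp => (hd i k p hp).differentiableAt.differentiableWithinAt, by simp, ?_⟩
    exact (((ih (i + 1) k).smul contDiffOn_const).add ((ih i (k + 1)).smul contDiffOn_const)).congr
      fun p hp => (hd i k p hp).fderiv

end CircleC

namespace CircleFun

/-- A curve is smooth if the curves of all derivatives are smooth for the uniform norm. -/
def SmoothCurveOn (c : ℝ → CircleFun) (S : Set ℝ) : Prop :=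
  ∀ k, ContDiffOn ℝ ∞ (fun t => jet k (c t)) S

theorem hasDirDerivAt_one_iff {c : ℝ → CircleFun} {v : CircleFun} {t : ℝ} :
    HasDirDerivAt c v t 1 ↔ ∀ k, HasDerivAt (fun s => jet k (c s)) (jet k v) t := by
  simp only [hasDirDerivAt_iff, _root_.hasDirDerivAt_one_iff]

theorem smoothCurveOn_of_jets {c : ℝ → CircleFun} {S : Set ℝ}
    (h : ∀ k, BSmoothOn (fun t => jet k (c t)) S) : SmoothCurveOn c S := by
  intro k
  obtain ⟨Z, _, _, L, W, F, hW, hF, H⟩ := h k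
  exact (hF.comp L.contDiff.contDiffOn fun t ht => (H t ht).1).congr fun t ht => (H t ht).2

theorem exists_hasDirDerivAt_of_jets {c : ℝ → CircleFun} {t : ℝ}
    (h : ∀ k, DifferentiableAt ℝ (fun s => jet k (c s)) t) : ∃ v, HasDirDerivAt c v t 1 := by
  choose y hy using fun k => (⟨_, (h k).hasDerivAt⟩ : ∃ y, HasDerivAt (fun s => jet k (c s)) y t)
  have h1 : ∀ k, Tendsto (fun ε : ℝ => jet k (ε⁻¹ • (c (t + ε) - c t))) (𝓝[≠] 0) (𝓝 (y k)) := by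
    intro k
    refine (hasDerivAt_iff_tendsto_slope_zero.1 (hy k)).congr fun ε => ?_
    rw [map_smul, map_sub]
  obtain ⟨v, hv⟩ := exists_of_tendsto h1
  refine ⟨v, hasDirDerivAt_one_iff.2 fun k => ?_⟩
  rw [hv]
  exact hy k

namespace SmoothCurveOn

variable {c v : ℝ → CircleFun} {S : Set ℝ}

theorem velocity (hc : SmoothCurveOn c S) (hS : IsOpen S) (hv : ∀ t ∈ S, HasDirDerivAt c (v t) t 1) :
    SmoothCurveOn v S := by
  intro k
  have h1 := ((contDiffOn_infty_iff_deriv_of_isOpen hS).1 (hc k)).2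
  exact h1.congr fun t ht => ((hasDirDerivAt_one_iff.1 (hv t ht)) k).deriv.symm

theorem contDiffOn_uncurry (hc : SmoothCurveOn c S) (hS : IsOpen S) :
    ContDiffOn ℝ ∞ (fun p : ℝ × ℝ => c p.1 p.2) (S ×ˢ univ) := by
  have hs : ∀ i k, ContDiffOn ℝ ∞ (iteratedDeriv i fun t => jet k (c t)) S := by
    intro i k
    induction i with
    | zero => simpa using hc k
    | succ i ih =>
      rw [iteratedDeriv_succ]
      exact ((contDiffOn_infty_iff_deriv_of_isOpen hS).1 ih).2
  have ht : ∀ i k, ∀ t ∈ S, HasDerivAt (iteratedDeriv i fun t => jet k (c t))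
      (iteratedDeriv (i + 1) (fun t => jet k (c t)) t) t := by
    intro i k t ht
    rw [iteratedDeriv_succ]
    exact (((hs i k).differentiableOn (by simp)).differentiableAt (hS.mem_nhds ht)).hasDerivAt
  have hx : ∀ i k, ∀ t ∈ S, CircleC.IsD (iteratedDeriv i (fun t => jet k (c t)) t)
      (iteratedDeriv i (fun t => jet (k + 1) (c t)) t) := by
    intro i k
    induction i with
    | zero => exact fun t _ => by simpa using isD_jet k (c t)
    | succ i ih =>
      intro t hts
      refine CircleC.IsD.deriv (ht i k t hts) (ht i (k + 1) t hts) ?_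
      filter_upwards [hS.mem_nhds hts] with s hs using ih s hs
  refine contDiffOn_infty.2 fun n => ?_
  have h := CircleC.contDiffOn_uncurry (f := fun i k => iteratedDeriv i fun t => jet k (c t)) hS ht hx n 0 0
  simpa [jet_zero] using h

end SmoothCurveOn

end CircleFun

/-! ### Inversion of families of diffeomorphisms -/

/-- The linear equivalence `(s, y) ↦ (s, α s + β y)`. -/
def lowerTriangular (α β : ℝ) (hβ : β ≠ 0) : (ℝ × ℝ) ≃L[ℝ] (ℝ × ℝ) :=
  ContinuousLinearEquiv.equivOfInverse
    ((ContinuousLinearMap.fst ℝ ℝ ℝ).prod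
      (α • ContinuousLinearMap.fst ℝ ℝ ℝ + β • ContinuousLinearMap.snd ℝ ℝ ℝ))
    ((ContinuousLinearMap.fst ℝ ℝ ℝ).prod
      (β⁻¹ • (ContinuousLinearMap.snd ℝ ℝ ℝ - α • ContinuousLinearMap.fst ℝ ℝ ℝ)))
    (fun w => by ext <;> simp [hβ]) (fun w => by ext <;> simp [hβ])

/-- The inverse function theorem applies to `(t, x) ↦ (t, F (t, x))`, whose derivative is
triangular. Injectivity on fibres identifies `ξ` with the local inverse, so no continuity of `ξ` has
to be assumed. -/
theorem contDiffOn_fiberInverse {F ξ : ℝ × ℝ → ℝ} {S : Set ℝ} (hS : IsOpen S)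
    (hF : ContDiffOn ℝ ∞ F (S ×ˢ univ)) (hinj : ∀ t ∈ S, Function.Injective fun x => F (t, x))
    (hd : ∀ p ∈ S ×ˢ (univ : Set ℝ), fderiv ℝ F p (0, 1) ≠ 0)
    (hξ : ∀ t ∈ S, ∀ y, F (t, ξ (t, y)) = y) : ContDiffOn ℝ ∞ ξ (S ×ˢ univ) := by
  rintro ⟨t, y⟩ ⟨ht, -⟩
  refine ContDiffAt.contDiffWithinAt ?_
  have hO : IsOpen (S ×ˢ (univ : Set ℝ)) := hS.prod isOpen_univ
  set x := ξ (t, y) with hx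
  have hp : (t, x) ∈ S ×ˢ (univ : Set ℝ) := ⟨ht, mem_univ _⟩
  have hFa : ContDiffAt ℝ ∞ F (t, x) := hF.contDiffAt (hO.mem_nhds hp)
  have hFd := (hFa.differentiableAt (by simp)).hasFDerivAt
  have hG : ContDiffAt ℝ ∞ (fun p : ℝ × ℝ => (p.1, F p)) (t, x) := contDiffAt_fst.prodMk hFa
  have hGd : HasFDerivAt (fun p : ℝ × ℝ => (p.1, F p))
      (lowerTriangular (fderiv ℝ F (t, x) (1, 0)) (fderiv ℝ F (t, x) (0, 1)) (hd _ hp) :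
        ℝ × ℝ →L[ℝ] ℝ × ℝ) (t, x) := by
    convert! hasFDerivAt_fst.prodMk hFd using 1
    ext <;> simp [lowerTriangular]
  have hn : (∞ : WithTop ℕ∞) ≠ 0 := by simp
  have hy : F (t, x) = y := hξ t ht y
  have hinv : ContDiffAt ℝ ∞ (hG.localInverse hGd hn) (t, y) := by
    have := hG.to_localInverse hGd hn
    rwa [hy] at this
  refine hinv.snd.congr_of_eventuallyEq ?_
  have h1 := hG.toOpenPartialHomeomorph _ hGd hn |>.eventually_right_inverse
    (hG.image_mem_toOpenPartialHomeomorph_target hGd hn)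
  simp only [hy] at h1
  have h2 : ∀ᶠ q : ℝ × ℝ in 𝓝 (t, y), q.1 ∈ S :=
    continuous_fst.continuousAt.eventually (hS.mem_nhds ht)
  filter_upwards [h1, h2] with q hq hqS
  have h3 : ((hG.localInverse hGd hn q).1, F (hG.localInverse hGd hn q)) = q := hq
  have h4 := congrArg Prod.fst h3
  have h5 := congrArg Prod.snd h3
  simp only at h4 h5
  refine hinj q.1 hqS ?_
  simp only
  rw [hξ q.1 hqS, ← h4]
  exact h5.symm

/-! ### Smooth functions of two variables as curves of functions -/

/-- The continuous function on the circle with the given lift. -/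
def CircleC.ofPeriodic (f : ℝ → ℝ) (hf : Continuous f) (hp : Function.Periodic f 1) : CircleC :=
  CircleC.ofMap ⟨hp.lift, (QuotientAddGroup.isQuotientMap_mk _).continuous_iff.2 hf⟩

/-- Pointwise differentiability in `t` becomes differentiability in the uniform norm: `∂_t F` is
close to its value at time `t` uniformly over the compact period `[0, 1]`, and the mean value
inequality controls the remainder. -/
theorem differentiableAt_of_uncurry {f : ℝ → CircleC} {F : ℝ × ℝ → ℝ} {S : Set ℝ} (hS : IsOpen S)
    (hF : ContDiffOn ℝ 1 F (S ×ˢ univ)) (hf : ∀ t ∈ S, ∀ x : ℝ, f t (x : UnitAddCircle) = F (t, x))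
    {t : ℝ} (ht : t ∈ S) : DifferentiableAt ℝ f t := by
  have hO : IsOpen (S ×ˢ (univ : Set ℝ)) := hS.prod isOpen_univ
  set G : ℝ × ℝ → ℝ := fun p => fderiv ℝ F p (1, 0) with hG
  have hGc : ContinuousOn G (S ×ˢ univ) :=
    (hF.continuousOn_fderiv_of_isOpen hO le_rfl).clm_apply continuousOn_const
  have hFG : ∀ s ∈ S, ∀ x, HasDerivAt (fun r => F (r, x)) (G (s, x)) s := by
    intro s hs x
    have h1 := ((hF.differentiableOn (by simp)).differentiableAt
      (hO.mem_nhds (mk_mem_prod hs (mem_univ x)))).hasFDerivAt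
    exact h1.comp_hasDerivAt s ((hasDerivAt_id s).prodMk (hasDerivAt_const s x))
  have hFp : ∀ s ∈ S, ∀ x, F (s, x + 1) = F (s, x) := fun s hs x => by
    rw [← hf s hs, ← hf s hs]; simp
  have hGp : ∀ s ∈ S, ∀ x, G (s, x + 1) = G (s, x) := by
    intro s hs x
    refine ((hFG s hs (x + 1)).congr_of_eventuallyEq ?_).unique (hFG s hs x) |>.symm.symm
    filter_upwards [hS.mem_nhds hs] with r hr
    exact (hFp r hr x).symm
  have hGt : Continuous fun x => G (t, x) :=
    hGc.comp_continuous (continuous_const.prodMk continuous_id) fun x => ⟨ht, mem_univ _⟩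
  let g : CircleC := CircleC.ofPeriodic _ hGt (hGp t ht)
  refine HasDerivAt.differentiableAt (f' := g) (hasDerivAt_iff_isLittleO.2 ?_)
  rw [Asymptotics.isLittleO_iff]
  intro ε hε
  have h1 : ∀ᶠ s in 𝓝 t, ∀ x ∈ Icc (0 : ℝ) 1, |G (s, x) - G (t, x)| < ε := by
    refine isCompact_Icc.eventually_forall_of_forall_eventually fun x _ => ?_
    have h2 : ContinuousAt G (t, x) := hGc.continuousAt (hO.mem_nhds (mk_mem_prod ht (mem_univ x)))
    have h3 : ContinuousAt (fun p : ℝ × ℝ => |G (p.1, p.2) - G (t, p.2)|) (t, x) :=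
      (h2.sub (hGt.continuousAt.comp (f := Prod.snd) (x := (t, x)) continuousAt_snd)).abs
    refine h3.eventually (gt_mem_nhds ?_)
    simpa using hε
  obtain ⟨δ, hδ, hball⟩ := Metric.eventually_nhds_iff_ball.1 (h1.and (hS.mem_nhds ht))
  filter_upwards [Metric.ball_mem_nhds t hδ] with s hs
  refine CircleC.norm_le (by positivity) fun θ => ?_
  obtain ⟨x, hx, rfl⟩ : ∃ x ∈ Icc (0 : ℝ) 1, (x : UnitAddCircle) = θ := by
    obtain ⟨y, rfl⟩ := QuotientAddGroup.mk_surjective θ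
    refine ⟨Int.fract y, ⟨Int.fract_nonneg y, (Int.fract_lt_one y).le⟩, ?_⟩
    rw [Int.fract, AddCircle.coe_sub, sub_eq_self, AddCircle.coe_eq_zero_iff]
    exact ⟨⌊y⌋, by simp⟩
  have h4 := (convex_ball t δ).norm_image_sub_le_of_norm_hasDerivWithin_le
    (f := fun r => F (r, x) - (r - t) * G (t, x)) (f' := fun r => G (r, x) - G (t, x)) (C := ε)
    (fun r hr => ((hFG r (hball r hr).2 x).sub
      (((hasDerivAt_id r).sub_const t).mul_const (G (t, x)))).hasDerivWithinAt.congr_deriv (by simp))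
    (fun r hr => ((hball r hr).1 x hx).le) (Metric.mem_ball_self hδ) hs
  refine le_trans (le_of_eq ?_) h4
  have h5 : g (x : UnitAddCircle) = G (t, x) := rfl
  simp only [CircleC.sub_apply, CircleC.smul_apply, hf s (hball s hs).2, hf t ht, h5,
    sub_self, zero_mul, sub_zero]
  congr 1
  ring

theorem CircleFun.exists_hasDirDerivAt_of_uncurry {c : ℝ → CircleFun} {F : ℝ × ℝ → ℝ} {S : Set ℝ}
    (hS : IsOpen S) (hF : ContDiffOn ℝ ∞ F (S ×ˢ univ)) (hc : ∀ t ∈ S, ∀ x : ℝ, c t x = F (t, x))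
    {t : ℝ} (ht : t ∈ S) : ∃ v, HasDirDerivAt c v t 1 := by
  have hO : IsOpen (S ×ˢ (univ : Set ℝ)) := hS.prod isOpen_univ
  have key : ∀ k, ∃ G : ℝ × ℝ → ℝ, ContDiffOn ℝ ∞ G (S ×ˢ univ) ∧
      ∀ t ∈ S, ∀ x : ℝ, jet k (c t) (x : UnitAddCircle) = G (t, x) := by
    intro k
    induction k with
    | zero => exact ⟨F, hF, fun t ht x => by rw [jet_zero, toC_coe, hc t ht]⟩
    | succ k ih =>
      obtain ⟨G, hG, h⟩ := ih
      refine ⟨fun p => fderiv ℝ G p (0, 1),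
        (hG.fderiv_of_isOpen hO (by simp)).clm_apply contDiffOn_const, fun t ht x => ?_⟩
      have h1 := ((hG.differentiableOn (by simp)).differentiableAt
        (hO.mem_nhds (mk_mem_prod ht (mem_univ x)))).hasFDerivAt
      have h2 := h1.comp_hasDerivAt x ((hasDerivAt_const x t).prodMk (hasDerivAt_id x))
      refine (isD_jet k (c t) x).unique ?_
      rw [funext (h t ht)]
      exact h2
  refine exists_hasDirDerivAt_of_jets fun k => ?_
  obtain ⟨G, hG, h⟩ := key k
  exact differentiableAt_of_uncurry hS (hG.of_le (by exact_mod_cast le_top)) h ht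

/-! ### The charts of the diffeomorphism group -/

/-- The difference of two lifts is continuous and integer valued, hence constant on the connected
line. -/
theorem IsSmoothLift.exists_int {f g : ℝ → ℝ} {φ : UnitAddCircle → UnitAddCircle} (hf : IsSmoothLift f φ)
    (hg : IsSmoothLift g φ) : ∃ n : ℤ, ∀ x, f x = g x + n := by
  have h3 : ∀ x : ℝ, ∃ n : ℤ, f x - g x = n := by
    intro x
    have h4 : ((f x : ℝ) : UnitAddCircle) = (g x : UnitAddCircle) := (hf.2.2 x).symm.trans (hg.2.2 x)
    rw [← sub_eq_zero, ← AddCircle.coe_sub, AddCircle.coe_eq_zero_iff] at h4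
    obtain ⟨n, hn⟩ := h4
    exact ⟨n, by simpa using hn.symm⟩
  choose n hn using h3
  have hcont : Continuous fun x => (n x : ℝ) := by
    simp only [← hn]
    exact hf.1.continuous.sub hg.1.continuous
  have hnc : Continuous n := Int.isClosedEmbedding_coe_real.isInducing.continuous_iff.2 hcont
  refine ⟨n 0, fun x => ?_⟩
  have hx : n x = n 0 := PreconnectedSpace.constant inferInstance hnc
  rw [← hx, ← hn]
  ring

namespace CircleFun

/-- The constant functions. -/
def const (c : ℝ) : CircleFun := algebraMap ℝ CircleFun c

theorem const_apply (c x : ℝ) : const c x = c := rfl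

theorem add_apply (u v : CircleFun) (x : ℝ) : (u + v) x = u x + v x := rfl

theorem dx_const (c : ℝ) : dx (const c) = 0 := ext' fun x => deriv_const x c

theorem toC_const (c : ℝ) : toC (const c) = algebraMap ℝ CircleC c := toC.commutes c

end CircleFun

namespace CircleDiff

open CircleFun

theorem neg_one_lt_deriv_add_const {u : CircleFun} (c : ℝ) (h : ∀ x, -1 < deriv u x) (x : ℝ) :
    -1 < deriv (u + const c : CircleFun) x := by
  change -1 < dx (u + const c) x
  rw [map_add, dx_const, add_zero]
  exact h x

theorem param_add_const {u : CircleFun} (h : ∀ x, -1 < deriv u x) (n : ℤ) :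
    param (u + const n) = param u := by
  refine ext' fun θ => ?_
  obtain ⟨x, rfl⟩ := QuotientAddGroup.mk_surjective θ
  have h1 := (param_spec h).2.2 x
  have h2 := (param_spec (neg_one_lt_deriv_add_const n h)).2.2 x
  refine h2.trans (Eq.trans ?_ h1.symm)
  beta_reduce
  rw [add_apply, const_apply, ← add_assoc, AddCircle.coe_add, add_eq_left, AddCircle.coe_eq_zero_iff]
  exact ⟨n, by simp⟩

theorem exists_eq_add_const {u w : CircleFun} (hu : ∀ x, -1 < deriv u x) (hw : ∀ x, -1 < deriv w x)
    (h : param u = param w) : ∃ n : ℤ, u = w + const n := by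
  have h1 := param_spec hu
  rw [h] at h1
  obtain ⟨n, hn⟩ := h1.exists_int (param_spec hw)
  refine ⟨n, CircleFun.ext' fun x => ?_⟩
  have := hn x
  rw [add_apply, const_apply]
  linarith

theorem chart_param {j : Fin 2} {u : CircleFun} (hu : u ∈ chartDomain j) : chart j (param u) = u :=
  (param_injOn j).leftInvOn_invFunOn hu

theorem chart_mem {j : Fin 2} {φ : CircleDiff} (h : φ ∈ chartImage j) : chart j φ ∈ chartDomain j :=
  Function.invFunOn_mem h

theorem param_chart {j : Fin 2} {φ : CircleDiff} (h : φ ∈ chartImage j) : param (chart j φ) = φ :=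
  Function.invFunOn_eq h

/-- The left end point of the interval of values at `0` in the `j`-th chart domain. -/
def chartBase (j : Fin 2) : ℝ := ![(-1 / 2 : ℝ), 0] j

theorem mem_chartDomain {j : Fin 2} {u : CircleFun} : u ∈ chartDomain j ↔
    (chartBase j < u 0 ∧ u 0 < chartBase j + 1) ∧ ∀ x, -1 < deriv u x := by
  have h : ![(1 / 2 : ℝ), 1] j = chartBase j + 1 := by
    fin_cases j <;> simp [chartBase]; norm_num
  rw [chartDomain, mem_ofPred_eq, h, chartBase, and_assoc]

/-- The representative of `u` modulo integer constants in the `j`-th chart. -/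
def chartRep (j : Fin 2) (u : CircleFun) : CircleFun := u + const (-⌊u 0 - chartBase j⌋ : ℤ)

theorem param_chartRep (j : Fin 2) {u : CircleFun} (h : ∀ x, -1 < deriv u x) :
    param (chartRep j u) = param u := param_add_const h _

/-- The normalizing integer is a floor, and on the image of the chart its argument avoids the
integers. There the change of representative is locally constant, so it does not affect smoothness.
-/
theorem chartRep_eq {j : Fin 2} {u : CircleFun} (h : ∀ x, -1 < deriv u x)
    (hj : param u ∈ chartImage j) :
    Int.fract (u 0 - chartBase j) ≠ 0 ∧ chartRep j u = chart j (param u) := by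
  have h1 := mem_chartDomain.1 (chart_mem hj)
  obtain ⟨n, hn⟩ := exists_eq_add_const h1.2 h (param_chart hj)
  have h2 : chart j (param u) 0 = u 0 + n := by rw [hn, add_apply, const_apply]
  rw [h2] at h1
  have h3 : ⌊u 0 - chartBase j⌋ = -n := by
    rw [Int.floor_eq_iff]
    push_cast
    constructor <;> linarith [h1.1.1, h1.1.2]
  refine ⟨?_, ?_⟩
  · rw [Int.fract, h3]
    push_cast
    linarith [h1.1.1]
  · rw [chartRep, h3, neg_neg, ← hn]

theorem isOpen_diffDomain : IsOpen {u : CircleFun | ∀ x, -1 < deriv u x} := by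
  have h1 : IsOpen (range (NormedSpace.exp : CircleC → CircleC)) := isOpen_range_exp
  have h2 : Continuous fun u : CircleFun => 1 + toC (dx u) :=
    continuous_const.add (continuous_toC.comp continuous_dx)
  convert h1.preimage h2 using 1
  ext u
  rw [mem_preimage, CircleC.mem_range_exp]
  constructor
  · intro h θ
    obtain ⟨x, rfl⟩ := QuotientAddGroup.mk_surjective θ
    have h3 : toC (dx u) (x : UnitAddCircle) = deriv u x := toC_coe _ _
    change 0 < 1 + toC (dx u) (x : UnitAddCircle)
    rw [h3]
    linarith [h x]
  · intro h x
    have h3 : toC (dx u) (x : UnitAddCircle) = deriv u x := toC_coe _ _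
    have h4 : 0 < 1 + toC (dx u) (x : UnitAddCircle) := h _
    rw [h3] at h4
    linarith

theorem continuous_eval (x : ℝ) : Continuous fun u : CircleFun => u x := by
  have : (fun u : CircleFun => u x) = fun u => CircleC.ev (x : UnitAddCircle) (toC u) :=
    funext fun u => (toC_coe u x).symm
  rw [this]
  exact (CircleC.ev _).continuous.comp continuous_toC

theorem isOpen_chartDomain (j : Fin 2) : IsOpen (chartDomain j) := by
  have h : chartDomain j = (fun u : CircleFun => u 0) ⁻¹' Ioo (chartBase j) (chartBase j + 1) ∩
      {u | ∀ x, -1 < deriv u x} := ext fun u => mem_chartDomain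
  rw [h]
  exact (isOpen_Ioo.preimage (continuous_eval 0)).inter isOpen_diffDomain

theorem continuousOn_param (j : Fin 2) : ContinuousOn param (chartDomain j) := by
  rw [continuousOn_iff_continuous_domRestrict]
  exact continuous_iSup_rng (i := j) continuous_coinduced_rng

/-- Seen in another chart, the image of `S` is the union of the translates of `S` by integer
constants. -/
theorem isOpen_image {j : Fin 2} {S : Set CircleFun} (hS : IsOpen S) (hj : S ⊆ chartDomain j) :
    IsOpen (param '' S) := by
  refine isOpen_iSup_iff.2 fun i => isOpen_coinduced.2 ?_
  have h : (chartDomain i).domRestrict param ⁻¹' (param '' S) =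
      Subtype.val ⁻¹' ⋃ n : ℤ, (fun w => w + const n) ⁻¹' S := by
    ext ⟨w, hw⟩
    rw [mem_preimage, mem_preimage, mem_iUnion]
    constructor
    · rintro ⟨u, hu, huw⟩
      obtain ⟨n, hn⟩ := exists_eq_add_const (mem_chartDomain.1 (hj hu)).2 (mem_chartDomain.1 hw).2 huw
      exact ⟨n, show w + const n ∈ S by rwa [← hn]⟩
    · rintro ⟨n, hn⟩
      exact ⟨_, hn, param_add_const (mem_chartDomain.1 hw).2 n⟩
  rw [h]
  exact (isOpen_iUnion fun n => hS.preimage (continuous_id.add continuous_const)).preimage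
    continuous_subtype_val

theorem isOpen_chartImage (j : Fin 2) : IsOpen (chartImage j) := isOpen_image (isOpen_chartDomain j) subset_rfl

theorem continuousOn_chart (j : Fin 2) : ContinuousOn (chart j) (chartImage j) := by
  intro φ hφ
  refine ContinuousAt.continuousWithinAt ?_
  intro O hO
  obtain ⟨V, hV, hVo, hm⟩ := mem_nhds_iff.1 hO
  have h1 : IsOpen (param '' (V ∩ chartDomain j)) :=
    isOpen_image (hVo.inter (isOpen_chartDomain j)) inter_subset_right
  rw [mem_map]
  refine mem_of_superset (h1.mem_nhds ⟨chart j φ, ⟨hm, chart_mem hφ⟩, param_chart hφ⟩) ?_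
  rintro _ ⟨u, hu, rfl⟩
  rw [mem_preimage, chart_param hu.2]
  exact hV hu.1

/-- Point evaluations separate diffeomorphisms and have Hausdorff values. This gives the closedness
of the coincidence set in the uniqueness proof. -/
theorem continuous_apply (x : ℝ) : Continuous fun φ : CircleDiff => φ (x : UnitAddCircle) := by
  refine continuous_iSup_dom.2 fun j => continuous_coinduced_dom.2 ?_
  have h : (fun φ : CircleDiff => φ (x : UnitAddCircle)) ∘ (chartDomain j).domRestrict param =
      fun w => ((x + w.1 x : ℝ) : UnitAddCircle) := by
    funext w
    exact (param_spec (mem_chartDomain.1 w.2).2).2.2 x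
  rw [h]
  exact (AddCircle.continuous_mk' 1).comp
    (continuous_const.add ((continuous_eval x).comp continuous_subtype_val))

/-- The derivative of a lift never vanishes, since the inverse also has a smooth lift. It equals `1`
somewhere because the lift has degree one, so by the intermediate value theorem it is positive
everywhere. -/
theorem exists_param_eq (φ : CircleDiff) : ∃ u : CircleFun, (∀ x, -1 < deriv u x) ∧ param u = φ := by
  obtain ⟨f, hf⟩ := φ.2.1
  obtain ⟨g, hg⟩ := φ.2.2
  have hid : IsSmoothLift id (φ.toPerm.symm ∘ φ.toPerm) :=
    ⟨contDiff_id, fun _ => rfl, fun x => φ.toPerm.symm_apply_apply _⟩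
  obtain ⟨n, hn⟩ := (hg.comp hf).exists_int hid
  have hfd : ∀ x, HasDerivAt f (deriv f x) x := fun x =>
    (hf.1.differentiable (by simp) x).hasDerivAt
  have hne : ∀ x, deriv f x ≠ 0 := by
    intro x h0
    have h1 := ((hg.1.differentiable (by simp) (f x)).hasDerivAt).comp x (hfd x)
    have h2 : HasDerivAt (g ∘ f) 1 x := by
      rw [funext hn]
      exact (hasDerivAt_id x).add_const _
    have h3 := h1.unique h2
    rw [h0, mul_zero] at h3
    exact zero_ne_one h3
  have hpos : ∀ x, 0 < deriv f x := by
    intro x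
    by_contra hx
    have hc : Continuous (deriv f) := (contDiff_infty_iff_deriv.1 hf.1).2.continuous
    obtain ⟨c, -, hcs⟩ := exists_deriv_eq_slope f zero_lt_one hf.1.continuous.continuousOn
      (hf.1.differentiable (by simp)).differentiableOn
    have h1 : deriv f c = 1 := by
      have := hf.2.1 0
      rw [zero_add] at this
      rw [hcs, this]
      ring
    obtain ⟨y, hy⟩ := mem_range_of_exists_le_of_exists_ge hc ⟨x, not_lt.1 hx⟩
      ⟨c, h1.symm ▸ zero_le_one⟩
    exact hne y hy
  let u : CircleFun := ⟨fun x => f x - x, hf.1.sub contDiff_id, fun x => by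
    change f (x + 1) - (x + 1) = f x - x
    rw [hf.2.1]
    ring⟩
  have hu : ∀ x, u x = f x - x := fun _ => rfl
  have hud : ∀ x, -1 < deriv u x := by
    intro x
    have h1 : HasDerivAt u (deriv f x - 1) x := (hfd x).sub (hasDerivAt_id x)
    rw [h1.deriv]
    linarith [hpos x]
  refine ⟨u, hud, ext' fun θ => ?_⟩
  obtain ⟨x, rfl⟩ := QuotientAddGroup.mk_surjective θ
  refine ((param_spec hud).2.2 x).trans (Eq.trans ?_ (hf.2.2 x).symm)
  beta_reduce
  rw [hu, add_sub_cancel]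

theorem chartRep_mem (j : Fin 2) {u : CircleFun} (h : ∀ x, -1 < deriv u x)
    (hj : Int.fract (u 0 - chartBase j) ≠ 0) : chartRep j u ∈ chartDomain j := by
  refine mem_chartDomain.2 ⟨?_, neg_one_lt_deriv_add_const _ h⟩
  have h1 : chartRep j u 0 = chartBase j + Int.fract (u 0 - chartBase j) := by
    rw [chartRep, add_apply, const_apply, Int.fract]
    push_cast
    ring
  rw [h1]
  have h2 : 0 < Int.fract (u 0 - chartBase j) := lt_of_le_of_ne (Int.fract_nonneg _) hj.symm
  constructor <;> linarith [Int.fract_lt_one (u 0 - chartBase j)]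

theorem exists_mem_chartImage (φ : CircleDiff) : ∃ j, φ ∈ chartImage j := by
  obtain ⟨u, hu, rfl⟩ := exists_param_eq φ
  have key : ∀ j, Int.fract (u 0 - chartBase j) ≠ 0 → ∃ j, param u ∈ chartImage j := fun j hj =>
    ⟨j, chartRep j u, chartRep_mem j hu hj, param_chartRep j hu⟩
  -- Chart `1` misses exactly the integer values of `u 0`; these lie in the middle of the interval
  -- of chart `0`.
  by_cases h : Int.fract (u 0) = 0
  · refine key 0 ?_
    obtain ⟨n, hn⟩ := Int.fract_eq_zero_iff.1 h
    have h1 : u 0 - chartBase 0 = (n : ℝ) + 1 / 2 := by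
      rw [← hn]
      simp [chartBase]
      ring
    rw [h1, Int.fract_intCast_add, Int.fract_eq_self.2 (by norm_num)]
    norm_num
  · exact key 1 (by simpa [chartBase] using h)

section Good

variable {X : Type} [AddCommGroup X] [Module ℝ X] [TopologicalSpace X] {U : Set X}

theorem goodN_floor {f : X → CircleC} (hf : BSmoothOn f U) (a : ℝ)
    (h : ∀ x ∈ U, Int.fract (f x ((0 : ℝ) : UnitAddCircle) - a) ≠ 0) (n : ℕ) :
    GoodN CircleC.IsD n
      (fun x => algebraMap ℝ CircleC (-⌊f x ((0 : ℝ) : UnitAddCircle) - a⌋ : ℤ)) U := by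
  have hO : IsOpen {y : ℝ | Int.fract (y - a) ≠ 0} := by
    have h1 : {y : ℝ | Int.fract (y - a) ≠ 0} = (fun y => y - a) ⁻¹' (range ((↑) : ℤ → ℝ))ᶜ := by
      ext y
      simp only [mem_ofPred_eq, mem_preimage, mem_compl_iff, Int.fract_eq_zero_iff, ne_eq]
    rw [h1]
    exact Int.isClosedEmbedding_coe_real.isClosed_range.isOpen_compl.preimage
      (continuous_id.sub continuous_const)
  have hs : ContDiffOn ℝ ∞ (fun y : ℝ => algebraMap ℝ CircleC (-⌊y - a⌋ : ℤ))
      {y : ℝ | Int.fract (y - a) ≠ 0} := by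
    intro y hy
    refine ContDiffAt.contDiffWithinAt ?_
    refine (contDiffAt_const (c := algebraMap ℝ CircleC (-⌊y - a⌋ : ℤ))).congr_of_eventuallyEq ?_
    have h2 : Ioo (⌊y - a⌋ + a : ℝ) (⌊y - a⌋ + 1 + a) ∈ 𝓝 y := by
      refine isOpen_Ioo.mem_nhds ⟨?_, by linarith [Int.lt_floor_add_one (y - a)]⟩
      have h3 : 0 < Int.fract (y - a) := lt_of_le_of_ne (Int.fract_nonneg _) (Ne.symm hy)
      rw [Int.fract] at h3
      linarith
    filter_upwards [h2] with w hw
    have h3 : ⌊w - a⌋ = ⌊y - a⌋ := by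
      rw [Int.floor_eq_iff]
      constructor <;> linarith [hw.1, hw.2]
    rw [h3]
  have hb : BSmoothOn (fun x => algebraMap ℝ CircleC (-⌊f x ((0 : ℝ) : UnitAddCircle) - a⌋ : ℤ)) U :=
    (hf.comp_contDiff (CircleC.ev ((0 : ℝ) : UnitAddCircle)).contDiff).comp hO hs h
  cases n with
  | zero => exact hb
  | succ n =>
    refine ⟨hb, fun _ => algebraMap ℝ CircleC 0, GoodN.const CircleC.derivRel 0, fun x _ => ?_⟩
    rw [map_zero]
    exact CircleC.isD_const _

theorem goodN_chartRep {Q : X → CircleFun} {j : Fin 2} (hQ : ∀ n, GoodN CircleC.IsD n (fun x => toC (Q x)) U)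
    (h : ∀ x ∈ U, Int.fract (Q x 0 - chartBase j) ≠ 0) (n : ℕ) :
    GoodN CircleC.IsD n (fun x => toC (chartRep j (Q x))) U := by
  have e : ∀ x, toC (Q x) ((0 : ℝ) : UnitAddCircle) = Q x 0 := fun x => toC_coe _ _
  refine (GoodN.add CircleC.derivRel (hQ n) (goodN_floor (hQ 0) (chartBase j)
    (fun x hx => by rw [e]; exact h x hx) n)).congr fun x _ => ?_
  rw [chartRep, map_add, toC_const, e]

theorem smoothOnInto_param [ContinuousAdd X] [ContinuousSMul ℝ X] {Q : X → CircleFun} (hU : IsOpen U)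
    (hQ : ∀ n, GoodN CircleC.IsD n (fun x => toC (Q x)) U) {i : Fin 2}
    (hi : ∀ x ∈ U, Q x ∈ chartDomain i) {F : X → CircleDiff} (hF : ∀ x ∈ U, F x = param (Q x)) :
    SmoothOnInto F U := by
  have hc : ContinuousOn Q U := CircleFun.continuousOn_iff.2 fun k => (GoodN.jet hQ k).continuousOn
  have hp : ContinuousOn F U := ((continuousOn_param i).comp hc hi).congr hF
  refine ⟨hp, fun j => ?_⟩
  have hO := hp.isOpen_inter_preimage hU (isOpen_chartImage j)
  have hn : ∀ x ∈ U ∩ F ⁻¹' chartImage j,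
      Int.fract (Q x 0 - chartBase j) ≠ 0 ∧ chartRep j (Q x) = chart j (F x) := by
    intro x hx
    have h1 : F x ∈ chartImage j := hx.2
    rw [hF x hx.1] at h1 ⊢
    exact chartRep_eq (mem_chartDomain.1 (hi x hx.1)).2 h1
  refine fun n => isClassC_of_jets hO (fun k => GoodN.jet (fun n => ?_) k) n
  refine (goodN_chartRep (fun n => (hQ n).precomp (ContinuousLinearMap.id ℝ X) fun x hx => hx.1) (fun x hx => (hn x hx).1) n).congr
    fun x hx => ?_
  exact congrArg toC (hn x hx).2.symm

end Good

theorem _root_.CircleFun.continuousAt_of_hasDirDerivAt {c : ℝ → CircleFun} {v : CircleFun} {t : ℝ}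
    (h : HasDirDerivAt c v t 1) : ContinuousAt c t :=
  CircleFun.tendsto_iff.2 fun k => (CircleFun.hasDirDerivAt_one_iff.1 h k).continuousAt

/-- By continuity of `Q` at `t`, the coordinate in any chart differs from `Q` near `t` by one fixed
integer constant, which has no effect on the velocity. -/
theorem hasVelocityAt_param {Q : ℝ → CircleFun} {v : CircleFun} {t : ℝ} (h : HasDirDerivAt Q v t 1)
    (hD : ∀ x, -1 < deriv (Q t) x) : HasVelocityAt (fun s => param (Q s)) v t := by
  intro j hj
  have hc := CircleFun.continuousAt_of_hasDirDerivAt h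
  obtain ⟨n, hn⟩ := exists_eq_add_const (mem_chartDomain.1 (chart_mem hj)).2 hD (param_chart hj)
  have h1 : ∀ᶠ s in 𝓝 t, chart j (param (Q s)) = Q s + const n := by
    have h2 : ∀ᶠ s in 𝓝 t, Q s + const n ∈ chartDomain j :=
      (hc.add continuousAt_const).eventually ((isOpen_chartDomain j).mem_nhds
        (show Q t + const n ∈ chartDomain j from hn ▸ chart_mem hj))
    filter_upwards [h2, hc.eventually (isOpen_diffDomain.mem_nhds hD)] with s hs hs'
    rw [← param_add_const hs' n, chart_param hs]
  refine CircleFun.hasDirDerivAt_one_iff.2 fun k => ?_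
  refine HasDerivAt.congr_of_eventuallyEq
    ((CircleFun.hasDirDerivAt_one_iff.1 h k).add_const (jet k (const n))) ?_
  filter_upwards [h1] with s hs
  rw [hs, map_add]

end CircleDiff

/-! ### Eulerian and Lagrangian velocities -/

namespace CircleC

open NormedSpace

theorem exp_mul_eq_zero {f d : CircleC} (h : exp f * d = 0) : d = 0 := by
  linear_combination exp (-f) * h - d * banach_exp_mul_exp_neg f

/-- The difference `d` satisfies `dₓ = -φₓ d`, so `(1 + ∂ₓ)(e^q d) = 0` and `d = 0` by injectivity
of `1 + ∂ₓ` on periodic functions. -/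
theorem eq_of_isD_sub {z c f g : CircleC} (hf : IsD f (stretch z * (c - f)))
    (hg : IsD g (stretch z * (c - g))) : f = g := by
  have h1 := (isD_resP_stretch z).exp.mul (hf.sub hg)
  have h2 := resP_of_isD h1
  have e : exp (resP z) * (f - g) + (exp (resP z) * (stretch z - 1) * (f - g) +
      exp (resP z) * (stretch z * (c - f) - stretch z * (c - g))) = 0 := by ring
  rw [e, map_zero] at h2
  exact sub_eq_zero.1 (exp_mul_eq_zero h2.symm)

theorem eq_of_isD_add {z c f g : CircleC} (hf : IsD f (stretch z * (f - c)))
    (hg : IsD g (stretch z * (g - c))) : f = g := by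
  have h1 := (isD_resP_stretch z).neg.exp.mul (hf.sub hg)
  have h2 := resM_of_isD h1
  have e : exp (-resP z) * (f - g) - (exp (-resP z) * -(stretch z - 1) * (f - g) +
      exp (-resP z) * (stretch z * (f - c) - stretch z * (g - c))) = 0 := by ring
  rw [e, map_zero] at h2
  exact sub_eq_zero.1 (exp_mul_eq_zero h2.symm)

theorem mul_left_cancel_stretch {z f g : CircleC} (hz : z ∈ dom) (h : stretch z * f = stretch z * g) :
    f = g := by
  refine ext' fun θ => ?_
  have h1 := congrArg (fun w : CircleC => w θ) h
  exact mul_left_cancel₀ (mem_dom.1 hz θ).ne' h1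

end CircleC

/-! ### Composition with `id + q` and the conserved momentum. -/

namespace CircleFun

/-- The function `u ∘ (id + q)`. -/
def compAdd (u q : CircleFun) : CircleFun :=
  ⟨fun x => u (x + q x), u.contDiff.comp (contDiff_id.add q.contDiff), fun x => by
    change u (x + 1 + q (x + 1)) = u (x + q x)
    rw [q.periodic x, add_right_comm]
    exact u.periodic _⟩

theorem compAdd_apply (u q : CircleFun) (x : ℝ) : compAdd u q x = u (x + q x) := rfl

theorem hasDerivAt_compAdd (u q : CircleFun) (x : ℝ) :
    HasDerivAt (fun x => u (x + q x)) (dx u (x + q x) * (1 + dx q x)) x :=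
  (u.hasDerivAt (x + q x)).comp x ((hasDerivAt_id x).add (q.hasDerivAt x))

theorem dx_compAdd (u q : CircleFun) : dx (compAdd u q) = (1 + dx q) * compAdd (dx u) q := by
  refine ext' fun x => ((hasDerivAt_compAdd u q x).deriv).trans ?_
  rw [mul_comm]
  rfl

/-- The coordinate in which the geodesic equation is an ordinary differential equation. -/
def coord (q : CircleFun) : CircleC := toC q + toC (dx q)

theorem resP_coord (q : CircleFun) : CircleC.resP (coord q) = toC q := CircleC.resP_of_isD (isD_toC q)

theorem stretch_coord (q : CircleFun) : CircleC.stretch (coord q) = toC (1 + dx q) := by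
  rw [CircleC.stretch_eq, resP_coord, coord, map_add, map_one]
  ring

theorem coord_mem_dom {q : CircleFun} (hq : ∀ x, -1 < deriv q x) : coord q ∈ CircleC.dom := by
  rw [CircleC.mem_dom]
  intro θ
  obtain ⟨x, rfl⟩ := QuotientAddGroup.mk_surjective θ
  rw [stretch_coord]
  have h : toC (1 + dx q) (x : UnitAddCircle) = 1 + deriv q x := toC_coe _ _
  refine lt_of_lt_of_eq ?_ h.symm
  linarith [hq x]

theorem coord_eq_of_toC_eq {q : CircleFun} {z : CircleC} (h : toC q = CircleC.resP z) : coord q = z := by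
  have h1 := isD_toC q
  rw [h] at h1
  rw [coord, h1.unique (CircleC.isD_resP z), h]
  ring

variable {b : ℝ} {q u : CircleFun} {m : CircleC}

theorem isD_compAdd (u q : CircleFun) : CircleC.IsD (toC (compAdd u q))
    (CircleC.stretch (coord q) * toC (compAdd (dx u) q)) := by
  have h := isD_toC (compAdd u q)
  rwa [dx_compAdd, map_mul, ← stretch_coord] at h

theorem compAdd_opA (u q : CircleFun) :
    toC (compAdd (opA u) q) = toC (compAdd u q) - toC (compAdd (dx (dx u)) q) := by
  rw [← map_sub]
  rfl

/-- The functions `(u ∓ uₓ) ∘ φ` satisfy the same first-order equations as `velA` and `velB`, and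
periodic solutions of these are unique. -/
theorem vel_slope_of_compAdd_opA
    (h : toC (compAdd (opA u) q) = CircleC.powr (-b) (CircleC.stretch (coord q)) * m) :
    toC (compAdd u q) = CircleC.vel b (coord q) m ∧
      toC (compAdd (dx u) q) = CircleC.slope b (coord q) m := by
  have h1 := isD_compAdd u q
  have h2 := isD_compAdd (dx u) q
  rw [compAdd_opA] at h
  have hA : toC (compAdd u q) - toC (compAdd (dx u) q) = CircleC.velA b (coord q) m := by
    refine CircleC.eq_of_isD_sub ?_ (CircleC.isD_velA b (coord q) m)
    convert h1.sub h2 using 1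
    linear_combination (-CircleC.stretch (coord q)) * h
  have hB : toC (compAdd u q) + toC (compAdd (dx u) q) = CircleC.velB b (coord q) m := by
    refine CircleC.eq_of_isD_add ?_ (CircleC.isD_velB b (coord q) m)
    convert h1.add h2 using 1
    linear_combination CircleC.stretch (coord q) * h
  rw [CircleC.vel_eq, CircleC.slope_eq, ← hA, ← hB]
  constructor <;> module

theorem coord_compAdd_eq_field
    (h : toC (compAdd (opA u) q) = CircleC.powr (-b) (CircleC.stretch (coord q)) * m) :
    coord (compAdd u q) = CircleC.field b (coord q) m := by
  obtain ⟨h1, h2⟩ := vel_slope_of_compAdd_opA h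
  rw [CircleC.field_eq, ← h1, ← h2, coord, dx_compAdd, map_mul, stretch_coord]

/-- Differentiating `u ∘ φ` twice in `x` and cancelling the positive factor `φₓ` each time recovers
`uₓ ∘ φ` and `uₓₓ ∘ φ`, hence the momentum. -/
theorem compAdd_opA_of_vel (hq : ∀ x, -1 < deriv q x)
    (h : toC (compAdd u q) = CircleC.vel b (coord q) m) :
    toC (compAdd (opA u) q) = CircleC.powr (-b) (CircleC.stretch (coord q)) * m := by
  have hz := coord_mem_dom hq
  have h1 := isD_compAdd u q
  rw [h] at h1
  have h2 := CircleC.mul_left_cancel_stretch hz (h1.unique (CircleC.isD_vel b (coord q) m))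
  have h3 := isD_compAdd (dx u) q
  rw [h2] at h3
  have h4 := CircleC.mul_left_cancel_stretch hz (h3.unique (CircleC.isD_slope b (coord q) m))
  rw [compAdd_opA, h4, h]
  ring

theorem powr_stretch_coord (hq : ∀ x, -1 < deriv q x) (s x : ℝ) :
    CircleC.powr s (CircleC.stretch (coord q)) (x : UnitAddCircle) = (1 + dx q x) ^ s := by
  rw [CircleC.powr_apply (CircleC.mem_dom.1 (coord_mem_dom hq)), stretch_coord]
  have h : toC (1 + dx q) (x : UnitAddCircle) = 1 + dx q x := toC_coe _ _
  exact congrArg (· ^ s) h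

/-- The conserved quantity `((A u) ∘ φ) φₓ^b`, as a condition on continuous functions. -/
theorem compAdd_opA_iff (hq : ∀ x, -1 < deriv q x) :
    toC (compAdd (opA u) q) = CircleC.powr (-b) (CircleC.stretch (coord q)) * m ↔
      ∀ x : ℝ, opA u (x + q x) * (1 + dx q x) ^ b = m (x : UnitAddCircle) := by
  have hp : ∀ x, 0 < 1 + dx q x := fun x => by
    have : -1 < dx q x := hq x
    linarith
  have e : ∀ x, (1 + dx q x) ^ (-b) * (1 + dx q x) ^ b = 1 := fun x => by
    rw [← Real.rpow_add (hp x), neg_add_cancel, Real.rpow_zero]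
  have h1 : ∀ x : ℝ, toC (compAdd (opA u) q) (x : UnitAddCircle) = opA u (x + q x) := fun x => toC_coe _ _
  constructor
  · intro h x
    rw [← h1, h, CircleC.mul_apply, powr_stretch_coord hq]
    linear_combination m (x : UnitAddCircle) * e x
  · intro h
    refine CircleC.ext_coe fun x => ?_
    rw [h1, CircleC.mul_apply, powr_stretch_coord hq, ← h]
    linear_combination (-opA u (x + q x)) * e x

theorem hasDerivAt_toC {c : ℝ → CircleFun} {v : CircleFun} {t : ℝ} (h : HasDirDerivAt c v t 1) :
    HasDerivAt (fun s => toC (c s)) (toC v) t := by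
  have h1 := hasDirDerivAt_one_iff.1 h 0
  simp only [jet_zero] at h1
  exact h1

theorem hasDerivAt_momentum {c : ℝ → CircleFun} {v : CircleFun} {t : ℝ} (h : HasDirDerivAt c v t 1) :
    HasDerivAt (fun s => momentum (c s)) (momentum v) t := by
  have e : ∀ w, momentum w = jet 0 w - jet 2 w := fun w => by
    rw [momentum_apply, jet_succ, jet_succ, jet_zero, jet_zero, ← map_sub]
    rfl
  simp only [e]
  exact (hasDirDerivAt_one_iff.1 h 0).sub (hasDirDerivAt_one_iff.1 h 2)

theorem hasDerivAt_jet_apply {c : ℝ → CircleFun} {v : CircleFun} {t : ℝ} (h : HasDirDerivAt c v t 1)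
    (k : ℕ) (θ : UnitAddCircle) : HasDerivAt (fun s => jet k (c s) θ) (jet k v θ) t :=
  (CircleC.ev θ).hasFDerivAt.comp_hasDerivAt t (hasDirDerivAt_one_iff.1 h k)

theorem hasDerivAt_apply {c : ℝ → CircleFun} {v : CircleFun} {t : ℝ} (h : HasDirDerivAt c v t 1) (x : ℝ) :
    HasDerivAt (fun s => c s x) (v x) t := by
  simpa [jet_zero] using hasDerivAt_jet_apply h 0 (x : UnitAddCircle)

theorem hasDerivAt_dx_apply {c : ℝ → CircleFun} {v : CircleFun} {t : ℝ} (h : HasDirDerivAt c v t 1) (x : ℝ) :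
    HasDerivAt (fun s => dx (c s) x) (dx v x) t := by
  simpa [jet_zero, jet_succ] using hasDerivAt_jet_apply h 1 (x : UnitAddCircle)

/-- The time derivative of `((A u) ∘ φ) φₓ^b` along a curve with Eulerian velocity `u`. -/
theorem hasDerivAt_transport (b : ℝ) {Q u : ℝ → CircleFun} {u' : CircleFun} {t : ℝ}
    (hQ : HasDirDerivAt Q (compAdd (u t) (Q t)) t 1) (hu : HasDirDerivAt u u' t 1)
    (hq : ∀ x, -1 < deriv (Q t) x) (x : ℝ) :
    HasDerivAt (fun s => opA (u s) (x + Q s x) * (1 + dx (Q s) x) ^ b)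
      ((opA u' + (u t * dx (opA (u t)) + b • (opA (u t) * dx (u t))) : CircleFun) (x + Q t x) *
        (1 + dx (Q t) x) ^ b) t := by
  have hp : 0 < 1 + dx (Q t) x := by
    have : -1 < dx (Q t) x := hq x
    linarith
  have h1 := CircleC.hasFDerivAt_uncurry (x := x + Q t x) (hasDerivAt_momentum hu)
    (isD_toC (opA (u t)))
  have h2 : HasDerivAt (fun s => x + Q s x) (u t (x + Q t x)) t := (hasDerivAt_apply hQ x).const_add x
  have h3 := HasFDerivAt.comp_hasDerivAt (f := fun s => (s, x + Q s x)) t h1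
    ((hasDerivAt_id t).prodMk h2)
  have h4 : HasDerivAt (fun s => (1 + dx (Q s) x) ^ b) _ t :=
    ((hasDerivAt_dx_apply hQ x).const_add 1).rpow_const (Or.inl hp.ne')
  have h5 := h3.mul h4
  convert! h5 using 1
  have e1 : momentum u' ((x + Q t x : ℝ) : UnitAddCircle) = opA u' (x + Q t x) := toC_coe _ _
  have e2 : toC (dx (opA (u t))) ((x + Q t x : ℝ) : UnitAddCircle) = dx (opA (u t)) (x + Q t x) :=
    toC_coe _ _
  have e3 : momentum (u t) ((x + Q t x : ℝ) : UnitAddCircle) = opA (u t) (x + Q t x) := toC_coe _ _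
  have e4 : dx (compAdd (u t) (Q t)) x = (1 + dx (Q t) x) * dx (u t) (x + Q t x) := by
    rw [dx_compAdd]; rfl
  have e5 : (opA u' + (u t * dx (opA (u t)) + b • (opA (u t) * dx (u t))) : CircleFun) (x + Q t x) =
      opA u' (x + Q t x) + (u t (x + Q t x) * dx (opA (u t)) (x + Q t x) +
        b * (opA (u t) (x + Q t x) * dx (u t) (x + Q t x))) := rfl
  have e6 : (1 + dx (Q t) x) ^ (b - 1) * (1 + dx (Q t) x) = (1 + dx (Q t) x) ^ b := by
    rw [Real.rpow_sub_one hp.ne', div_mul_cancel₀ _ hp.ne']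
  simp only [Function.comp_apply, e3, e5, _root_.add_apply, _root_.smul_apply,
    ContinuousLinearMap.coe_fst', ContinuousLinearMap.coe_snd', smul_eq_mul, e1, e2, e4, ← e6]
  ring

theorem opB_self (b : ℝ) (u : CircleFun) :
    opB b u u = opAInv (u * dx (opA u) + b • (opA u * dx u)) := by
  rw [opB, ← map_smul]
  congr 1
  module

theorem bracket_self (u : CircleFun) : bracket u u = 0 := by
  rw [bracket]
  ring

end CircleFun

namespace CircleDiff

open CircleFun

/-- For `w = u` the bracket vanishes. Applying the injective operator `A` turns the rest into the
`b`-equation, whose left-hand side is the one transported in `hasDerivAt_transport`. -/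
theorem hasCovDerivAt_self_iff {b : ℝ} {u : ℝ → CircleFun} {u' : CircleFun} {t : ℝ}
    (h : HasDirDerivAt u u' t 1) : HasCovDerivAt b u u 0 t ↔
      opA u' + (u t * dx (opA (u t)) + b • (opA (u t) * dx (u t))) = 0 := by
  have key : u' + (1 / 2 : ℝ) • bracket (u t) (u t) + opB b (u t) (u t) = 0 ↔
      opA u' + (u t * dx (opA (u t)) + b • (opA (u t) * dx (u t))) = 0 := by
    rw [bracket_self, smul_zero, add_zero, opB_self, ← opA_bijective.injective.eq_iff, map_add, map_zero,
      opA_opAInv]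
  rw [← key]
  constructor
  · rintro ⟨w, hw, h0⟩
    have : w = u' := tendsto_nhds_unique hw h
    rw [← this, ← h0]
  · intro h0
    exact ⟨u', h, h0.symm⟩

theorem exists_lift_inv {q : CircleFun} (hq : ∀ x, -1 < deriv q x) :
    ∃ n : ℤ, ∀ x, (param q)⁻¹.lift (x + q x) = x + n := by
  have hid : IsSmoothLift id ((param q).toPerm.symm ∘ (param q).toPerm) :=
    ⟨contDiff_id, fun _ => rfl, fun x => (param q).toPerm.symm_apply_apply _⟩
  exact ((param q)⁻¹.lift_spec.comp (param_spec hq)).exists_int hid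

theorem injective_add {q : CircleFun} (hq : ∀ x, -1 < deriv q x) : Function.Injective fun x => x + q x := by
  obtain ⟨n, hn⟩ := exists_lift_inv hq
  intro x y h
  have h1 := congrArg (param q)⁻¹.lift h
  simp only [hn] at h1
  linarith

theorem surjective_add {q : CircleFun} (hq : ∀ x, -1 < deriv q x) : Function.Surjective fun x => x + q x := by
  have hid : IsSmoothLift id ((param q).toPerm ∘ (param q).toPerm.symm) :=
    ⟨contDiff_id, fun _ => rfl, fun x => (param q).toPerm.apply_symm_apply _⟩
  obtain ⟨n, hn⟩ := ((param_spec hq).comp (param q)⁻¹.lift_spec).exists_int hid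
  intro y
  refine ⟨(param q)⁻¹.lift y - n, ?_⟩
  have h1 : q ((param q)⁻¹.lift y - n) = q ((param q)⁻¹.lift y) := by
    have := q.periodic_int ((param q)⁻¹.lift y) (-n)
    rwa [Int.cast_neg, ← sub_eq_add_neg] at this
  have h2 : (param q)⁻¹.lift y + q ((param q)⁻¹.lift y) = y + n := hn y
  simp only [h1]
  linarith

theorem compAdd_rightComp_inv {q : CircleFun} (hq : ∀ x, -1 < deriv q x) (v : CircleFun) :
    compAdd (rightComp (param q)⁻¹ v) q = v := by
  obtain ⟨n, hn⟩ := exists_lift_inv hq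
  refine CircleFun.ext' fun x => ?_
  change v ((param q)⁻¹.lift (x + q x)) = v x
  rw [hn, v.periodic_int]

end CircleDiff

/-! ### Existence of geodesics -/

theorem CircleC.vel_zero (b : ℝ) (m : CircleC) : vel b 0 m = resP (resM m) := by
  rw [resP_resM]
  have := LagrangeField.vel_zero (A := CircleC) CircleC.resP CircleC.resM b exp_injective m
  exact this

theorem CircleDiff.param_zero : CircleDiff.param 0 = 1 := by
  have h : ∀ x, -1 < deriv (0 : CircleFun) x := fun x => by
    change -1 < CircleFun.dx 0 x
    rw [map_zero]
    exact neg_one_lt_zero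
  refine CircleDiff.ext' fun θ => ?_
  obtain ⟨x, rfl⟩ := QuotientAddGroup.mk_surjective θ
  refine ((CircleDiff.param_spec h).2.2 x).trans ?_
  change ((x + 0 : ℝ) : UnitAddCircle) = x
  rw [add_zero]

open CircleFun in
/-- The smoothness of the Eulerian velocity of a smooth curve of diffeomorphisms. -/
theorem CircleDiff.exists_hasDirDerivAt_rightComp {Q v : ℝ → CircleFun} {S : Set ℝ} (hS : IsOpen S)
    (hQ : SmoothCurveOn Q S) (hv : ∀ t ∈ S, HasDirDerivAt Q (v t) t 1)
    (hq : ∀ t ∈ S, ∀ x, -1 < deriv (Q t) x) {t : ℝ} (ht : t ∈ S) :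
    ∃ u', HasDirDerivAt (fun s => rightComp (param (Q s))⁻¹ (v s)) u' t 1 := by
  have hF : ContDiffOn ℝ ∞ (fun p : ℝ × ℝ => p.2 + Q p.1 p.2) (S ×ˢ univ) :=
    contDiffOn_snd.add (hQ.contDiffOn_uncurry hS)
  have hV : ContDiffOn ℝ ∞ (fun p : ℝ × ℝ => v p.1 p.2) (S ×ˢ univ) :=
    (hQ.velocity hS hv).contDiffOn_uncurry hS
  have hex : ∀ p : ℝ × ℝ, ∃ x, p.1 ∈ S → x + Q p.1 x = p.2 := by
    intro p
    by_cases hp : p.1 ∈ S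
    · obtain ⟨x, hx⟩ := surjective_add (hq p.1 hp) p.2
      exact ⟨x, fun _ => hx⟩
    · exact ⟨0, fun h => absurd h hp⟩
  choose ξ hξ using hex
  have hξs : ContDiffOn ℝ ∞ ξ (S ×ˢ univ) := by
    refine contDiffOn_fiberInverse hS hF (fun t ht => injective_add (hq t ht)) (fun p hp => ?_)
      fun t ht y => hξ (t, y) ht
    have h1 := ((hF.differentiableOn (by simp)).differentiableAt
      ((hS.prod isOpen_univ).mem_nhds hp)).hasFDerivAt
    have h2 := h1.comp_hasDerivAt p.2 ((hasDerivAt_const p.2 p.1).prodMk (hasDerivAt_id p.2))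
    have h3 : HasDerivAt (fun x => x + Q p.1 x) (1 + dx (Q p.1) p.2) p.2 :=
      (hasDerivAt_id _).add ((Q p.1).hasDerivAt _)
    have h4 : -1 < dx (Q p.1) p.2 := hq p.1 hp.1 p.2
    rw [h2.unique h3]
    linarith
  -- Right translation by `φ⁻¹` is not smooth jointly in `φ` and `v` with values in a fixed Banach
  -- space, so the Eulerian velocity is handled as the two-variable function `v(t, ξ(t, y))`, where
  -- `ξ(t, ·)` inverts `id + Q t`.
  have hU : ContDiffOn ℝ ∞ (fun p : ℝ × ℝ => v p.1 (ξ p)) (S ×ˢ univ) :=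
    hV.comp (f := fun p : ℝ × ℝ => (p.1, ξ p)) (contDiffOn_fst.prodMk hξs) fun p hp => ⟨hp.1, mem_univ _⟩
  refine exists_hasDirDerivAt_of_uncurry hS hU (fun s hs x => ?_) ht
  have h := congrArg (fun w : CircleFun => w (ξ (s, x))) (compAdd_rightComp_inv (hq s hs) (v s))
  simp only [compAdd_apply] at h
  rwa [hξ (s, x) hs] at h

namespace IsSolutionMap

open CircleFun CircleDiff

variable {b ρ ε : ℝ} {Z : CircleC → PathC} (hZ : IsSolutionMap b ρ ε Z)
include hZ

theorem displacement_zero : displacement Z 0 = 0 := by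
  have h0 : momentum 0 ∈ Metric.ball (0 : CircleC) ρ := by
    rw [map_zero]
    exact Metric.mem_ball_self hZ.pos
  refine toC_injective ?_
  rw [hZ.toC_displacement h0, map_zero, map_zero, hZ.zero, map_zero]
  rfl

/-- By rescaling, `Z (s • m)` at time `1` equals the solution with momentum `2 m` at time `s / 2`.
This makes `s = 1` an interior time; the factors `2` and `1/2` cancel since the field is linear in
`m`. -/
theorem hasDerivAt_endTime {m : CircleC} (hm : m ∈ Metric.ball 0 (ρ / 2)) {t : ℝ}
    (ht : t ∈ Ioo (-2 : ℝ) 2) : HasDerivAt (fun s : ℝ => Z (s • m) PathC.endTime)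
      (CircleC.field b (Z (t • m) PathC.endTime) m) t := by
  have hm2 : (2 : ℝ) • m ∈ Metric.ball (0 : CircleC) ρ := by
    rw [mem_ball_zero_iff] at hm ⊢
    rw [norm_smul, Real.norm_eq_abs, abs_two]
    linarith
  have h1 : ∀ s ∈ Ioo (-2 : ℝ) 2, Z (s • m) PathC.endTime = (Z ((2 : ℝ) • m)).ext (s / 2) := by
    intro s hs
    rw [hZ.ext_eq hm2 (by constructor <;> linarith [hs.1, hs.2]), smul_smul, div_mul_cancel₀ s two_ne_zero]
  have h2 := (hZ.isSol _ hm2).hasDerivAt (t := t / 2) (by constructor <;> linarith [ht.1, ht.2])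
  have h3 := h2.scomp t ((hasDerivAt_id t).div_const 2)
  rw [CircleC.field_smul, smul_smul, one_div_mul_cancel two_ne_zero, one_smul, ← h1 t ht] at h3
  refine h3.congr_of_eventuallyEq ?_
  filter_upwards [isOpen_Ioo.mem_nhds ht] with s hs using h1 s hs

/-- The geodesic is `t ↦ param (displacement Z (t • u₀))`. Its coordinate solves the ordinary
differential equation, so `u ∘ φ = vel`, the momentum is conserved, and differentiating the
conservation law in `t` gives the geodesic equation at every point `φ(x)`, that is everywhere. -/
theorem exists_geodesic {u₀ : CircleFun} (hu : momentum u₀ ∈ Metric.ball 0 (ρ / 2)) :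
    IsTimeOne b u₀ (param (displacement Z u₀)) := by
  set m := momentum u₀ with hm
  let Q : ℝ → CircleFun := fun t => displacement Z (t • u₀)
  have hmem : ∀ t ∈ Ioo (-2 : ℝ) 2, momentum (t • u₀) ∈ Metric.ball (0 : CircleC) ρ := by
    intro t ht
    rw [mem_ball_zero_iff] at hu ⊢
    rw [map_smul, norm_smul, Real.norm_eq_abs]
    have h1 : |t| < 2 := abs_lt.2 ht
    have h2 := norm_nonneg m
    nlinarith
  have hQ : ∀ n, GoodN CircleC.IsD n (fun t => toC (Q t)) (Ioo (-2 : ℝ) 2) := by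
    intro n
    exact (hZ.goodN_displacement n).precomp (ContinuousLinearMap.toSpanSingleton ℝ u₀) hmem
  have hQs : SmoothCurveOn Q (Ioo (-2 : ℝ) 2) := smoothCurveOn_of_jets (GoodN.jet hQ)
  have hdom : ∀ t ∈ Ioo (-2 : ℝ) 2, Q t ∈ chartDomain 0 := fun t ht =>
    hZ.displacement_mem_chartDomain (hmem t ht)
  have hq : ∀ t ∈ Ioo (-2 : ℝ) 2, ∀ x, -1 < deriv (Q t) x := fun t ht => (hdom t ht).2.2
  have hv : ∀ t, ∃ v, t ∈ Ioo (-2 : ℝ) 2 → HasDirDerivAt Q v t 1 := by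
    intro t
    by_cases ht : t ∈ Ioo (-2 : ℝ) 2
    · obtain ⟨v, hv⟩ := exists_hasDirDerivAt_of_jets fun k =>
        ((hQs k).differentiableOn (by simp)).differentiableAt (isOpen_Ioo.mem_nhds ht)
      exact ⟨v, fun _ => hv⟩
    · exact ⟨0, fun h => absurd h ht⟩
  choose v hv using hv
  have hcoord : ∀ t ∈ Ioo (-2 : ℝ) 2, coord (Q t) = Z (t • m) PathC.endTime := by
    intro t ht
    refine coord_eq_of_toC_eq ?_
    rw [hZ.toC_displacement (hmem t ht), map_smul]
    rfl
  have hvel : ∀ t ∈ Ioo (-2 : ℝ) 2, toC (v t) = CircleC.vel b (coord (Q t)) m := by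
    intro t ht
    have h1 : HasDerivAt (fun s => toC (Q s)) (toC (v t)) t := hasDerivAt_toC (hv t ht)
    have h2 := (CircleC.resP.hasFDerivAt (x := Z (t • m) PathC.endTime)).comp_hasDerivAt t
      (hZ.hasDerivAt_endTime hu ht)
    rw [← hcoord t ht, CircleC.field_eq, CircleC.resP_of_isD (CircleC.isD_vel b _ m)] at h2
    refine h1.unique (h2.congr_of_eventuallyEq ?_)
    filter_upwards [isOpen_Ioo.mem_nhds ht] with s hs
    rw [Function.comp_apply, ← hcoord s hs, resP_coord]
  let u : ℝ → CircleFun := fun s => rightComp (param (Q s))⁻¹ (v s)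
  have huv : ∀ t ∈ Ioo (-2 : ℝ) 2, compAdd (u t) (Q t) = v t := fun t ht =>
    compAdd_rightComp_inv (hq t ht) (v t)
  have hcons : ∀ t ∈ Ioo (-2 : ℝ) 2, ∀ x : ℝ,
      opA (u t) (x + Q t x) * (1 + dx (Q t) x) ^ b = m (x : UnitAddCircle) := by
    intro t ht
    refine (compAdd_opA_iff (hq t ht)).1 (compAdd_opA_of_vel (hq t ht) ?_)
    rw [huv t ht, hvel t ht]
  have h0 : (0 : ℝ) ∈ Ioo (-2 : ℝ) 2 := by constructor <;> norm_num
  have hQ0 : Q 0 = 0 := by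
    change displacement Z ((0 : ℝ) • u₀) = 0
    rw [zero_smul, hZ.displacement_zero]
  have hv0 : v 0 = u₀ := by
    refine toC_injective ?_
    have hc : coord 0 = 0 := by simp [coord]
    rw [hvel 0 h0, hQ0, hc, CircleC.vel_zero, hm, momentum_apply,
      resP_resM_toC_opA]
  refine ⟨-2, 2, by norm_num, by norm_num, fun t => param (Q t), ⟨smoothOnInto_param isOpen_Ioo hQ hdom fun _ _ => rfl, v,
    fun t ht => hasVelocityAt_param (hv t ht) (hq t ht), fun t ht => ?_⟩, ?_, ?_, ?_⟩
  · obtain ⟨u', hu'⟩ := exists_hasDirDerivAt_rightComp isOpen_Ioo hQs hv hq ht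
    refine (hasCovDerivAt_self_iff hu').2 (CircleFun.ext' fun y => ?_)
    obtain ⟨x, rfl⟩ := surjective_add (hq t ht) y
    have h1 := hasDerivAt_transport b (u := u) (by rw [huv t ht]; exact hv t ht) hu' (hq t ht) x
    have h2 : HasDerivAt (fun s => opA (u s) (x + Q s x) * (1 + dx (Q s) x) ^ b) 0 t := by
      refine (hasDerivAt_const t (m (x : UnitAddCircle))).congr_of_eventuallyEq ?_
      filter_upwards [isOpen_Ioo.mem_nhds ht] with s hs using hcons s hs x
    have h3 : 0 < 1 + dx (Q t) x := by
      have : -1 < dx (Q t) x := hq t ht x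
      linarith
    exact (mul_eq_zero.1 (h1.unique h2)).resolve_right (Real.rpow_pos_of_pos h3 b).ne'
  · change param (Q 0) = 1
    rw [hQ0, param_zero]
  · have := hasVelocityAt_param (hv 0 h0) (hq 0 h0)
    rwa [hv0] at this
  · change param (displacement Z ((1 : ℝ) • u₀)) = _
    rw [one_smul]

end IsSolutionMap

/-! ### Uniqueness of geodesics -/

theorem exists_lipschitzOnWith_left {E F G : Type*} [NormedAddCommGroup E] [NormedSpace ℝ E]
    [NormedAddCommGroup F] [NormedSpace ℝ F] [NormedAddCommGroup G] [NormedSpace ℝ G] {f : E × F → G}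
    {O : Set E} (hO : IsOpen O) (hf : ContDiffOn ℝ ω f (O ×ˢ univ)) (y : F) {x : E} (hx : x ∈ O) :
    ∃ K, ∃ s ∈ 𝓝 x, LipschitzOnWith K (fun z => f (z, y)) s := by
  have h1 : ContDiffOn ℝ ω (fun z => f (z, y)) O :=
    hf.comp (contDiffOn_id.prodMk contDiffOn_const) fun z hz => ⟨hz, mem_univ _⟩
  exact ((h1.contDiffAt (hO.mem_nhds hx)).of_le (by simp)).exists_lipschitzOnWith

theorem CircleC.exists_lipschitzOnWith_field (b : ℝ) (m : CircleC) {z : CircleC} (hz : z ∈ dom) :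
    ∃ K, ∃ s ∈ 𝓝 z, LipschitzOnWith K (fun z => field b z m) s := by
  have := exists_lipschitzOnWith_left isOpen_dom (contDiffOn_field b) m hz
  exact this

namespace CircleDiff

open CircleFun

/-- The conserved quantity `((A u) ∘ φ) φₓ^b`. -/
def lagMomentum (b : ℝ) (φ : CircleDiff) (u : CircleFun) (x : ℝ) : ℝ :=
  opA u (φ.lift x) * (deriv φ.lift x) ^ b

theorem lagMomentum_param (b : ℝ) {q : CircleFun} (hq : ∀ x, -1 < deriv q x) (u : CircleFun) (x : ℝ) :
    lagMomentum b (param q) u x = opA u (x + q x) * (1 + dx q x) ^ b := by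
  obtain ⟨n, hn⟩ := (param q).lift_spec.exists_int (param_spec hq)
  have h1 : HasDerivAt (param q).lift (1 + dx q x) x := by
    rw [funext hn]
    exact ((hasDerivAt_id x).add (q.hasDerivAt x)).add_const _
  rw [lagMomentum, h1.deriv, hn, periodic_int]

theorem zero_mem_chartDomain : (0 : CircleFun) ∈ chartDomain 0 := by
  have h : ((0 : CircleFun) 0) = 0 := rfl
  refine ⟨by rw [h]; norm_num, by rw [h]; norm_num, fun x => ?_⟩
  change -1 < dx 0 x
  rw [map_zero]
  exact neg_one_lt_zero

theorem HasVelocityAt.unique {φ : ℝ → CircleDiff} {v w : CircleFun} {t : ℝ} (hv : HasVelocityAt φ v t)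
    (hw : HasVelocityAt φ w t) : v = w := by
  obtain ⟨j, hj⟩ := exists_mem_chartImage (φ t)
  exact tendsto_nhds_unique (hv j hj) (hw j hj)

theorem eq_of_toC_chart {j : Fin 2} {φ ψ : CircleDiff} (hφ : φ ∈ chartImage j) (hψ : ψ ∈ chartImage j)
    (h : coord (chart j φ) = coord (chart j ψ)) : φ = ψ := by
  rw [← param_chart hφ, ← param_chart hψ]
  congr 1
  refine toC_injective ?_
  rw [← resP_coord, h, resP_coord]

section Geodesic

variable {b : ℝ} {φ : ℝ → CircleDiff} {v : ℝ → CircleFun} {J : Set ℝ} (hJ : IsOpen J)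
  (hφ : ContinuousOn φ J) (hv : ∀ t ∈ J, HasVelocityAt φ (v t) t)

include hJ hφ

theorem eventually_mem_chartImage {t : ℝ} (ht : t ∈ J) {j : Fin 2} (hj : φ t ∈ chartImage j) :
    ∀ᶠ s in 𝓝 t, s ∈ J ∧ φ s ∈ chartImage j :=
  Eventually.and (hJ.mem_nhds ht)
    ((hφ.continuousAt (hJ.mem_nhds ht)).eventually ((isOpen_chartImage j).mem_nhds hj))

theorem compAdd_chart {t : ℝ} {j : Fin 2} (hj : φ t ∈ chartImage j) :
    compAdd (rightComp (φ t)⁻¹ (v t)) (chart j (φ t)) = v t := by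
  have h := compAdd_rightComp_inv (mem_chartDomain.1 (chart_mem hj)).2 (v t)
  rwa [param_chart hj] at h

include hv

variable (hg : ∀ t ∈ J, HasCovDerivAt b (fun s => rightComp (φ s)⁻¹ (v s))
  (fun s => rightComp (φ s)⁻¹ (v s)) 0 t)

include hg

theorem hasDerivAt_lagMomentum {t : ℝ} (ht : t ∈ J) (x : ℝ) :
    HasDerivAt (fun s => lagMomentum b (φ s) (rightComp (φ s)⁻¹ (v s)) x) 0 t := by
  obtain ⟨j, hj⟩ := exists_mem_chartImage (φ t)
  obtain ⟨u', hu', -⟩ := id (hg t ht)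
  have h1 := (hasCovDerivAt_self_iff hu').1 (hg t ht)
  have h2 := hasDerivAt_transport b (Q := fun s => chart j (φ s)) (u := fun s => rightComp (φ s)⁻¹ (v s))
    (by rw [compAdd_chart hJ hφ hj]; exact hv t ht j hj) hu' (mem_chartDomain.1 (chart_mem hj)).2 x
  rw [h1] at h2
  have h3 : (0 : CircleFun) (x + chart j (φ t) x) = 0 := rfl
  rw [h3, zero_mul] at h2
  refine h2.congr_of_eventuallyEq ?_
  filter_upwards [eventually_mem_chartImage hJ hφ ht hj] with s hs
  have h4 := lagMomentum_param b (mem_chartDomain.1 (chart_mem hs.2)).2 (rightComp (φ s)⁻¹ (v s)) x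
  rwa [param_chart hs.2] at h4

theorem lagMomentum_eq (hJc : IsPreconnected J) (h0 : (0 : ℝ) ∈ J) (hφ0 : φ 0 = 1) {u₀ : CircleFun}
    (hu₀ : HasVelocityAt φ u₀ 0) {t : ℝ} (ht : t ∈ J) (x : ℝ) :
    lagMomentum b (φ t) (rightComp (φ t)⁻¹ (v t)) x = opA u₀ x := by
  have h1 := hJ.is_const_of_deriv_eq_zero hJc
    (fun s hs => (hasDerivAt_lagMomentum hJ hφ hv hg hs x).differentiableAt.differentiableWithinAt)
    (fun s hs => (hasDerivAt_lagMomentum hJ hφ hv hg hs x).deriv) ht h0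
  have hq := (mem_chartDomain.1 zero_mem_chartDomain).2
  have h2 : rightComp (φ 0)⁻¹ (v 0) = u₀ := by
    have h3 := compAdd_rightComp_inv hq (v 0)
    rw [param_zero, ← hφ0, (hv 0 h0).unique hu₀] at h3
    rw [(hv 0 h0).unique hu₀]
    conv_rhs => rw [← h3]
    refine CircleFun.ext' fun y => ?_
    rw [compAdd_apply]
    change _ = (rightComp (φ 0)⁻¹ u₀) (y + 0)
    rw [add_zero]
  rw [h1, h2, hφ0, ← param_zero, lagMomentum_param b hq, map_zero]
  change opA u₀ (x + 0) * (1 + 0) ^ b = _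
  rw [add_zero, add_zero, Real.one_rpow, mul_one]

/-- For any geodesic the conserved momentum equals `A u₀`, so it obeys the same ordinary
differential equation in each chart. The argument needs no compatibility of the field with the
change of charts. -/
theorem hasDerivAt_coord (hJc : IsPreconnected J) (h0 : (0 : ℝ) ∈ J) (hφ0 : φ 0 = 1) {u₀ : CircleFun}
    (hu₀ : HasVelocityAt φ u₀ 0) {t : ℝ} (ht : t ∈ J) {j : Fin 2} (hj : φ t ∈ chartImage j) :
    HasDerivAt (fun s => coord (chart j (φ s)))
      (CircleC.field b (coord (chart j (φ t))) (momentum u₀)) t := by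
  have hq := (mem_chartDomain.1 (chart_mem hj)).2
  have h1 := hv t ht j hj
  have h2 : HasDerivAt (fun s => coord (chart j (φ s))) (coord (v t)) t := by
    have h3 := (hasDirDerivAt_one_iff.1 h1 0).add (hasDirDerivAt_one_iff.1 h1 1)
    simp only [jet_succ, jet_zero] at h3
    exact h3
  convert! h2 using 1
  rw [← compAdd_chart (v := v) hJ hφ hj]
  refine (coord_compAdd_eq_field ((compAdd_opA_iff hq).2 fun x => ?_)).symm
  rw [← lagMomentum_param b hq, param_chart hj, lagMomentum_eq hJ hφ hv hg hJc h0 hφ0 hu₀ ht]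
  exact (toC_coe _ _).symm

end Geodesic

/-- The set of times at which the geodesics agree is open by local uniqueness for the Lipschitz
equation in a chart. It is closed in `J` because evaluations are continuous and separate points, and
`J` is connected. -/
theorem geodesic_unique {b : ℝ} {φ ψ : ℝ → CircleDiff} {J : Set ℝ} (hJ : IsOpen J)
    (hJc : IsPreconnected J) (h0 : (0 : ℝ) ∈ J)
    (hφc : ContinuousOn φ J) (hψc : ContinuousOn ψ J) {v w : ℝ → CircleFun}
    (hv : ∀ t ∈ J, HasVelocityAt φ (v t) t) (hw : ∀ t ∈ J, HasVelocityAt ψ (w t) t)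
    (hg : ∀ t ∈ J, HasCovDerivAt b (fun s => rightComp (φ s)⁻¹ (v s))
      (fun s => rightComp (φ s)⁻¹ (v s)) 0 t)
    (hk : ∀ t ∈ J, HasCovDerivAt b (fun s => rightComp (ψ s)⁻¹ (w s))
      (fun s => rightComp (ψ s)⁻¹ (w s)) 0 t)
    (hφ0 : φ 0 = 1) (hψ0 : ψ 0 = 1) {u₀ : CircleFun} (huφ : HasVelocityAt φ u₀ 0)
    (huψ : HasVelocityAt ψ u₀ 0) : ∀ t ∈ J, φ t = ψ t := by
  have hopen : IsOpen {t | t ∈ J ∧ φ t = ψ t} := by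
    rw [isOpen_iff_eventually]
    rintro t ⟨ht, heq⟩
    obtain ⟨j, hj⟩ := exists_mem_chartImage (φ t)
    have hj' : ψ t ∈ chartImage j := heq ▸ hj
    have hdom := coord_mem_dom (mem_chartDomain.1 (chart_mem hj)).2
    obtain ⟨K, s, hs, hL⟩ := CircleC.exists_lipschitzOnWith_field b (momentum u₀) hdom
    have e1 := eventually_mem_chartImage hJ hφc ht hj
    have e2 := eventually_mem_chartImage hJ hψc ht hj'
    have d1 : ∀ r, r ∈ J ∧ φ r ∈ chartImage j → _ := fun r hr =>
      hasDerivAt_coord hJ hφc hv hg hJc h0 hφ0 huφ hr.1 hr.2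
    have d2 : ∀ r, r ∈ J ∧ ψ r ∈ chartImage j → _ := fun r hr =>
      hasDerivAt_coord hJ hψc hw hk hJc h0 hψ0 huψ hr.1 hr.2
    have m1 := (d1 t ⟨ht, hj⟩).continuousAt.eventually hs
    have hs' : s ∈ 𝓝 (coord (chart j (ψ t))) := heq ▸ hs
    have m2 := (d2 t ⟨ht, hj'⟩).continuousAt.eventually hs'
    have key := ODE_solution_unique_of_eventually (v := fun _ z => CircleC.field b z (momentum u₀))
      (s := fun _ => s) (K := K) (t₀ := t) (Eventually.of_forall fun _ => hL)
      (by filter_upwards [e1, m1] with r hr hm using ⟨d1 r hr, hm⟩)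
      (by filter_upwards [e2, m2] with r hr hm using ⟨d2 r hr, hm⟩) (by rw [heq])
    filter_upwards [key, e1, e2] with r hr h1 h2
    exact ⟨h1.1, eq_of_toC_chart h1.2 h2.2 hr⟩
  have hsub : J ⊆ {t | t ∈ J ∧ φ t = ψ t} := by
    refine hJc.subset_of_closure_inter_subset hopen ⟨0, h0, h0, hφ0.trans hψ0.symm⟩ ?_
    rintro t ⟨htc, ht⟩
    refine ⟨ht, ext' fun θ => ?_⟩
    obtain ⟨x, rfl⟩ := QuotientAddGroup.mk_surjective θ
    have c1 := (continuous_apply x).continuousAt.comp (hφc.continuousAt (hJ.mem_nhds ht))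
    have c2 := (continuous_apply x).continuousAt.comp (hψc.continuousAt (hJ.mem_nhds ht))
    refine tendsto_nhds_unique_of_frequently_eq c1 c2 ?_
    refine (mem_closure_iff_frequently.1 htc).mono fun s hs => ?_
    rw [Function.comp_apply, Function.comp_apply, hs.2]
  exact fun t ht => (hsub ht).2

theorem IsTimeOne.unique {b : ℝ} {u₀ : CircleFun} {φ ψ : CircleDiff} (hφ : IsTimeOne b u₀ φ)
    (hψ : IsTimeOne b u₀ ψ) : φ = ψ := by
  obtain ⟨α, β, hα, hβ, f, ⟨hfs, v, hv, hg⟩, hf0, hfu, rfl⟩ := hφ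
  obtain ⟨α', β', hα', hβ', g, ⟨hgs, w, hw, hk⟩, hg0, hgu, rfl⟩ := hψ
  have s1 : Ioo (max α α') (min β β') ⊆ Ioo α β := Ioo_subset_Ioo (le_max_left _ _) (min_le_left _ _)
  have s2 : Ioo (max α α') (min β β') ⊆ Ioo α' β' := Ioo_subset_Ioo (le_max_right _ _) (min_le_right _ _)
  have h1 : (1 : ℝ) ∈ Ioo (max α α') (min β β') :=
    ⟨max_lt (hα.trans zero_lt_one) (hα'.trans zero_lt_one), lt_min hβ hβ'⟩
  have h0 : (0 : ℝ) ∈ Ioo (max α α') (min β β') :=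
    ⟨max_lt hα hα', lt_min (zero_lt_one.trans hβ) (zero_lt_one.trans hβ')⟩
  exact geodesic_unique isOpen_Ioo isPreconnected_Ioo h0 (hfs.1.mono s1) (hgs.1.mono s2)
    (fun t ht => hv t (s1 ht)) (fun t ht => hw t (s2 ht)) (fun t ht => hg t (s1 ht))
    (fun t ht => hk t (s2 ht)) hf0 hg0 hfu hgu 1 h1

theorem isTimeOne_iff {b : ℝ} {u₀ : CircleFun} {φ : CircleDiff} (h : IsTimeOne b u₀ φ) :
    expMap b u₀ = φ ∧ ∀ ψ, IsTimeOne b u₀ ψ ↔ ψ = expMap b u₀ := by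
  have hex : ∃ ψ, IsTimeOne b u₀ ψ := ⟨φ, h⟩
  have h1 : IsTimeOne b u₀ (expMap b u₀) := by
    rw [expMap, dif_pos hex]
    exact hex.choose_spec
  exact ⟨h1.unique h, fun ψ => ⟨fun hψ => hψ.unique h1, fun hψ => hψ ▸ h1⟩⟩

end CircleDiff

/-! ### The exponential map -/

namespace CircleDiff

open CircleFun

theorem goodN_momentum_chartRep (n : ℕ) (j : Fin 2) {U : Set CircleFun}
    (h : ∀ w ∈ U, Int.fract (w 0 - chartBase j) ≠ 0) :
    GoodN CircleC.IsD n (fun w => momentum (chartRep j w)) U := by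
  have e : ∀ w : CircleFun, toC w ((0 : ℝ) : UnitAddCircle) = w 0 := fun w => toC_coe _ _
  have hb : BSmoothOn (fun w : CircleFun => toC w) U :=
    BSmoothOn.clm (⟨toC.toLinearMap, continuous_toC⟩ : CircleFun →L[ℝ] CircleC) U
  refine (GoodN.add CircleC.derivRel (goodN_momentum n U) (goodN_floor hb (chartBase j)
    (fun w hw => by rw [e]; exact h w hw) n)).congr fun w _ => ?_
  have hc : ∀ c, momentum (const c) = algebraMap ℝ CircleC c := fun c => by
    rw [momentum_apply, ← toC_const]
    change toC (const c - dx (dx (const c))) = _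
    rw [dx_const, map_zero, sub_zero]
  rw [chartRep, map_add, hc, e]

end CircleDiff

end

open CircleDiff CircleFun in
theorem theorem6p1 (b : ℝ) :
    ∃ e : OpenPartialHomeomorph CircleFun CircleDiff,
      (0 : CircleFun) ∈ e.source ∧ (1 : CircleDiff) ∈ e.target ∧
      (∀ u ∈ e.source, ∀ ψ : CircleDiff, CircleDiff.IsTimeOne b u ψ ↔ ψ = CircleDiff.expMap b u) ∧
      (∀ u ∈ e.source, e u = CircleDiff.expMap b u) ∧
      CircleDiff.SmoothOnInto (CircleDiff.expMap b) e.source ∧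
      CircleDiff.SmoothOnFrom e.symm e.target := by
  obtain ⟨ρ, ε, Z, hZ⟩ := exists_isSolutionMap b
  obtain ⟨f, hf0, hfs, hf, hfc⟩ := hZ.exists_localInverse
  have hball : ∀ u : CircleFun, momentum u ∈ f.source → momentum u ∈ Metric.ball (0 : CircleC) ρ :=
    fun u hu => hZ.ball_half_subset (hfs hu)
  have hgeo : ∀ u, momentum u ∈ f.source → IsTimeOne b u (param (displacement Z u)) :=
    fun u hu => hZ.exists_geodesic (hfs hu)
  have hexp : ∀ u, momentum u ∈ f.source → expMap b u = param (displacement Z u) :=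
    fun u hu => (isTimeOne_iff (hgeo u hu)).1
  have hdisp : ∀ u, momentum u ∈ f.source → displacement Z u ∈ chartDomain 0 ∧
      momentum (displacement Z u) ∈ f.target := fun u hu =>
    ⟨hZ.displacement_mem_chartDomain (hball u hu), by
      rw [hZ.momentum_displacement_eq hfs hf hu]
      exact f.map_source hu⟩
  have hinv : ∀ ψ, momentum ψ ∈ f.target → momentum (invDisplacement f ψ) ∈ f.source ∧
      displacement Z (invDisplacement f ψ) = ψ := fun ψ hψ =>
    ⟨by rw [hZ.momentum_invDisplacement hfs hf hfc hψ]; exact f.map_target hψ,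
      hZ.displacement_invDisplacement hfs hf hfc hψ⟩
  -- Every such `ψ` is itself a displacement, hence lies in chart `0`, where `param` is injective
  -- and open.
  have hsub : momentum ⁻¹' f.target ⊆ chartDomain 0 := fun ψ hψ => by
    rw [← (hinv ψ hψ).2]
    exact (hdisp _ (hinv ψ hψ).1).1
  have hsrc : IsOpen (momentum ⁻¹' f.source) := f.open_source.preimage momentum.continuous
  have htgt : IsOpen (momentum ⁻¹' f.target) := f.open_target.preimage momentum.continuous
  have hsmooth : SmoothOnInto (expMap b) (momentum ⁻¹' f.source) :=
    smoothOnInto_param hsrc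
      (fun n => (hZ.goodN_displacement n).precomp (ContinuousLinearMap.id ℝ CircleFun) hball)
      (fun u hu => (hdisp u hu).1) hexp
  have hinvc : ContinuousOn (invDisplacement f) (momentum ⁻¹' f.target) :=
    CircleFun.continuousOn_iff.2 fun k => (GoodN.jet
      (fun n => hZ.goodN_invDisplacement hfs hf hfc (P := id) (fun _ h => h)
        (fun n => goodN_momentum n _) n) k).continuousOn
  have hopen : IsOpen (param '' (momentum ⁻¹' f.target)) := isOpen_image htgt hsub
  have htc : ∀ φ ∈ param '' (momentum ⁻¹' f.target), φ ∈ chartImage 0 ∧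
      momentum (chart 0 φ) ∈ f.target := by
    rintro _ ⟨ψ, hψ, rfl⟩
    exact ⟨⟨ψ, hsub hψ, rfl⟩, by rw [chart_param (hsub hψ)]; exact hψ⟩
  -- The neighbourhoods are the conditions `A u ∈ f.source` and, in chart `0`, `A ψ ∈ f.target`.
  -- They are open already for the `C²`-topology and serve all orders of differentiability.
  refine ⟨{ toFun := expMap b
            invFun := fun φ => invDisplacement f (chart 0 φ)
            source := momentum ⁻¹' f.source
            target := param '' (momentum ⁻¹' f.target)
            map_source' := fun u hu => ⟨displacement Z u, (hdisp u hu).2, (hexp u hu).symm⟩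
            map_target' := fun φ hφ => (hinv _ (htc φ hφ).2).1
            left_inv' := fun u hu => by
              rw [hexp u hu, chart_param (hdisp u hu).1, hZ.invDisplacement_displacement hfs hf hu]
            right_inv' := fun φ hφ => by
              rw [hexp _ (hinv _ (htc φ hφ).2).1, (hinv _ (htc φ hφ).2).2, param_chart (htc φ hφ).1]
            open_source := hsrc
            open_target := hopen
            continuousOn_toFun := hsmooth.1
            continuousOn_invFun := hinvc.comp ((continuousOn_chart 0).mono fun φ hφ => (htc φ hφ).1)
              fun φ hφ => (htc φ hφ).2 }, ?_, ?_, ?_, fun _ _ => rfl, hsmooth, ?_⟩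
  · change momentum 0 ∈ f.source
    rwa [map_zero]
  · have h0 : momentum 0 ∈ f.source := by rwa [map_zero]
    have h1 := (hdisp 0 h0).2
    rw [hZ.displacement_zero] at h1
    exact ⟨0, h1, param_zero⟩
  · exact fun u hu => (isTimeOne_iff (hgeo u hu)).2
  -- In chart `j` the inverse is composed with the passage to the representative in chart `0`, an
  -- integer shift that is locally constant on the set in question.
  · intro j n
    have hO := (continuousOn_param j).isOpen_inter_preimage (isOpen_chartDomain j) hopen
    have hn : ∀ w ∈ chartDomain j ∩ param ⁻¹' (param '' (momentum ⁻¹' f.target)),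
        Int.fract (w 0 - chartBase 0) ≠ 0 ∧ chartRep 0 w = chart 0 (param w) :=
      fun w hw => chartRep_eq (mem_chartDomain.1 hw.1).2 (htc _ hw.2).1
    refine isClassC_of_jets hO (fun k => GoodN.jet (fun n => ?_) k) n
    refine (hZ.goodN_invDisplacement hfs hf hfc (P := chartRep 0) (fun w hw => ?_)
      (fun n => goodN_momentum_chartRep n 0 fun w hw => (hn w hw).1) n).congr fun w hw => ?_
    · rw [(hn w hw).2]
      exact (htc _ hw.2).2
    · rw [(hn w hw).2]
      rfl
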